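/- Let $d\ge 1$, $T>0$, $\beta>0$, and let $G:\mathbb{R}^d\to\mathbb{R}$ be bounded from below and such that, for some constants $C>0$, $p>0$, $$|G(w)-G(v)|\le C\,(1+|v|^p+|w-v|^p)\,|w-v|\qquad\text{for all } v,w\in\mathbb{R}^d$$ (in the application, $G=\frac{\beta}{4}|\nabla V|^2-\frac12\Delta V$ for the bridge, pinned at $0$ at times $0$ and $T$, of the diffusion $dX=-\nabla V(X)\,dt+\sqrt{2/\beta}\,dW$). For $N\ge 1$ put $n=dN$, $\Delta t=T/(N+1)$ and, for $1\le i,t\le N$, $$e_{i,t}=\sqrt{\tfrac2T}\,\sin\Big(\frac{i\pi t}{N+1}\Big),\qquad \lambda_{i,n}^2=\frac{T^2}{2\beta}\Big(\sin\Big(\frac{i\pi}{2(N+1)}\Big)(N+1)\Big)^{-2}$$ (the eigenvectors and eigenvalues of $-L^{-1}$, where $L$ is $\beta/2$ times the discrete Dirichlet Laplacian of mesh $\Delta t$). For $x=(x_{\cdot,1},\dots,x_{\cdot,N})\in\mathbb{R}^{n}$ with $x_{\cdot,i}\in\mathbb{R}^d$ let $X_t=\sum_{i=1}^N x_{\cdot,i}\,e_{i,t}$,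 and let $\pi_n$ be the probability measure $$\frac{d\pi_n}{d\tilde\pi_n}(x)\propto\exp\Big\{-\sum_{t=1}^N G(X_t)\Delta t\Big\},\qquad \tilde\pi_n=\prod_{i=1}^N\prod_{j=1}^d\mathcal N(0,\lambda_{i,n}^2).$$ Consider the Metropolis–Hastings chain with target $\pi_n$ in stationarity, $x\sim\pi_n$, with one of the two proposals $$\text{RWM: } y=x+\sigma_nZ,\qquad \text{SLA: } y=x+\tfrac{\sigma_n^2}{2}\nabla\log\tilde\pi_n(x)+\sigma_nZ,\qquad Z\sim\mathcal N(0,I_n)\text{ independent of }x,$$ where $\sigma_n^2=l^2n^{-\rho}$ with $l,\rho>0$. Let $a_n(x,y)$ be its acceptance probability, $x'$ its state after one step from $x$, and $S_n=E[(x'_{i^*}-x_{i^*})^2]$ for an arbitrary fixed coordinate $i^*$; these expectations are finite. Put $\kappa=1$, $I=1$ for RWM and $I=1/3$ for SLA, and $$\tau^{\rm RWM}=\frac{\beta}{T^2d^2},\qquad \tau^{\rm SLA}=\frac{5\beta^3}{2T^6d^6},$$ $$a^{\rm RWM}(l)=2\Phi\Big(-\frac l2\sqrt{K^{\rm RWM}\tau^{\rm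 RWM}}\Big),\qquad a^{\rm SLA}(l)=2\Phi\Big(-\frac{l^3}2\sqrt{K^{\rm SLA}\tau^{\rm SLA}}\Big),$$ where $\Phi$ is the standard normal distribution function and, with $g=-\log f$ for the standard normal density $f$, $K^{\rm RWM}=E_f[(g')^2]=1$ and $K^{\rm SLA}=E_f[3(g'')^3+5(g''')^2]/48=1/16$. Then, for RWM and for SLA, as $N\to\infty$ (so $n=dN\to\infty$): (i) if $\rho=2\kappa+I$, then $E[a_n(x,y)]\to a(l)$ and $S_n=l^2a(l)\,n^{-2\kappa-I}+o(n^{-2\kappa-I})$; (ii) if $\rho>2\kappa+I$, then $E[a_n(x,y)]\to1$ and $S_n=l^2n^{-\rho}+o(n^{-\rho})$; (iii) if $2\kappa<\rho<2\kappa+I$, then $n^pE[a_n(x,y)]\to0$ and $S_n=\mathcal O(n^{-p})$ for every $p\ge0$. -/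

import Mathlib

open MeasureTheory ProbabilityTheory Filter Asymptotics
open scoped Topology

noncomputable section

namespace DiffusionBridge

/-! ### The finite-difference target -/

/-- The state space `ℝⁿ`, `n = d * N`: a point is the family of Karhunen-Loève coefficients
`x (i, j)`, the `j`-th component of the vector multiplying the `i`-th eigenvector.
The index `i : Fin N` stands for the frequency `i + 1`. -/
abbrev State (d N : ℕ) : Type := Fin N × Fin d → ℝ

/-- `G` is bounded from below, and locally Lipschitz with polynomially growing constant. -/
def GrowthCondition {d : ℕ} (G : EuclideanSpace ℝ (Fin d) → ℝ) : Prop :=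
  (∃ m : ℝ, ∀ v, m ≤ G v) ∧
    ∃ C p : ℝ, 0 < C ∧ 0 < p ∧ ∀ v w : EuclideanSpace ℝ (Fin d),
      |G w - G v| ≤ C * (1 + ‖v‖ ^ p + ‖w - v‖ ^ p) * ‖w - v‖

/-- The mesh `Δt = T / (N + 1)`. -/
def mesh (T : ℝ) (N : ℕ) : ℝ := T / (N + 1)

/-- The `t`-th entry of the `i`-th eigenvector of the discrete Dirichlet Laplacian
(`i` and `t` count from `0` here, from `1` in the formula). -/
def eigenvector (T : ℝ) (N : ℕ) (i t : Fin N) : ℝ :=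
  Real.sqrt (2 / T) *
    Real.sin (((i : ℕ) + 1 : ℝ) * Real.pi * ((t : ℕ) + 1 : ℝ) / (N + 1))

/-- The eigenvalue `λ²` of the covariance, i.e. of minus the inverse of `β / 2` times the discrete
Dirichlet Laplacian, for the `i`-th eigenvector. -/
def eigenvalue (T β : ℝ) (N : ℕ) (i : Fin N) : ℝ :=
  T ^ 2 / (2 * β) *
    ((Real.sin (((i : ℕ) + 1 : ℝ) * Real.pi / (2 * (N + 1))) * (N + 1)) ^ 2)⁻¹

/-- The discrete path `X_t = ∑ i, x_{·,i} e_{i,t}` with values in `ℝ^d`. -/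
def path {d N : ℕ} (T : ℝ) (x : State d N) (t : Fin N) : EuclideanSpace ℝ (Fin d) :=
  WithLp.toLp 2 fun j => ∑ i : Fin N, x (i, j) * eigenvector T N i t

/-- The functional `∑ t, G (X_t) Δt`. -/
def potential {d N : ℕ} (T : ℝ) (G : EuclideanSpace ℝ (Fin d) → ℝ) (x : State d N) : ℝ :=
  ∑ t : Fin N, G (path T x t) * mesh T N

/-- The Lebesgue density of the Gaussian product reference law. -/
def refDensity {d N : ℕ} (T β : ℝ) (x : State d N) : ℝ :=
  ∏ k : Fin N × Fin d, gaussianPDFReal 0 (eigenvalue T β N k.1).toNNReal (x k)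

/-- The reference law: independent coordinates `x (i, j) ∼ N(0, λ_i²)`. -/
def reference (d N : ℕ) (T β : ℝ) : Measure (State d N) :=
  Measure.pi fun k => gaussianReal 0 (eigenvalue T β N k.1).toNNReal

/-- The Lebesgue density of the target. -/
def targetDensity {d N : ℕ} (T β : ℝ) (G : EuclideanSpace ℝ (Fin d) → ℝ)
    (x : State d N) : ℝ :=
  Real.exp (-potential T G x) / (∫ z, Real.exp (-potential T G z) ∂(reference d N T β)) *
    refDensity T β x

/-- The target law: density proportional to `exp (-potential)` with respect to the reference
law. -/
def target {d : ℕ} (N : ℕ) (T β : ℝ) (G : EuclideanSpace ℝ (Fin d) → ℝ) :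
    Measure (State d N) :=
  (reference d N T β).tilted fun x => -potential T G x

/-! ### The two algorithms -/

/-- Random-walk Metropolis, and the simplified Langevin algorithm. -/
inductive Algorithm : Type
  | RWM : Algorithm
  | SLA : Algorithm

/-- The mean of the proposal from `x` with step-size `σ`: it is `x` for RWM and
`x + (σ² / 2) ∇ log (refDensity x)` for SLA. -/
def proposalMean {d N : ℕ} (T β : ℝ) : Algorithm → ℝ → State d N → State d N
  | .RWM, _, x => x
  | .SLA, σ, x => fun k =>
      x k + σ ^ 2 / 2 *
        deriv (fun u : ℝ => Real.log (refDensity T β (Function.update x k u))) (x k)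

/-- The proposal `y = proposalMean x + σ z`, where `z` will be standard Gaussian. -/
def proposal {d N : ℕ} (T β : ℝ) (alg : Algorithm) (σ : ℝ) (x z : State d N) : State d N :=
  fun k => proposalMean T β alg σ x k + σ * z k

/-- The Lebesgue density at `y` of the proposal from `x`. -/
def proposalDensity {d N : ℕ} (T β : ℝ) (alg : Algorithm) (σ : ℝ) (x y : State d N) : ℝ :=
  ∏ k : Fin N × Fin d, gaussianPDFReal (proposalMean T β alg σ x k) (σ ^ 2).toNNReal (y k)

open Classical in
/-- The Metropolis-Hastings acceptance probability. -/
def acceptance {d N : ℕ} (T β : ℝ) (G : EuclideanSpace ℝ (Fin d) → ℝ) (alg : Algorithm)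
    (σ : ℝ) (x y : State d N) : ℝ :=
  if 0 < targetDensity T β G x * proposalDensity T β alg σ x y then
    min 1 (targetDensity T β G y * proposalDensity T β alg σ y x /
      (targetDensity T β G x * proposalDensity T β alg σ x y))
  else 0

open Classical in
/-- One step of the chain from `x`: with Gaussian noise `z` and an acceptance variable `u`
(uniform on `[0, 1]`), move to the proposal `y` if `u` is at most the acceptance probability, and
stay at `x` otherwise. -/
def nextState {d N : ℕ} (T β : ℝ) (G : EuclideanSpace ℝ (Fin d) → ℝ) (alg : Algorithm)
    (σ : ℝ) (x z : State d N) (u : ℝ) : State d N :=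
  if u ≤ acceptance T β G alg σ x (proposal T β alg σ x z) then proposal T β alg σ x z else x

/-- The joint law of `((x, z), u)` in stationarity: independent `x ∼ target`, `z` standard
Gaussian and `u` uniform on `[0, 1]`. -/
def stationaryLaw {d : ℕ} (N : ℕ) (T β : ℝ) (G : EuclideanSpace ℝ (Fin d) → ℝ) :
    Measure ((State d N × State d N) × ℝ) :=
  ((target N T β G).prod (Measure.pi fun _ => gaussianReal 0 1)).prod
    (volume.restrict (Set.Icc (0 : ℝ) 1))

/-- The step-size: `σ² = l² n^{-ρ}` with `n = d * N`. -/
def stepSize (d N : ℕ) (l ρ : ℝ) : ℝ :=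
  Real.sqrt (l ^ 2 * ((d * N : ℕ) : ℝ) ^ (-ρ))

/-- The average acceptance probability `E[a_n(x, y)]` in stationarity, `n = d * N`. -/
def meanAcceptance {d : ℕ} (T β : ℝ) (G : EuclideanSpace ℝ (Fin d) → ℝ) (alg : Algorithm)
    (l ρ : ℝ) (N : ℕ) : ℝ :=
  ∫ ω, acceptance T β G alg (stepSize d N l ρ) ω.1.1
    (proposal T β alg (stepSize d N l ρ) ω.1.1 ω.1.2) ∂(stationaryLaw N T β G)

/-- The squared jump of the coordinate `k` in one step, as a random variable. -/
def squaredJump {d N : ℕ} (T β : ℝ) (G : EuclideanSpace ℝ (Fin d) → ℝ) (alg : Algorithm)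
    (l ρ : ℝ) (k : Fin N × Fin d) (ω : (State d N × State d N) × ℝ) : ℝ :=
  (nextState T β G alg (stepSize d N l ρ) ω.1.1 ω.1.2 ω.2 k - ω.1.1 k) ^ 2

/-- The mean squared-jump-distance `S_n` in stationarity of the fixed coordinate `(i, j)`,
`n = d * N`. It is only meaningful when the coordinate exists, i.e. for `N > i`. -/
def meanSquaredJump {d : ℕ} (T β : ℝ) (G : EuclideanSpace ℝ (Fin d) → ℝ) (alg : Algorithm)
    (l ρ : ℝ) (i : ℕ) (j : Fin d) (N : ℕ) : ℝ :=
  if h : i < N then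
    ∫ ω, squaredJump T β G alg l ρ ((⟨i, h⟩ : Fin N), j) ω ∂(stationaryLaw N T β G)
  else 0

/-! ### The limits -/

/-- The index `I`. -/
def Algorithm.index : Algorithm → ℝ
  | .RWM => 1
  | .SLA => 1 / 3

/-- `g = -log f` for the standard Gaussian density `f`. -/
def negLogGaussian (u : ℝ) : ℝ := -Real.log (gaussianPDFReal 0 1 u)

/-- The constant `K` of the algorithm for the standard Gaussian density `f`: it is
`E_f[(g')²]` for RWM and `E_f[3 (g'')³ + 5 (g''')²] / 48` for SLA. -/
def Algorithm.K : Algorithm → ℝ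
  | .RWM => ∫ u, (deriv negLogGaussian u) ^ 2 ∂(gaussianReal 0 1)
  | .SLA => (∫ u, (3 * (iteratedDeriv 2 negLogGaussian u) ^ 3 +
      5 * (iteratedDeriv 3 negLogGaussian u) ^ 2) ∂(gaussianReal 0 1)) / 48

/-- The constant `τ` of the algorithm for the finite-difference target. -/
def Algorithm.tau (d : ℕ) (T β : ℝ) : Algorithm → ℝ
  | .RWM => β / (T ^ 2 * (d : ℝ) ^ 2)
  | .SLA => 5 * β ^ 3 / (2 * T ^ 6 * (d : ℝ) ^ 6)

/-- The limiting acceptance probability `a(l)`: it is `2 Φ(-(l / 2) √(K τ))` for RWM and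
`2 Φ(-(l³ / 2) √(K τ))` for SLA, with `Φ` the standard Gaussian distribution function. Here `τ` is
the limit of `n^{-(2κ+1)} ∑ λ^{-2}`, respectively of `n^{-(6κ+1)} ∑ λ^{-6}`, so that it multiplies
`K`. -/
def limitAcceptance (d : ℕ) (T β : ℝ) : Algorithm → ℝ → ℝ
  | .RWM, l => 2 * cdf (gaussianReal 0 1)
      (-(l / 2) * Real.sqrt (Algorithm.RWM.K * Algorithm.RWM.tau d T β))
  | .SLA, l => 2 * cdf (gaussianReal 0 1)
      (-(l ^ 3 / 2) * Real.sqrt (Algorithm.SLA.K * Algorithm.SLA.tau d T β))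

end DiffusionBridge

end

/-! In the coordinates ξ_k = x_k / λ_k the target has a density `weight` with respect to a standard
normal vector. With s_k = σ / λ_k, the part of the Metropolis log-ratio that comes from the
reference law is the diagonal quadratic form ∑ (a_k ξ_k z_k + b_k ξ_k² + c_k z_k²), whose
coefficients are polynomials in s_k (`coord_ratio`).

The function G is harmless for two reasons. It is bounded below and, by Jensen, the partition
function is bounded away from 0, so the weight is bounded uniformly in N (`exists_weight_le`) and
every L¹ estimate under the Gaussian law survives under the target. Moreover one step moves the path
by σ√N times a Gaussian path of bounded variance, and σ²N = O(n^{1-ρ}) tends to 0, so the potential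
changes by o(1) in L¹ (`exists_potentialDrop_le`).

For the quadratic form, let u bound all s_k², so u = O(n^{2-ρ}) tends to 0, and let v = ∑ rate(s_k).
The identity b + c = -rate/2 is exact, a² equals the rate up to a relative error u, and ∑ b², ∑ c²,
∑ a⁴ are all at most u v. Given ξ the bilinear part is exactly normal, with variance ∑ a_k² ξ_k²,
which concentrates near v, while the squares concentrate near -v/2. Thus, when v tends to V, the
log-ratio behaves like N(-V/2, V), and the mean of min(1, exp) of such a variable is 2Φ(-√V/2)
(`abs_integral_acc_quadForm_sub_le`, `integral_acc_gaussian`).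

Closed trigonometric sums show that v is a convergent factor times n^{m(2+I-ρ)}, with m = 1 for RWM
and m = 3 for SLA (`exists_totalRate_eq`). Hence v has a positive limit at the critical ρ and
vanishes above it. Below it v grows polynomially; there min(1, e^R) ≤ e^{R/2}, and an explicit
Gaussian integral gives the bound e^{-v/16} (`integral_acc_logRatio_le`).

The squared jump of one coordinate is σ² (z_k + drift · ξ_k)² on acceptance. The drift is at most
√u, and z_k² - 1 is nearly uncorrelated with acceptance, because a single coordinate has a
negligible share of the log-ratio (`abs_integral_acc_mul_sq_sub_one_le`). So S_n is σ² times the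
mean acceptance, up to a factor error o(1). -/

noncomputable section

namespace DiffusionBridge

/-! ### Standard Gaussian vectors -/

section Gaussian

variable {ι : Type*} [Fintype ι]

/-- The standard normal law on `ι → ℝ`. -/
abbrev stdNormal (ι : Type*) [Fintype ι] : Measure (ι → ℝ) :=
  Measure.pi fun _ => gaussianReal 0 1

lemma map_sum_mul_stdNormal (c : ι → ℝ) :
    (stdNormal ι).map (fun z => ∑ k, c k * z k) = gaussianReal 0 (∑ k, c k ^ 2).toNNReal := by
  have hm : Measurable fun z : ι → ℝ => ∑ k, c k * z k := by fun_prop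
  refine Measure.ext_of_charFun ?_
  ext t
  rw [charFun_apply_real, integral_map hm.aemeasurable (by fun_prop), charFun_gaussianReal]
  have h1 : ∀ z : ι → ℝ, Complex.exp (t * ((∑ k, c k * z k : ℝ) : ℂ) * Complex.I) =
      ∏ k, Complex.exp (((t * c k : ℝ) : ℂ) * (z k : ℂ) * Complex.I) := by
    intro z
    rw [← Complex.exp_sum]
    congr 1
    push_cast
    rw [Finset.mul_sum, Finset.sum_mul]
    exact Finset.sum_congr rfl fun k _ => by ring
  simp_rw [h1]
  rw [integral_fintype_prod_eq_prod (𝕜 := ℂ)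
    (fun k (u : ℝ) => Complex.exp (((t * c k : ℝ) : ℂ) * (u : ℂ) * Complex.I))]
  have h2 : ∀ k, ∫ u : ℝ, Complex.exp (((t * c k : ℝ) : ℂ) * (u : ℂ) * Complex.I)
      ∂(gaussianReal 0 1) = Complex.exp (-((t * c k : ℝ) : ℂ) ^ 2 / 2) := by
    intro k
    rw [← charFun_apply_real, charFun_gaussianReal]
    congr 1
    push_cast
    ring
  simp_rw [h2]
  rw [← Complex.exp_sum]
  congr 1
  rw [Real.coe_toNNReal _ (Finset.sum_nonneg fun k _ => sq_nonneg _)]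
  push_cast
  rw [Finset.sum_mul, Finset.sum_div, mul_zero, zero_mul, zero_sub, ← Finset.sum_neg_distrib]
  exact Finset.sum_congr rfl fun k _ => by ring

lemma integral_comp_sum_mul_stdNormal (c : ι → ℝ) {f : ℝ → ℝ} (hf : Measurable f) :
    ∫ z, f (∑ k, c k * z k) ∂(stdNormal ι) =
      ∫ g, f (Real.sqrt (∑ k, c k ^ 2) * g) ∂(gaussianReal 0 1) := by
  have hm : Measurable fun z : ι → ℝ => ∑ k, c k * z k := by fun_prop
  have h := gaussianReal_map_const_mul (μ := 0) (v := 1) (Real.sqrt (∑ k, c k ^ 2))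
  rw [← integral_map hm.aemeasurable hf.aestronglyMeasurable, map_sum_mul_stdNormal,
    ← integral_map (φ := fun g => Real.sqrt (∑ k, c k ^ 2) * g) (by fun_prop)
      hf.aestronglyMeasurable, h]
  congr 2
  · simp
  · ext
    rw [Real.coe_toNNReal _ (Finset.sum_nonneg fun k _ => sq_nonneg _)]
    simp [Real.sq_sqrt (Finset.sum_nonneg fun k (_ : k ∈ Finset.univ) => sq_nonneg (c k))]

lemma integrable_exp_sum_mul_stdNormal (c : ι → ℝ) :
    Integrable (fun z => Real.exp (∑ k, c k * z k)) (stdNormal ι) := by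
  simp_rw [Real.exp_sum]
  exact Integrable.fintype_prod (f := fun k (u : ℝ) => Real.exp (c k * u))
    fun k => integrable_exp_mul_gaussianReal (c k)

lemma integral_exp_sum_mul_stdNormal (c : ι → ℝ) :
    ∫ z, Real.exp (∑ k, c k * z k) ∂(stdNormal ι) = Real.exp ((∑ k, c k ^ 2) / 2) := by
  simp_rw [Real.exp_sum]
  rw [integral_fintype_prod_eq_prod (𝕜 := ℝ) (fun k (u : ℝ) => Real.exp (c k * u)),
    Finset.sum_div, Real.exp_sum]
  refine Finset.prod_congr rfl fun k _ => ?_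
  have h := mgf_gaussianReal (p := gaussianReal 0 1) (X := id) (μ := 0) (v := 1) (by simp) (c k)
  simp only [mgf, id] at h
  rw [h]
  simp

lemma memLp_id_gaussian (q : ENNReal) (hq : q ≠ ⊤) : MemLp (fun u : ℝ => u) q (gaussianReal 0 1) :=
  memLp_id_gaussianReal' q hq

lemma integrable_pow_gaussian (m : ℕ) : Integrable (fun u : ℝ => u ^ m) (gaussianReal 0 1) := by
  rcases Nat.eq_zero_or_pos m with rfl | hm
  · simp
  · have h := (memLp_id_gaussian (m : ENNReal) (by simp)).integrable_norm_pow hm.ne'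
    refine h.mono' (by fun_prop) (ae_of_all _ fun u => ?_)
    simp

lemma integral_sq_gaussian : ∫ u : ℝ, u ^ 2 ∂(gaussianReal 0 1) = 1 := by
  have h := variance_fun_id_gaussianReal (μ := 0) (v := 1)
  rw [variance_of_integral_eq_zero (by fun_prop) (by simp)] at h
  simpa using h

lemma integral_abs_gaussian_le : ∫ u : ℝ, |u| ∂(gaussianReal 0 1) ≤ 1 := by
  have h : ∫ u : ℝ, |u| ∂(gaussianReal 0 1) ≤ ∫ u : ℝ, (1 + u ^ 2) / 2 ∂(gaussianReal 0 1) := by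
    refine integral_mono ?_ (((integrable_const 1).add (integrable_pow_gaussian 2)).div_const 2)
      fun u => ?_
    · simpa using (integrable_pow_gaussian 1).abs
    · have := sq_nonneg (|u| - 1)
      simp only
      nlinarith [sq_abs u]
  refine h.trans ?_
  rw [integral_div, integral_add (integrable_const 1) (integrable_pow_gaussian 2),
    integral_sq_gaussian]
  simp

/-- The variance of the square of a standard normal variable. -/
def sqVar : ℝ := ∫ u : ℝ, (u ^ 2 - 1) ^ 2 ∂(gaussianReal 0 1)

lemma sqVar_nonneg : 0 ≤ sqVar := integral_nonneg fun _ => sq_nonneg _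

lemma memLp_sq_sub_one : MemLp (fun u : ℝ => u ^ 2 - 1) 2 (gaussianReal 0 1) := by
  rw [memLp_two_iff_integrable_sq (by fun_prop)]
  have : (fun u : ℝ => (u ^ 2 - 1) ^ 2) = fun u => u ^ 4 - 2 * u ^ 2 + 1 := by ext u; ring
  rw [this]
  exact ((integrable_pow_gaussian 4).sub ((integrable_pow_gaussian 2).const_mul 2)).add
    (integrable_const 1)

lemma integral_sq_sub_one : ∫ u : ℝ, (u ^ 2 - 1) ∂(gaussianReal 0 1) = 0 := by
  rw [integral_sub (integrable_pow_gaussian 2) (integrable_const 1), integral_sq_gaussian]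
  simp

lemma sq_integral_abs_le {Ω : Type*} {mΩ : MeasurableSpace Ω} {μ : Measure Ω}
    [IsProbabilityMeasure μ] {X : Ω → ℝ} (hX : MemLp X 2 μ) :
    (∫ ω, |X ω| ∂μ) ^ 2 ≤ ∫ ω, X ω ^ 2 ∂μ := by
  have h := variance_eq_sub hX.abs
  have h0 := variance_nonneg |X| μ
  have h1 : ∫ ω, (|X| ^ 2) ω ∂μ = ∫ ω, X ω ^ 2 ∂μ := by simp
  have h2 : ∫ ω, |X| ω ∂μ = ∫ ω, |X ω| ∂μ := rfl
  rw [h1, h2] at h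
  linarith

/-- The summands are independent and centred, so the second moment is the sum of their variances;
the first absolute moment is then bounded by Cauchy-Schwarz. This is the only concentration estimate
needed for the quadratic forms. -/
lemma integral_abs_sum_sq_sub_one_le (c : ι → ℝ) :
    ∫ z, |∑ k, c k * (z k ^ 2 - 1)| ∂(stdNormal ι) ≤ Real.sqrt (sqVar * ∑ k, c k ^ 2) := by
  have hL : ∀ k, MemLp (fun u : ℝ => c k * (u ^ 2 - 1)) 2 (gaussianReal 0 1) :=
    fun k => memLp_sq_sub_one.const_mul (c k)
  have hL' : ∀ k, MemLp (fun z : ι → ℝ => c k * (z k ^ 2 - 1)) 2 (stdNormal ι) :=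
    fun k => (hL k).comp_measurePreserving (measurePreserving_eval _ k)
  have hS : MemLp (fun z : ι → ℝ => ∑ k, c k * (z k ^ 2 - 1)) 2 (stdNormal ι) :=
    memLp_finsetSum _ fun k _ => hL' k
  refine Real.le_sqrt_of_sq_le ((sq_integral_abs_le hS).trans ?_)
  have h0 : ∫ z, (∑ k, c k * (z k ^ 2 - 1)) ∂(stdNormal ι) = 0 := by
    rw [integral_finsetSum _ fun k _ => (hL' k).integrable (by norm_num)]
    refine Finset.sum_eq_zero fun k _ => ?_
    rw [integral_comp_eval (μ := fun _ : ι => gaussianReal 0 1) (i := k)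
      (f := fun u : ℝ => c k * (u ^ 2 - 1)) (by fun_prop), integral_const_mul, integral_sq_sub_one,
      mul_zero]
  have hv := variance_sum_pi (μ := fun _ : ι => gaussianReal 0 1)
    (X := fun k (u : ℝ) => c k * (u ^ 2 - 1)) hL
  have he : (∑ k, fun z : ι → ℝ => c k * (z k ^ 2 - 1)) = fun z => ∑ k, c k * (z k ^ 2 - 1) := by
    ext z; simp
  rw [he, variance_of_integral_eq_zero hS.1.aemeasurable h0] at hv
  rw [hv, Finset.mul_sum]
  refine (Finset.sum_congr rfl fun k _ => ?_).le
  rw [variance_const_mul, variance_of_integral_eq_zero (by fun_prop) integral_sq_sub_one]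
  rw [mul_comm, sqVar]

/-- Completing the square turns the integrand times the standard density into a multiple of the
density of N(p/(1-q), 1/(1-q)). -/
lemma gaussian_exp_quadratic (p q : ℝ) (hq : q < 1) :
    Integrable (fun u : ℝ => Real.exp (p * u + q * u ^ 2 / 2)) (gaussianReal 0 1) ∧
    ∫ u : ℝ, Real.exp (p * u + q * u ^ 2 / 2) ∂(gaussianReal 0 1) =
      (Real.sqrt (1 - q))⁻¹ * Real.exp (p ^ 2 / (2 * (1 - q))) := by
  have hq' : 0 < 1 - q := by linarith
  set v : NNReal := ((1 - q)⁻¹).toNNReal with hv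
  have hvr : (v : ℝ) = (1 - q)⁻¹ := Real.coe_toNNReal _ (inv_nonneg.2 hq'.le)
  have hv0 : v ≠ 0 := by
    intro h
    rw [h] at hvr
    exact (inv_pos.2 hq').ne (by simpa using hvr)
  have key : ∀ u : ℝ, gaussianPDFReal 0 1 u * Real.exp (p * u + q * u ^ 2 / 2) =
      ((Real.sqrt (1 - q))⁻¹ * Real.exp (p ^ 2 / (2 * (1 - q)))) *
        gaussianPDFReal (p / (1 - q)) v u := by
    intro u
    simp only [gaussianPDFReal, hvr]
    have e1 : Real.sqrt (2 * Real.pi * (1 - q)⁻¹) =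
        Real.sqrt (2 * Real.pi) * (Real.sqrt (1 - q))⁻¹ := by
      rw [Real.sqrt_mul (by positivity), Real.sqrt_inv]
    have hs : Real.sqrt (1 - q) ≠ 0 := (Real.sqrt_pos.2 hq').ne'
    have hs2 : Real.sqrt (2 * Real.pi) ≠ 0 := (Real.sqrt_pos.2 (by positivity)).ne'
    rw [e1, NNReal.coe_one, mul_one, mul_assoc, ← Real.exp_add]
    have e2 : -(u - 0) ^ 2 / (2 * 1) + (p * u + q * u ^ 2 / 2) =
        p ^ 2 / (2 * (1 - q)) + -(u - p / (1 - q)) ^ 2 / (2 * (1 - q)⁻¹) := by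
      field_simp
      ring
    rw [e2, Real.exp_add]
    field_simp
  constructor
  · rw [gaussianReal_of_var_ne_zero 0 one_ne_zero, integrable_withDensity_iff_integrable_smul'
      (measurable_gaussianPDF 0 1) (ae_of_all _ fun _ => gaussianPDF_lt_top)]
    simp only [toReal_gaussianPDF, smul_eq_mul, key]
    exact (integrable_gaussianPDFReal _ _).const_mul _
  · rw [integral_gaussianReal_eq_integral_smul one_ne_zero]
    simp only [smul_eq_mul, key]
    rw [integral_const_mul, integral_gaussianPDFReal_eq_one _ hv0, mul_one]

end Gaussian

/-! ### The Metropolis function -/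

/-- The acceptance probability as a function of the log-ratio. -/
def acc (r : ℝ) : ℝ := min 1 (Real.exp r)

lemma acc_pos (r : ℝ) : 0 < acc r := lt_min one_pos (Real.exp_pos r)

lemma acc_nonneg (r : ℝ) : 0 ≤ acc r := (acc_pos r).le

lemma acc_le_one (r : ℝ) : acc r ≤ 1 := min_le_left _ _

lemma acc_le_exp (r : ℝ) : acc r ≤ Real.exp r := min_le_right _ _

lemma abs_acc_le (r : ℝ) : |acc r| ≤ 1 := by
  rw [abs_of_nonneg (acc_nonneg r)]
  exact acc_le_one r

/-- The exponent 1/2 matters: for a reversible log-ratio R the mean of e^R is 1, so `acc_le_exp`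
yields no decay, whereas e^{R/2} has an exponentially small mean. -/
lemma acc_le_exp_half (r : ℝ) : acc r ≤ Real.exp (r / 2) := by
  rcases le_total r 0 with h | h
  · exact (acc_le_exp r).trans (Real.exp_le_exp.2 (by linarith))
  · exact (acc_le_one r).trans (Real.one_le_exp (by linarith))

@[fun_prop]
lemma continuous_acc : Continuous acc := by
  unfold acc
  fun_prop

@[fun_prop]
lemma measurable_acc : Measurable acc := continuous_acc.measurable

lemma acc_sub_le {r s : ℝ} (h : s ≤ r) : acc r - acc s ≤ r - s := by
  rcases le_total s 0 with hs | hs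
  · have h1 : acc s = Real.exp s := min_eq_right (Real.exp_le_one_iff.2 hs)
    have h2 := Real.add_one_le_exp (s - r)
    have h3 : Real.exp s = Real.exp r * Real.exp (s - r) := by
      rw [← Real.exp_add]; ring_nf
    have h4 : Real.exp (s - r) ≤ 1 := Real.exp_le_one_iff.2 (by linarith)
    rw [h1]
    rcases le_total (Real.exp r) 1 with hr | hr
    · have := acc_le_exp r
      nlinarith [Real.exp_pos r]
    · have h5 := acc_le_one r
      nlinarith [Real.exp_pos (s - r)]
  · have h1 : acc s = 1 := min_eq_left (Real.one_le_exp hs)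
    have := acc_le_one r
    linarith

lemma acc_mono {r s : ℝ} (h : s ≤ r) : acc s ≤ acc r :=
  min_le_min le_rfl (Real.exp_le_exp.2 h)

lemma abs_acc_sub_le (r s : ℝ) : |acc r - acc s| ≤ |r - s| := by
  rcases le_total s r with h | h
  · rw [abs_of_nonneg (sub_nonneg.2 (acc_mono h)), abs_of_nonneg (sub_nonneg.2 h)]
    exact acc_sub_le h
  · rw [abs_of_nonpos (sub_nonpos.2 (acc_mono h)), abs_of_nonpos (sub_nonpos.2 h)]
    linarith [acc_sub_le h]

lemma abs_acc_sub_le_one (r s : ℝ) : |acc r - acc s| ≤ 1 := by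
  rw [abs_le]
  constructor <;> linarith [acc_nonneg r, acc_nonneg s, acc_le_one r, acc_le_one s]

/-- For s > 0 the log-ratio changes sign at g = s/2. Above it the integrand is 1; below it the
exponential turns the density of N(0,1) into that of N(s,1). By symmetry and translation each half
has mass Φ(-s/2). -/
lemma integral_acc_gaussian {s : ℝ} :
    ∫ g, acc (s * g - s ^ 2 / 2) ∂(gaussianReal 0 1) = 2 * cdf (gaussianReal 0 1) (-(|s| / 2)) := by
  wlog hs : 0 ≤ s generalizing s
  · have h := this (s := -s) (by linarith)
    rw [abs_neg] at h
    rw [← h]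
    have hmap := gaussianReal_map_neg (μ := 0) (v := 1)
    rw [neg_zero] at hmap
    nth_rewrite 1 [← hmap]
    rw [integral_map (by fun_prop) (by fun_prop)]
    simp
  rw [abs_of_nonneg hs]
  rcases hs.eq_or_lt with rfl | hs
  · have h0 : cdf (gaussianReal 0 1) 0 = 1 / 2 := by
      rw [cdf_eq_real]
      have h1 : (gaussianReal 0 1).real (Set.Ioi 0) = (gaussianReal 0 1).real (Set.Iic 0) := by
        have hmap := gaussianReal_map_neg (μ := 0) (v := 1)
        rw [neg_zero] at hmap
        have : NullSingletonClass (gaussianReal 0 1) :=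
          nullSingletonClass_gaussianReal one_ne_zero
        rw [← measureReal_congr (Iio_ae_eq_Iic (a := (0 : ℝ)))]
        nth_rewrite 1 [← hmap]
        rw [map_measureReal_apply (by fun_prop) measurableSet_Ioi]
        congr 1
        ext x
        simp
      have h2 := measureReal_compl (μ := gaussianReal 0 1) (measurableSet_Iic (a := (0 : ℝ)))
      rw [Set.compl_Iic, h1] at h2
      simp at h2
      linarith
    simp [acc, h0]
  have : NullSingletonClass (gaussianReal 0 1) := nullSingletonClass_gaussianReal one_ne_zero
  have hsplit : ∀ g, acc (s * g - s ^ 2 / 2) = (Set.Ici (s / 2)).indicator (fun _ => (1 : ℝ)) g +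
      (Set.Iio (s / 2)).indicator (fun g => Real.exp (s * g - s ^ 2 / 2)) g := by
    intro g
    by_cases hg : s / 2 ≤ g
    · rw [Set.indicator_of_mem (by exact hg), Set.indicator_of_notMem (by simpa using hg), add_zero]
      exact min_eq_left (Real.one_le_exp (by nlinarith))
    · rw [Set.indicator_of_notMem (by exact hg), Set.indicator_of_mem (by simpa using hg), zero_add]
      push Not at hg
      exact min_eq_right (Real.exp_le_one_iff.2 (by nlinarith))
  have hint : Integrable (fun g => Real.exp (s * g - s ^ 2 / 2)) (gaussianReal 0 1) := by
    simp_rw [sub_eq_add_neg, Real.exp_add]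
    exact (integrable_exp_mul_gaussianReal s).mul_const _
  simp_rw [hsplit]
  rw [integral_add ((integrable_const _).indicator measurableSet_Ici)
    (hint.indicator measurableSet_Iio), integral_indicator measurableSet_Ici]
  have h1 : ∫ g in Set.Ici (s / 2), (1 : ℝ) ∂(gaussianReal 0 1) =
      cdf (gaussianReal 0 1) (-(s / 2)) := by
    rw [cdf_eq_real, setIntegral_const, smul_eq_mul, mul_one]
    have hmap := gaussianReal_map_neg (μ := 0) (v := 1)
    rw [neg_zero] at hmap
    nth_rewrite 1 [← hmap]
    rw [map_measureReal_apply (by fun_prop) measurableSet_Ici]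
    congr 1
    ext x
    simp [le_neg]
  have h2 : ∫ g, (Set.Iio (s / 2)).indicator (fun g => Real.exp (s * g - s ^ 2 / 2)) g
      ∂(gaussianReal 0 1) = ∫ g, (Set.Iio (s / 2)).indicator (fun _ => (1 : ℝ)) g
      ∂(gaussianReal s 1) := by
    rw [integral_gaussianReal_eq_integral_smul one_ne_zero,
      integral_gaussianReal_eq_integral_smul one_ne_zero]
    congr 1
    ext g
    by_cases hg : g ∈ Set.Iio (s / 2)
    · rw [Set.indicator_of_mem hg, Set.indicator_of_mem hg]
      simp only [gaussianPDFReal, smul_eq_mul, mul_one]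
      rw [mul_assoc, ← Real.exp_add]
      congr 2
      simp only [NNReal.coe_one]
      ring
    · rw [Set.indicator_of_notMem hg, Set.indicator_of_notMem hg]
      simp
  have h3 : ∫ g, (Set.Iio (s / 2)).indicator (fun _ => (1 : ℝ)) g ∂(gaussianReal s 1) =
      cdf (gaussianReal 0 1) (-(s / 2)) := by
    rw [integral_indicator measurableSet_Iio, cdf_eq_real, setIntegral_const, smul_eq_mul, mul_one]
    have hmap := gaussianReal_map_add_const (μ := 0) (v := 1) s
    rw [zero_add] at hmap
    rw [← hmap, map_measureReal_apply (by fun_prop) measurableSet_Iio,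
      ← measureReal_congr (Iio_ae_eq_Iic (a := -(s / 2)))]
    congr 1
    ext x
    simp only [Set.mem_preimage, Set.mem_Iio]
    constructor <;> intro h <;> linarith
  rw [h1, h2, h3]
  ring

/-! ### Random quadratic forms -/

section QuadForm

variable {ι : Type*} [Fintype ι]

/-- A diagonal quadratic form in a pair of vectors. -/
def quadForm (a b c : ι → ℝ) (ξ z : ι → ℝ) : ℝ :=
  ∑ k, (a k * ξ k * z k + b k * ξ k ^ 2 + c k * z k ^ 2)

/-- The law of a pair of independent standard normal vectors. -/
abbrev pairLaw (ι : Type*) [Fintype ι] : Measure ((ι → ℝ) × (ι → ℝ)) :=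
  (stdNormal ι).prod (stdNormal ι)

@[fun_prop]
lemma measurable_quadForm (a b c : ι → ℝ) :
    Measurable fun p : (ι → ℝ) × (ι → ℝ) => quadForm a b c p.1 p.2 := by
  unfold quadForm
  fun_prop

lemma integral_pairLaw_fst (f : (ι → ℝ) → ℝ) :
    ∫ p, f p.1 ∂(pairLaw ι) = ∫ ξ, f ξ ∂(stdNormal ι) := by
  simpa using integral_fun_fst (μ := stdNormal ι) (ν := stdNormal ι) f

lemma integral_pairLaw_snd (f : (ι → ℝ) → ℝ) :
    ∫ p, f p.2 ∂(pairLaw ι) = ∫ ξ, f ξ ∂(stdNormal ι) := by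
  simpa using integral_fun_snd (μ := stdNormal ι) (ν := stdNormal ι) f

lemma integrable_sum_sq_sub_one (b : ι → ℝ) :
    Integrable (fun z : ι → ℝ => ∑ k, b k * (z k ^ 2 - 1)) (stdNormal ι) :=
  integrable_finsetSum _ fun k _ => integrable_comp_eval (μ := fun _ : ι => gaussianReal 0 1)
    (i := k) (f := fun u : ℝ => b k * (u ^ 2 - 1))
    (((integrable_pow_gaussian 2).sub (integrable_const 1)).const_mul _)

/-- The bounded change of measure: an L¹ estimate under the Gaussian law passes to the target at the
cost of the factor M. -/
lemma abs_integral_weighted_le {Ω : Type*} {mΩ : MeasurableSpace Ω} {μ : Measure Ω}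
    {w X Y : Ω → ℝ} {M : ℝ} (h0 : ∀ ω, 0 ≤ w ω) (hM : ∀ ω, w ω ≤ M) (hXY : ∀ ω, |X ω| ≤ Y ω)
    (hY : Integrable Y μ) : |∫ ω, w ω * X ω ∂μ| ≤ M * ∫ ω, Y ω ∂μ := by
  rw [← integral_const_mul]
  rw [← Real.norm_eq_abs]
  refine norm_integral_le_of_norm_le (hY.const_mul M) (ae_of_all _ fun ω => ?_)
  rw [Real.norm_eq_abs, abs_mul, abs_of_nonneg (h0 ω)]
  exact mul_le_mul (hM ω) (hXY ω) (abs_nonneg _) ((h0 ω).trans (hM ω))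

/-- Hölder continuity, unlike a Lipschitz bound, holds down to 0; this lets the limiting variance V
vanish, as it does above the critical scaling. -/
lemma abs_sqrt_sub_sqrt_le {x y : ℝ} (hx : 0 ≤ x) (hy : 0 ≤ y) :
    |Real.sqrt x - Real.sqrt y| ≤ Real.sqrt |x - y| := by
  refine Real.le_sqrt_of_sq_le ?_
  have h1 : x - y = (Real.sqrt x - Real.sqrt y) * (Real.sqrt x + Real.sqrt y) := by
    nlinarith [Real.sq_sqrt hx, Real.sq_sqrt hy]
  rw [h1, abs_mul, sq]
  refine mul_le_mul_of_nonneg_left ?_ (abs_nonneg _)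
  rw [abs_of_nonneg (add_nonneg (Real.sqrt_nonneg x) (Real.sqrt_nonneg y)), abs_le]
  constructor <;> linarith [Real.sqrt_nonneg x, Real.sqrt_nonneg y]

lemma integrable_sqrt_abs {Ω : Type*} {mΩ : MeasurableSpace Ω} {μ : Measure Ω}
    [IsProbabilityMeasure μ] {X : Ω → ℝ} (hX : Integrable X μ) :
    MemLp (fun ω => Real.sqrt |X ω|) 2 μ := by
  have hm : AEStronglyMeasurable (fun ω => Real.sqrt |X ω|) μ :=
    Real.continuous_sqrt.comp_aestronglyMeasurable hX.abs.aestronglyMeasurable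
  rw [memLp_two_iff_integrable_sq hm]
  simpa [Real.sq_sqrt] using hX.abs

lemma integral_sqrt_abs_le {Ω : Type*} {mΩ : MeasurableSpace Ω} {μ : Measure Ω}
    [IsProbabilityMeasure μ] {X : Ω → ℝ} (hX : Integrable X μ) :
    ∫ ω, Real.sqrt |X ω| ∂μ ≤ Real.sqrt (∫ ω, |X ω| ∂μ) := by
  refine Real.le_sqrt_of_sq_le ?_
  have h := sq_integral_abs_le (integrable_sqrt_abs hX)
  simpa [Real.sq_sqrt, abs_of_nonneg (Real.sqrt_nonneg _)] using h

/-- The conditional central limit theorem for a diagonal quadratic form, in quantitative form and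
under a bounded change of measure. -/
theorem abs_integral_acc_quadForm_sub_le (a b c : ι → ℝ) {w : (ι → ℝ) → ℝ} {M V : ℝ}
    (hw : Measurable w) (h0 : ∀ ξ, 0 ≤ w ξ) (hM : ∀ ξ, w ξ ≤ M) (h1 : ∫ ξ, w ξ ∂(stdNormal ι) = 1)
    (hV : 0 ≤ V) :
    |∫ p, w p.1 * acc (quadForm a b c p.1 p.2) ∂(pairLaw ι) -
        2 * cdf (gaussianReal 0 1) (-(Real.sqrt V / 2))| ≤
      M * (Real.sqrt (sqVar * ∑ k, b k ^ 2) + Real.sqrt (sqVar * ∑ k, c k ^ 2) +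
        |∑ k, (b k + c k) + V / 2| +
        Real.sqrt (Real.sqrt (sqVar * ∑ k, (a k ^ 2) ^ 2) + |∑ k, a k ^ 2 - V|)) := by
  have hM0 : 0 ≤ M := (h0 0).trans (hM 0)
  set L : (ι → ℝ) → (ι → ℝ) → ℝ := fun ξ z => ∑ k, (a k * ξ k) * z k with hL
  have hLm : Measurable fun p : (ι → ℝ) × (ι → ℝ) => L p.1 p.2 := by
    simp only [hL]; fun_prop
  set B : (ι → ℝ) → ℝ := fun ξ => ∑ k, b k * (ξ k ^ 2 - 1)
  set C : (ι → ℝ) → ℝ := fun z => ∑ k, c k * (z k ^ 2 - 1)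
  set e : ℝ := ∑ k, (b k + c k) + V / 2 with he
  set Q : (ι → ℝ) → ℝ := fun ξ => ∑ k, (a k * ξ k) ^ 2 with hQ
  have hQ0 : ∀ ξ, 0 ≤ Q ξ := fun ξ => Finset.sum_nonneg fun k _ => sq_nonneg _
  set H : ℝ → ℝ := fun q => ∫ g, acc (Real.sqrt q * g - V / 2) ∂(gaussianReal 0 1) with hH
  have hBi := integrable_sum_sq_sub_one b
  have hCi := integrable_sum_sq_sub_one c
  -- Centring the squares leaves their mean ∑ (b + c). The constant e measures its distance to -V/2,
  -- the drift that goes with variance V in `integral_acc_gaussian`.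
  have hdec : ∀ ξ z, quadForm a b c ξ z = L ξ z - V / 2 + (B ξ + C z + e) := by
    intro ξ z
    have : L ξ z - V / 2 + (B ξ + C z + e) = L ξ z + B ξ + C z + ∑ k, (b k + c k) := by
      rw [he]; ring
    rw [this]
    simp only [quadForm, hL, B, C, ← Finset.sum_add_distrib]
    exact Finset.sum_congr rfl fun k _ => by ring
  have hi : ∀ {f : (ι → ℝ) × (ι → ℝ) → ℝ}, Measurable f →
      Integrable (fun p => w p.1 * acc (f p)) (pairLaw ι) := by
    intro f hf
    refine Integrable.of_bound (by fun_prop) M (ae_of_all _ fun p => ?_)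
    rw [Real.norm_eq_abs, abs_mul, abs_of_nonneg (h0 _)]
    exact (mul_le_of_le_one_right (h0 _) (abs_acc_le _)).trans (hM _)
  have hi1 := hi (measurable_quadForm a b c)
  have hi2 := hi (f := fun p => L p.1 p.2 - V / 2) (by fun_prop)
  -- replacing the quadratic form by its bilinear part
  have hA : |∫ p, w p.1 * acc (quadForm a b c p.1 p.2) ∂(pairLaw ι) -
      ∫ p, w p.1 * acc (L p.1 p.2 - V / 2) ∂(pairLaw ι)| ≤
      M * (Real.sqrt (sqVar * ∑ k, b k ^ 2) + Real.sqrt (sqVar * ∑ k, c k ^ 2) + |e|) := by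
    rw [← integral_sub hi1 hi2]
    simp_rw [← mul_sub]
    have hBC : Integrable (fun p : (ι → ℝ) × (ι → ℝ) => |B p.1| + |C p.2|) (pairLaw ι) :=
      (hBi.abs.comp_fst _).add (hCi.abs.comp_snd _)
    have hY : Integrable (fun p : (ι → ℝ) × (ι → ℝ) => |B p.1| + |C p.2| + |e|) (pairLaw ι) :=
      hBC.add (integrable_const _)
    refine (abs_integral_weighted_le (w := fun p : (ι → ℝ) × (ι → ℝ) => w p.1)
      (fun p => h0 p.1) (fun p => hM p.1) (Y := fun p => |B p.1| + |C p.2| + |e|)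
      (fun p => ?_) hY).trans ?_
    · refine (abs_acc_sub_le _ _).trans ?_
      rw [hdec, add_sub_cancel_left]
      exact (abs_add_le _ _).trans (add_le_add_left (abs_add_le _ _) _)
    · refine mul_le_mul_of_nonneg_left ?_ hM0
      rw [integral_add hBC (integrable_const _),
        integral_add (hBi.abs.comp_fst _) (hCi.abs.comp_snd _),
        integral_pairLaw_fst (fun ξ => |B ξ|), integral_pairLaw_snd (fun ξ => |C ξ|)]
      have hb := integral_abs_sum_sq_sub_one_le b
      have hc := integral_abs_sum_sq_sub_one_le c
      simp only [integral_const, probReal_univ, smul_eq_mul, one_mul]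
      exact add_le_add_left (add_le_add hb hc) _
  -- conditioning on the first vector
  have hcond : ∀ ξ, ∫ z, w ξ * acc (L ξ z - V / 2) ∂(stdNormal ι) = w ξ * H (Q ξ) := by
    intro ξ
    rw [integral_const_mul]
    congr 1
    exact integral_comp_sum_mul_stdNormal (fun k => a k * ξ k) (f := fun u => acc (u - V / 2))
      (by fun_prop)
  have hI2 : ∫ p, w p.1 * acc (L p.1 p.2 - V / 2) ∂(pairLaw ι) =
      ∫ ξ, w ξ * H (Q ξ) ∂(stdNormal ι) := by
    rw [integral_prod _ hi2]
    exact integral_congr_ae (ae_of_all _ hcond)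
  have hI2i : Integrable (fun ξ => w ξ * H (Q ξ)) (stdNormal ι) :=
    hi2.integral_prod_left.congr (ae_of_all _ hcond)
  have hwi : Integrable w (stdNormal ι) :=
    Integrable.of_bound (by fun_prop) M (ae_of_all _ fun ξ => by
      rw [Real.norm_eq_abs, abs_of_nonneg (h0 _)]; exact hM _)
  have hHV : H V = 2 * cdf (gaussianReal 0 1) (-(Real.sqrt V / 2)) := by
    have := integral_acc_gaussian (s := Real.sqrt V)
    rwa [Real.sq_sqrt hV, abs_of_nonneg (Real.sqrt_nonneg V)] at this
  -- The conditional expectation depends on the first vector only through the conditional variance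
  -- q. Since `acc` is 1-Lipschitz, changing q costs at most |√q - √V| E|g|.
  have hHlip : ∀ q, 0 ≤ q → |H q - H V| ≤ Real.sqrt |q - V| := by
    intro q hq
    have hacc : ∀ s : ℝ, Integrable (fun g => acc (s * g - V / 2)) (gaussianReal 0 1) := fun s =>
      Integrable.of_bound (by fun_prop) 1 (ae_of_all _ fun g => abs_acc_le _)
    have hg : Integrable (fun g : ℝ => |g|) (gaussianReal 0 1) := by
      simpa using (integrable_pow_gaussian 1).abs
    rw [hH]
    simp only
    rw [← integral_sub (hacc _) (hacc _), ← Real.norm_eq_abs]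
    refine (norm_integral_le_of_norm_le (g := fun g => |Real.sqrt q - Real.sqrt V| * |g|)
      (hg.const_mul _) (ae_of_all _ fun g => ?_)).trans ?_
    · rw [Real.norm_eq_abs, ← abs_mul]
      refine (abs_acc_sub_le _ _).trans (le_of_eq ?_)
      congr 1
      ring
    · rw [integral_const_mul]
      exact (mul_le_of_le_one_right (abs_nonneg _) integral_abs_gaussian_le).trans
        (abs_sqrt_sub_sqrt_le hq hV)
  have hQi : Integrable (fun ξ => Q ξ - V) (stdNormal ι) := by
    refine Integrable.sub (integrable_finsetSum _ fun k _ => ?_) (integrable_const _)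
    have : (fun ξ : ι → ℝ => (a k * ξ k) ^ 2) = fun ξ => a k ^ 2 * ξ k ^ 2 := by
      ext ξ; ring
    rw [this]
    exact (integrable_comp_eval (μ := fun _ : ι => gaussianReal 0 1)
      (i := k) (f := fun u : ℝ => u ^ 2) (integrable_pow_gaussian 2)).const_mul _
  have hQ1 : ∫ ξ, |Q ξ - V| ∂(stdNormal ι) ≤
      Real.sqrt (sqVar * ∑ k, (a k ^ 2) ^ 2) + |∑ k, a k ^ 2 - V| := by
    have hai := integrable_sum_sq_sub_one fun k => a k ^ 2
    refine (integral_mono hQi.abs (hai.abs.add (integrable_const |∑ k, a k ^ 2 - V|))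
      fun ξ => ?_).trans ?_
    · have : Q ξ - V = ∑ k, a k ^ 2 * (ξ k ^ 2 - 1) + (∑ k, a k ^ 2 - V) := by
        rw [← add_sub_assoc, ← Finset.sum_add_distrib]
        congr 1
        exact Finset.sum_congr rfl fun k _ => by ring
      simp only [Pi.add_apply]
      rw [this]
      exact abs_add_le _ _
    · rw [integral_add' hai.abs (integrable_const _)]
      have := integral_abs_sum_sq_sub_one_le fun k => a k ^ 2
      simp only [integral_const, probReal_univ, smul_eq_mul, one_mul]
      linarith
  have hB : |∫ p, w p.1 * acc (L p.1 p.2 - V / 2) ∂(pairLaw ι) -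
      2 * cdf (gaussianReal 0 1) (-(Real.sqrt V / 2))| ≤
      M * Real.sqrt (Real.sqrt (sqVar * ∑ k, (a k ^ 2) ^ 2) + |∑ k, a k ^ 2 - V|) := by
    have : 2 * cdf (gaussianReal 0 1) (-(Real.sqrt V / 2)) = ∫ ξ, w ξ * H V ∂(stdNormal ι) := by
      rw [integral_mul_const, h1, one_mul, hHV]
    rw [hI2, this, ← integral_sub hI2i (hwi.mul_const _)]
    simp_rw [← mul_sub]
    refine (abs_integral_weighted_le h0 hM (fun ξ => hHlip _ (hQ0 ξ))
      ((integrable_sqrt_abs hQi).integrable (by norm_num))).trans ?_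
    exact mul_le_mul_of_nonneg_left ((integral_sqrt_abs_le hQi).trans
      (Real.sqrt_le_sqrt hQ1)) hM0
  calc _ ≤ _ := abs_sub_le _ (∫ p, w p.1 * acc (L p.1 p.2 - V / 2) ∂(pairLaw ι)) _
    _ ≤ _ := add_le_add hA hB
    _ = _ := by ring

/-! ### Decoupling one coordinate, and an exponential moment -/

lemma integrable_pow_coord_fst (k : ι) (m : ℕ) :
    Integrable (fun p : (ι → ℝ) × (ι → ℝ) => p.1 k ^ m) (pairLaw ι) :=
  (integrable_comp_eval (μ := fun _ : ι => gaussianReal 0 1) (i := k) (f := fun u : ℝ => u ^ m)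
    (integrable_pow_gaussian m)).comp_fst _

lemma integrable_pow_coord_snd (k : ι) (m : ℕ) :
    Integrable (fun p : (ι → ℝ) × (ι → ℝ) => p.2 k ^ m) (pairLaw ι) :=
  (integrable_comp_eval (μ := fun _ : ι => gaussianReal 0 1) (i := k) (f := fun u : ℝ => u ^ m)
    (integrable_pow_gaussian m)).comp_snd _

lemma integral_pow_coord_fst (k : ι) (m : ℕ) :
    ∫ p : (ι → ℝ) × (ι → ℝ), p.1 k ^ m ∂(pairLaw ι) = ∫ u, u ^ m ∂(gaussianReal 0 1) := by
  rw [integral_pairLaw_fst fun ξ => ξ k ^ m]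
  exact integral_comp_eval (μ := fun _ : ι => gaussianReal 0 1) (i := k) (f := fun u : ℝ => u ^ m)
    (by fun_prop)

lemma integral_pow_coord_snd (k : ι) (m : ℕ) :
    ∫ p : (ι → ℝ) × (ι → ℝ), p.2 k ^ m ∂(pairLaw ι) = ∫ u, u ^ m ∂(gaussianReal 0 1) := by
  rw [integral_pairLaw_snd fun ξ => ξ k ^ m]
  exact integral_comp_eval (μ := fun _ : ι => gaussianReal 0 1) (i := k) (f := fun u : ℝ => u ^ m)
    (by fun_prop)

/-- The fourth moment of a standard normal variable. -/
def fourthMoment : ℝ := ∫ u : ℝ, u ^ 4 ∂(gaussianReal 0 1)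

/-- A single coordinate of the noise is asymptotically independent of the acceptance event. -/
theorem abs_integral_acc_mul_sq_sub_one_le (a b c : ι → ℝ) {w : (ι → ℝ) → ℝ} {M : ℝ}
    (hw : Measurable w) (h0 : ∀ ξ, 0 ≤ w ξ) (hM : ∀ ξ, w ξ ≤ M) (k : ι) :
    |∫ p, w p.1 * (acc (quadForm a b c p.1 p.2) * (p.2 k ^ 2 - 1)) ∂(pairLaw ι)| ≤
      M * ((|a k| + |b k| + |c k|) * (2 * fourthMoment + 2)) := by
  classical
  -- The form without its k-th term: given the first vector it is independent of z_k, so replacing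
  -- the full form by r kills the correlation with z_k² - 1.
  set r : (ι → ℝ) → (ι → ℝ) → ℝ := fun ξ z =>
    ∑ i ∈ Finset.univ.erase k, (a i * ξ i * z i + b i * ξ i ^ 2 + c i * z i ^ 2) with hr
  have hrm : Measurable fun p : (ι → ℝ) × (ι → ℝ) => r p.1 p.2 := by
    simp only [hr]; fun_prop
  have hdec : ∀ ξ z, quadForm a b c ξ z =
      (a k * ξ k * z k + b k * ξ k ^ 2 + c k * z k ^ 2) + r ξ z := by
    intro ξ z
    rw [quadForm, ← Finset.add_sum_erase _ _ (Finset.mem_univ k)]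
  have hi : ∀ {f : (ι → ℝ) × (ι → ℝ) → ℝ}, Measurable f →
      Integrable (fun p => w p.1 * (acc (f p) * (p.2 k ^ 2 - 1))) (pairLaw ι) := by
    intro f hf
    have hd : Integrable (fun p : (ι → ℝ) × (ι → ℝ) => p.2 k ^ 2 - 1) (pairLaw ι) :=
      (integrable_pow_coord_snd k 2).sub (integrable_const _)
    refine (hd.abs.const_mul M).mono' (by fun_prop) (ae_of_all _ fun p => ?_)
    rw [Real.norm_eq_abs, abs_mul, abs_of_nonneg (h0 _), abs_mul]
    exact mul_le_mul (hM _) (mul_le_of_le_one_left (abs_nonneg _) (abs_acc_le _))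
      (by positivity) ((h0 0).trans (hM 0))
  have hi1 := hi (measurable_quadForm a b c)
  have hi2 := hi hrm
  have hzero : ∫ p, w p.1 * (acc (r p.1 p.2) * (p.2 k ^ 2 - 1)) ∂(pairLaw ι) = 0 := by
    rw [integral_prod _ hi2]
    refine integral_eq_zero_of_ae (ae_of_all _ fun ξ => ?_)
    simp only [Pi.zero_apply]
    rw [integral_const_mul]
    have hind : iIndepFun (fun (i : ι) (z : ι → ℝ) => z i) (stdNormal ι) :=
      iIndepFun_pi (μ := fun _ : ι => gaussianReal 0 1) (X := fun _ (u : ℝ) => u)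
        fun _ => aemeasurable_id
    set S : Finset ι := Finset.univ.erase k with hS
    have h2 := hind.indepFun_finset S {k} (by simp [hS])
      fun i => measurable_pi_apply i
    have h3 := h2.comp
      (φ := fun y : ↥S → ℝ => acc (∑ i : S, (a i * ξ i * y i + b i * ξ i ^ 2 + c i * y i ^ 2)))
      (ψ := fun y : ↥({k} : Finset ι) → ℝ => y ⟨k, by simp⟩ ^ 2 - 1) (by fun_prop) (by fun_prop)
    have h4 := h3.integral_fun_mul_eq_mul_integral (by fun_prop)
      (((measurable_pi_apply k).pow_const 2).sub_const 1).aestronglyMeasurable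
    have h5 : ∫ z : ι → ℝ, (z k ^ 2 - 1) ∂(stdNormal ι) = 0 := by
      rw [integral_comp_eval (μ := fun _ : ι => gaussianReal 0 1) (i := k)
        (f := fun u : ℝ => u ^ 2 - 1) (by fun_prop), integral_sq_sub_one]
    have h6 : ∀ z : ι → ℝ, r ξ z = ∑ i : S, (a i * ξ i * z i + b i * ξ i ^ 2 + c i * z i ^ 2) :=
      fun z => (Finset.sum_coe_sort S
        fun i => a i * ξ i * z i + b i * ξ i ^ 2 + c i * z i ^ 2).symm
    simp only [Function.comp_def] at h4
    simp only [h6]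
    rw [h4, h5, mul_zero, mul_zero]
  have hsub : ∫ p, w p.1 * (acc (quadForm a b c p.1 p.2) * (p.2 k ^ 2 - 1)) ∂(pairLaw ι) =
      ∫ p, w p.1 * ((acc (quadForm a b c p.1 p.2) - acc (r p.1 p.2)) * (p.2 k ^ 2 - 1))
        ∂(pairLaw ι) := by
    rw [← sub_zero (∫ p, w p.1 * (acc (quadForm a b c p.1 p.2) * (p.2 k ^ 2 - 1)) ∂(pairLaw ι)),
      ← hzero, ← integral_sub hi1 hi2]
    exact integral_congr_ae (ae_of_all _ fun p => by simp only; ring)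
  rw [hsub]
  set s : ℝ := |a k| + |b k| + |c k| with hs
  have hs0 : 0 ≤ s := by positivity
  -- This majorant comes from (ξ² + z²)(z² + 1) and ξ²z² ≤ (ξ⁴ + z⁴)/2; its mean is the constant 2
  -- `fourthMoment` + 2 of the statement.
  have hY4 : Integrable (fun p : (ι → ℝ) × (ι → ℝ) => (p.1 k ^ 4 + 3 * p.2 k ^ 4) / 2)
      (pairLaw ι) :=
    ((integrable_pow_coord_fst k 4).add ((integrable_pow_coord_snd k 4).const_mul 3)).div_const 2
  have hY2 : Integrable (fun p : (ι → ℝ) × (ι → ℝ) => p.1 k ^ 2 + p.2 k ^ 2) (pairLaw ι) :=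
    (integrable_pow_coord_fst k 2).add (integrable_pow_coord_snd k 2)
  have hYi : Integrable (fun p : (ι → ℝ) × (ι → ℝ) =>
      (p.1 k ^ 4 + 3 * p.2 k ^ 4) / 2 + (p.1 k ^ 2 + p.2 k ^ 2)) (pairLaw ι) := hY4.add hY2
  refine (abs_integral_weighted_le (w := fun p : (ι → ℝ) × (ι → ℝ) => w p.1) (fun p => h0 p.1)
    (fun p => hM p.1) (fun p => ?_) (hYi.const_mul s)).trans ?_
  · rw [abs_mul]
    have e1 : |acc (quadForm a b c p.1 p.2) - acc (r p.1 p.2)| ≤ s * (p.1 k ^ 2 + p.2 k ^ 2) := by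
      refine (abs_acc_sub_le _ _).trans ?_
      rw [hdec, add_sub_cancel_right]
      refine (abs_add_three _ _ _).trans ?_
      rw [abs_mul, abs_mul, abs_mul, abs_mul, abs_of_nonneg (sq_nonneg (p.1 k)),
        abs_of_nonneg (sq_nonneg (p.2 k)), hs]
      have f1 : |p.1 k| * |p.2 k| ≤ p.1 k ^ 2 + p.2 k ^ 2 := by
        nlinarith [sq_nonneg (|p.1 k| - |p.2 k|), sq_abs (p.1 k), sq_abs (p.2 k),
          sq_nonneg (p.1 k), sq_nonneg (p.2 k)]
      have f2 := mul_le_mul_of_nonneg_left f1 (abs_nonneg (a k))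
      have f3 := mul_nonneg (abs_nonneg (b k)) (sq_nonneg (p.2 k))
      have f4 := mul_nonneg (abs_nonneg (c k)) (sq_nonneg (p.1 k))
      nlinarith
    have e2 : |p.2 k ^ 2 - 1| ≤ p.2 k ^ 2 + 1 := by
      rw [abs_le]; constructor <;> nlinarith [sq_nonneg (p.2 k)]
    refine (mul_le_mul e1 e2 (abs_nonneg _) (by positivity)).trans ?_
    rw [mul_assoc]
    refine mul_le_mul_of_nonneg_left ?_ hs0
    nlinarith [sq_nonneg (p.1 k ^ 2 - p.2 k ^ 2)]
  · refine mul_le_mul_of_nonneg_left ?_ ((h0 0).trans (hM 0))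
    rw [integral_const_mul]
    refine mul_le_mul_of_nonneg_left (le_of_eq ?_) hs0
    rw [integral_add hY4 hY2,
      integral_add (integrable_pow_coord_fst k 2) (integrable_pow_coord_snd k 2), integral_div,
      integral_add (integrable_pow_coord_fst k 4) ((integrable_pow_coord_snd k 4).const_mul 3),
      integral_const_mul]
    simp only [integral_pow_coord_fst, integral_pow_coord_snd, integral_sq_gaussian, fourthMoment]
    ring

/-- The exponential moment of order `1 / 2` of a diagonal quadratic form. -/
theorem integral_acc_quadForm_le (a b c : ι → ℝ) (hb : ∀ k, b k < 1)
    (hc : ∀ k, 0 < (1 - b k) * (1 - c k) - a k ^ 2 / 4) :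
    ∫ p, acc (quadForm a b c p.1 p.2) ∂(pairLaw ι) ≤
      ∏ k, (Real.sqrt ((1 - b k) * (1 - c k) - a k ^ 2 / 4))⁻¹ := by
  -- The coefficient of z²/2 that remains after ξ_k has been integrated out of exp((a ξ z + b ξ² + c
  -- z²)/2).
  set q : ι → ℝ := fun k => c k + a k ^ 2 / (4 * (1 - b k)) with hq
  have hb' : ∀ k, 0 < 1 - b k := fun k => by linarith [hb k]
  have hmul : ∀ k, (1 - b k) * (1 - c k) - a k ^ 2 / 4 = (1 - b k) * (1 - q k) := by
    intro k
    have := (hb' k).ne'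
    simp only [hq]
    field_simp
    ring
  have hq1 : ∀ k, q k < 1 := by
    intro k
    have h := hc k
    rw [hmul] at h
    have := pos_of_mul_pos_right h (hb' k).le
    linarith
  have hint : Integrable (fun p : (ι → ℝ) × (ι → ℝ) => acc (quadForm a b c p.1 p.2))
      (pairLaw ι) := Integrable.of_bound (by fun_prop) 1 (ae_of_all _ fun p => abs_acc_le _)
  rw [integral_prod_symm _ hint]
  have hG1 := fun k (u : ℝ) => gaussian_exp_quadratic (a k * u / 2) (b k) (hb k)
  have hG2 := fun k => gaussian_exp_quadratic 0 (q k) (hq1 k)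
  simp only [zero_mul, zero_add, ne_eq, OfNat.ofNat_ne_zero, not_false_eq_true, zero_pow,
    zero_div, Real.exp_zero, mul_one] at hG2
  have hinner : ∀ z : ι → ℝ, ∫ ξ, acc (quadForm a b c ξ z) ∂(stdNormal ι) ≤
      ∏ k, ((Real.sqrt (1 - b k))⁻¹ * Real.exp (q k * z k ^ 2 / 2)) := by
    intro z
    have hle : ∀ ξ, acc (quadForm a b c ξ z) ≤
        ∏ k, (Real.exp (a k * z k / 2 * ξ k + b k * ξ k ^ 2 / 2) *
          Real.exp (c k * z k ^ 2 / 2)) := by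
      intro ξ
      refine (acc_le_exp_half _).trans (le_of_eq ?_)
      simp_rw [← Real.exp_add]
      rw [← Real.exp_sum, quadForm, Finset.sum_div]
      congr 1
      exact Finset.sum_congr rfl fun k _ => by ring
    refine (integral_mono (Integrable.of_bound (by unfold quadForm; fun_prop) 1
      (ae_of_all _ fun p => abs_acc_le _)) (Integrable.fintype_prod
        (f := fun k (u : ℝ) => Real.exp (a k * z k / 2 * u + b k * u ^ 2 / 2) *
          Real.exp (c k * z k ^ 2 / 2)) fun k => (hG1 k (z k)).1.mul_const _) hle).trans
        (le_of_eq ?_)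
    rw [integral_fintype_prod_eq_prod (𝕜 := ℝ)
      (fun k (u : ℝ) => Real.exp (a k * z k / 2 * u + b k * u ^ 2 / 2) *
          Real.exp (c k * z k ^ 2 / 2))]
    refine Finset.prod_congr rfl fun k _ => ?_
    rw [integral_mul_const, (hG1 k (z k)).2, mul_assoc, ← Real.exp_add]
    congr 2
    have := (hb' k).ne'
    simp only [hq]
    field_simp
    ring
  refine (integral_mono hint.integral_prod_right (Integrable.fintype_prod
    (f := fun k (u : ℝ) => (Real.sqrt (1 - b k))⁻¹ * Real.exp (q k * u ^ 2 / 2))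
    fun k => (hG2 k).1.const_mul _) hinner).trans (le_of_eq ?_)
  rw [integral_fintype_prod_eq_prod (𝕜 := ℝ)
    (fun k (u : ℝ) => (Real.sqrt (1 - b k))⁻¹ * Real.exp (q k * u ^ 2 / 2))]
  refine Finset.prod_congr rfl fun k _ => ?_
  rw [integral_const_mul, (hG2 k).2, hmul, Real.sqrt_mul (hb' k).le, mul_inv]

end QuadForm

/-! ### The model in standardized coordinates -/

section Model

variable {d N : ℕ} {T β : ℝ} {G : EuclideanSpace ℝ (Fin d) → ℝ} {alg : Algorithm} {σ : ℝ}

lemma eigenvalue_pos (hT : 0 < T) (hβ : 0 < β) (i : Fin N) : 0 < eigenvalue T β N i := by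
  have hi : ((i : ℕ) : ℝ) + 1 ≤ N := by exact_mod_cast i.2
  have hN : (0 : ℝ) < (N : ℝ) + 1 := by positivity
  have hs : 0 < Real.sin (((i : ℕ) + 1 : ℝ) * Real.pi / (2 * (N + 1))) := by
    apply Real.sin_pos_of_pos_of_lt_pi
    · have := Real.pi_pos
      positivity
    · rw [div_lt_iff₀ (by positivity)]
      nlinarith [Real.pi_pos]
  unfold eigenvalue
  positivity

/-- The standard deviation of the coordinates of index `i` under the reference law. -/
def stdDev (T β : ℝ) (N : ℕ) (i : Fin N) : ℝ := Real.sqrt (eigenvalue T β N i)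

lemma stdDev_pos (hT : 0 < T) (hβ : 0 < β) (i : Fin N) : 0 < stdDev T β N i :=
  Real.sqrt_pos.2 (eigenvalue_pos hT hβ i)

lemma stdDev_sq (hT : 0 < T) (hβ : 0 < β) (i : Fin N) :
    stdDev T β N i ^ 2 = eigenvalue T β N i :=
  Real.sq_sqrt (eigenvalue_pos hT hβ i).le

/-- The state with given standardized coordinates. -/
def rescale (T β : ℝ) (ξ : State d N) : State d N := fun k => stdDev T β N k.1 * ξ k

/-- The standardized coordinates of a state. -/
def standardize (T β : ℝ) (x : State d N) : State d N := fun k => x k / stdDev T β N k.1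

@[fun_prop]
lemma measurable_rescale : Measurable (rescale T β : State d N → State d N) := by
  unfold rescale
  fun_prop

@[fun_prop]
lemma measurable_standardize : Measurable (standardize T β : State d N → State d N) := by
  unfold standardize
  fun_prop

lemma standardize_rescale (hT : 0 < T) (hβ : 0 < β) (ξ : State d N) :
    standardize T β (rescale T β ξ) = ξ := by
  ext k
  have := (stdDev_pos hT hβ k.1).ne'
  simp only [standardize, rescale]
  field_simp

lemma map_rescale (hT : 0 < T) (hβ : 0 < β) :
    (stdNormal (Fin N × Fin d)).map (rescale T β) = reference d N T β := by
  have h := Measure.pi_map_pi (μ := fun _ : Fin N × Fin d => gaussianReal 0 1)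
    (f := fun (k : Fin N × Fin d) (u : ℝ) => stdDev T β N k.1 * u) (fun k => by fun_prop)
  unfold rescale reference
  rw [h]
  congr 1
  ext1 k
  rw [gaussianReal_map_const_mul]
  congr 1
  · simp
  · ext
    rw [Real.coe_toNNReal _ (eigenvalue_pos hT hβ k.1).le, ← stdDev_sq hT hβ]
    simp

/-! ### The proposal -/

/-- The drift of the proposal, in units of `σ`, as a function of the relative step-size. -/
def Algorithm.drift : Algorithm → ℝ → ℝ
  | .RWM, _ => 0
  | .SLA, s => -s / 2

/-- The coefficient of the product term of the log-ratio. -/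
def Algorithm.coefA : Algorithm → ℝ → ℝ
  | .RWM, s => -s
  | .SLA, s => -(s ^ 3 / 4) * (1 - s ^ 2 / 2)

/-- The coefficient of the squared state in the log-ratio. -/
def Algorithm.coefB : Algorithm → ℝ → ℝ
  | .RWM, _ => 0
  | .SLA, s => s ^ 4 / 8 - s ^ 6 / 32

/-- The coefficient of the squared noise in the log-ratio. -/
def Algorithm.coefC : Algorithm → ℝ → ℝ
  | .RWM, s => -s ^ 2 / 2
  | .SLA, s => -s ^ 4 / 8

/-- The contribution of a coordinate to the asymptotic variance of the log-ratio. -/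
def Algorithm.rate : Algorithm → ℝ → ℝ
  | .RWM, s => s ^ 2
  | .SLA, s => s ^ 6 / 16

lemma deriv_log_refDensity (hT : 0 < T) (hβ : 0 < β) (x : State d N) (k : Fin N × Fin d) :
    deriv (fun u : ℝ => Real.log (refDensity T β (Function.update x k u))) (x k) =
      -x k / eigenvalue T β N k.1 := by
  have hv := eigenvalue_pos (N := N) hT hβ
  have hv0 : ∀ i : Fin N, (eigenvalue T β N i).toNNReal ≠ 0 := fun i =>
    (Real.toNNReal_pos.2 (hv i)).ne'
  set c : ℝ := ∏ i ∈ Finset.univ.erase k,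
    gaussianPDFReal 0 (eigenvalue T β N i.1).toNNReal (x i) with hc
  have hc0 : 0 < c := Finset.prod_pos fun i _ => gaussianPDFReal_pos _ _ _ (hv0 _)
  have h : (fun u : ℝ => Real.log (refDensity T β (Function.update x k u))) = fun u =>
      Real.log ((Real.sqrt (2 * Real.pi * eigenvalue T β N k.1))⁻¹) +
        -u ^ 2 / (2 * eigenvalue T β N k.1) + Real.log c := by
    ext u
    have h1 : refDensity T β (Function.update x k u) =
        gaussianPDFReal 0 (eigenvalue T β N k.1).toNNReal u * c := by
      rw [refDensity, ← Finset.mul_prod_erase _ _ (Finset.mem_univ k), Function.update_self, hc]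
      congr 1
      refine Finset.prod_congr rfl fun i hi => ?_
      rw [Function.update_of_ne (Finset.ne_of_mem_erase hi)]
    rw [h1, Real.log_mul (gaussianPDFReal_pos _ _ _ (hv0 _)).ne' hc0.ne', gaussianPDFReal,
      Real.coe_toNNReal _ (hv _).le, Real.log_mul, Real.log_exp, sub_zero]
    · have := hv k.1
      have := Real.pi_pos
      positivity
    · exact (Real.exp_pos _).ne'
  rw [h]
  have h2 : HasDerivAt (fun u : ℝ => Real.log ((Real.sqrt (2 * Real.pi *
      eigenvalue T β N k.1))⁻¹) + -u ^ 2 / (2 * eigenvalue T β N k.1) + Real.log c)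
      (-(2 * x k) / (2 * eigenvalue T β N k.1)) (x k) := by
    have := (((hasDerivAt_pow 2 (x k)).neg.div_const (2 * eigenvalue T β N k.1)).const_add
      (Real.log ((Real.sqrt (2 * Real.pi * eigenvalue T β N k.1))⁻¹))).add_const (Real.log c)
    simpa using this
  rw [h2.deriv]
  have := (hv k.1).ne'
  field_simp

lemma proposalMean_apply (hT : 0 < T) (hβ : 0 < β) (x : State d N) (k : Fin N × Fin d) :
    proposalMean T β alg σ x k =
      x k + σ * alg.drift (σ / stdDev T β N k.1) * (x k / stdDev T β N k.1) := by
  cases alg with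
  | RWM => simp [proposalMean, Algorithm.drift]
  | SLA =>
    have := (stdDev_pos hT hβ k.1).ne'
    simp only [proposalMean, Algorithm.drift]
    rw [deriv_log_refDensity hT hβ, ← stdDev_sq hT hβ]
    field_simp

lemma proposal_apply (hT : 0 < T) (hβ : 0 < β) (x z : State d N) (k : Fin N × Fin d) :
    proposal T β alg σ x z k = x k + σ * (z k + alg.drift (σ / stdDev T β N k.1) *
      standardize T β x k) := by
  rw [proposal, proposalMean_apply hT hβ, standardize]
  ring

lemma measurable_proposal (hT : 0 < T) (hβ : 0 < β) :
    Measurable fun p : State d N × State d N => proposal T β alg σ p.1 p.2 := by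
  refine measurable_pi_lambda _ fun k => ?_
  simp_rw [proposal_apply hT hβ]
  unfold standardize
  fun_prop

/-! ### The acceptance probability -/

/-- The log-ratio for the reference law as a quadratic form in the standardized coordinates. -/
def logRatio (T β : ℝ) (alg : Algorithm) (σ : ℝ) (ξ z : State d N) : ℝ :=
  quadForm (fun k => alg.coefA (σ / stdDev T β N k.1)) (fun k => alg.coefB (σ / stdDev T β N k.1))
    (fun k => alg.coefC (σ / stdDev T β N k.1)) ξ z

/-- The normalizing constants of the Gaussian densities agree on the two sides, so only the
exponents have to be compared. In the variables ξ, z and s = σ/λ this comparison is a polynomial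
identity, which is the origin of `coefA`, `coefB` and `coefC`. -/
lemma coord_ratio (hT : 0 < T) (hβ : 0 < β) (hσ : 0 < σ) (x z : State d N) (k : Fin N × Fin d) :
    gaussianPDFReal 0 (eigenvalue T β N k.1).toNNReal (proposal T β alg σ x z k) *
        gaussianPDFReal (proposalMean T β alg σ (proposal T β alg σ x z) k) (σ ^ 2).toNNReal (x k) =
      Real.exp (alg.coefA (σ / stdDev T β N k.1) * standardize T β x k * z k +
          alg.coefB (σ / stdDev T β N k.1) * standardize T β x k ^ 2 +
          alg.coefC (σ / stdDev T β N k.1) * z k ^ 2) *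
        (gaussianPDFReal 0 (eigenvalue T β N k.1).toNNReal (x k) *
          gaussianPDFReal (proposalMean T β alg σ x k) (σ ^ 2).toNNReal
            (proposal T β alg σ x z k)) := by
  have hl := stdDev_pos (N := N) hT hβ k.1
  have hl' := hl.ne'
  have hσ' := hσ.ne'
  have hexp : ∀ A B e₁ e₂ e₀ f₁ f₂ : ℝ, e₁ + e₂ = e₀ + (f₁ + f₂) →
      A * Real.exp e₁ * (B * Real.exp e₂) =
        Real.exp e₀ * (A * Real.exp f₁ * (B * Real.exp f₂)) := by
    intro A B e₁ e₂ e₀ f₁ f₂ h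
    have h' : Real.exp e₁ * Real.exp e₂ = Real.exp e₀ * (Real.exp f₁ * Real.exp f₂) := by
      rw [← Real.exp_add, ← Real.exp_add, ← Real.exp_add, h]
    linear_combination (A * B) * h'
  simp only [gaussianPDFReal, Real.coe_toNNReal _ (sq_nonneg _), ← stdDev_sq hT hβ]
  refine hexp _ _ _ _ _ _ _ ?_
  rw [proposalMean_apply hT hβ (proposal T β alg σ x z), proposalMean_apply hT hβ x,
    proposal_apply hT hβ]
  obtain ⟨u, hu⟩ : ∃ u, x k = stdDev T β N k.1 * u := ⟨x k / stdDev T β N k.1, by field_simp⟩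
  have hu' : standardize T β x k = u := by rw [standardize, hu]; field_simp
  rw [hu', hu]
  generalize z k = w
  generalize stdDev T β N k.1 = r at hl hl'
  cases alg with
  | RWM =>
    simp only [Algorithm.drift, Algorithm.coefA, Algorithm.coefB, Algorithm.coefC]
    field_simp
    ring
  | SLA =>
    simp only [Algorithm.drift, Algorithm.coefA, Algorithm.coefB, Algorithm.coefC]
    field_simp
    ring

/-- The normalizing constant of the target. -/
def partitionFunction (N : ℕ) (T β : ℝ) (G : EuclideanSpace ℝ (Fin d) → ℝ) : ℝ :=
  ∫ z, Real.exp (-potential T G z) ∂(reference d N T β)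

/-- All densities are strictly positive, so the degenerate branch of `acceptance` never occurs and
the partition function cancels. -/
lemma acceptance_eq (hT : 0 < T) (hβ : 0 < β) (hσ : 0 < σ)
    (hZ : 0 < partitionFunction N T β G) (x z : State d N) :
    acceptance T β G alg σ x (proposal T β alg σ x z) =
      acc (logRatio T β alg σ (standardize T β x) z +
        (potential T G x - potential T G (proposal T β alg σ x z))) := by
  set y := proposal T β alg σ x z with hy
  have hv0 : ∀ i : Fin N, (eigenvalue T β N i).toNNReal ≠ 0 := fun i =>
    (Real.toNNReal_pos.2 (eigenvalue_pos hT hβ i)).ne'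
  have hσ0 : (σ ^ 2).toNNReal ≠ 0 := (Real.toNNReal_pos.2 (by positivity)).ne'
  have href : ∀ u : State d N, 0 < refDensity T β u := fun u =>
    Finset.prod_pos fun i _ => gaussianPDFReal_pos _ _ _ (hv0 _)
  have hprop : ∀ u v : State d N, 0 < proposalDensity T β alg σ u v := fun u v =>
    Finset.prod_pos fun i _ => gaussianPDFReal_pos _ _ _ hσ0
  have hratio : refDensity T β y * proposalDensity T β alg σ y x =
      Real.exp (logRatio T β alg σ (standardize T β x) z) *
        (refDensity T β x * proposalDensity T β alg σ x y) := by
    simp only [refDensity, proposalDensity, logRatio, quadForm, Real.exp_sum,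
      ← Finset.prod_mul_distrib]
    exact Finset.prod_congr rfl fun k _ => coord_ratio hT hβ hσ x z k
  have htarget : ∀ u : State d N, targetDensity T β G u =
      Real.exp (-potential T G u) / partitionFunction N T β G * refDensity T β u := fun u => rfl
  have hpos : 0 < targetDensity T β G x * proposalDensity T β alg σ x y := by
    rw [htarget]
    have := href x
    have := hprop x y
    positivity
  rw [acceptance, if_pos hpos, acc]
  congr 1
  rw [div_eq_iff hpos.ne', htarget, htarget, mul_assoc, hratio]
  have : Real.exp (logRatio T β alg σ (standardize T β x) z +
      (potential T G x - potential T G y)) * Real.exp (-potential T G x) =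
      Real.exp (logRatio T β alg σ (standardize T β x) z) * Real.exp (-potential T G y) := by
    rw [← Real.exp_add, ← Real.exp_add]
    congr 1
    ring
  linear_combination (-(refDensity T β x * proposalDensity T β alg σ x y /
    partitionFunction N T β G)) * this

/-! ### The potential -/

lemma GrowthCondition.continuous (hG : GrowthCondition G) : Continuous G := by
  obtain ⟨-, C, p, hC, hp, h⟩ := hG
  refine continuous_iff_continuousAt.2 fun v => ?_
  rw [ContinuousAt, tendsto_iff_dist_tendsto_zero]
  have hlim : Tendsto (fun w => C * (1 + ‖v‖ ^ p + ‖w - v‖ ^ p) * ‖w - v‖) (𝓝 v) (𝓝 0) := by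
    have hc : Continuous fun w => C * (1 + ‖v‖ ^ p + ‖w - v‖ ^ p) * ‖w - v‖ := by
      have : Continuous fun w : EuclideanSpace ℝ (Fin d) => ‖w - v‖ ^ p :=
        Continuous.rpow_const (by fun_prop) fun _ => Or.inr hp.le
      fun_prop
    simpa using hc.tendsto v
  exact squeeze_zero (fun _ => dist_nonneg) (fun w => by rw [Real.dist_eq]; exact h v w) hlim

lemma continuous_path (t : Fin N) : Continuous fun x : State d N => path T x t := by
  unfold path
  fun_prop

lemma measurable_potential (hG : GrowthCondition G) :
    Measurable fun x : State d N => potential T G x := by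
  unfold potential
  refine Finset.measurable_sum _ fun t _ => Measurable.mul_const ?_ _
  exact (hG.continuous.comp (continuous_path t)).measurable

lemma sum_mesh_le (hT : 0 < T) : ∑ _t : Fin N, mesh T N ≤ T := by
  rw [Finset.sum_const, Finset.card_univ, Fintype.card_fin, nsmul_eq_mul, mesh, mul_div_assoc',
    div_le_iff₀ (by positivity)]
  nlinarith

lemma mesh_nonneg (hT : 0 < T) : 0 ≤ mesh T N := by
  unfold mesh
  positivity

lemma neg_le_potential (hT : 0 < T) {m : ℝ} (hm : ∀ v, m ≤ G v) (x : State d N) :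
    -(|m| * T) ≤ potential T G x := by
  -- The absolute value is needed because the meshes sum to less than T: for positive m the bound m
  -- T would fail in general.
  have h1 : -(|m| * T) ≤ -|m| * ∑ _t : Fin N, mesh T N := by
    have := mul_le_mul_of_nonneg_left (sum_mesh_le (N := N) hT) (abs_nonneg m)
    linarith
  refine h1.trans ?_
  rw [Finset.mul_sum]
  refine Finset.sum_le_sum fun t _ => mul_le_mul_of_nonneg_right ?_ (mesh_nonneg hT)
  exact (neg_abs_le m).trans (hm _)

lemma integrable_exp_neg_potential (hT : 0 < T) (hG : GrowthCondition G)
    (μ : Measure (State d N)) [IsFiniteMeasure μ] :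
    Integrable (fun x => Real.exp (-potential T G x)) μ := by
  obtain ⟨m, hm⟩ := hG.1
  have := measurable_potential (N := N) (T := T) hG
  refine Integrable.of_bound (by fun_prop) (Real.exp (|m| * T)) (ae_of_all _ fun x => ?_)
  rw [Real.norm_eq_abs, Real.abs_exp]
  exact Real.exp_le_exp.2 (by linarith [neg_le_potential hT hm x])

/-! ### The target as a weighted Gaussian law -/

instance : IsProbabilityMeasure (reference d N T β) := by
  unfold reference
  infer_instance

lemma partitionFunction_pos (hT : 0 < T) (hG : GrowthCondition G) :
    0 < partitionFunction N T β G :=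
  integral_exp_pos (integrable_exp_neg_potential hT hG _)

lemma isProbabilityMeasure_target (hT : 0 < T) (hG : GrowthCondition G) :
    IsProbabilityMeasure (target N T β G) :=
  isProbabilityMeasure_tilted (integrable_exp_neg_potential hT hG _)

/-- The density of the target with respect to the reference law, in standardized coordinates. -/
def weight (T β : ℝ) (G : EuclideanSpace ℝ (Fin d) → ℝ) (ξ : State d N) : ℝ :=
  Real.exp (-potential T G (rescale T β ξ)) / partitionFunction N T β G

lemma measurable_weight (hG : GrowthCondition G) :
    Measurable (weight T β G : State d N → ℝ) := by
  have := measurable_potential (N := N) (T := T) hG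
  unfold weight
  fun_prop

lemma weight_pos (hT : 0 < T) (hG : GrowthCondition G) (ξ : State d N) : 0 < weight T β G ξ :=
  div_pos (Real.exp_pos _) (partitionFunction_pos hT hG)

lemma integral_weight (hT : 0 < T) (hβ : 0 < β) (hG : GrowthCondition G) :
    ∫ ξ, weight T β G ξ ∂(stdNormal (Fin N × Fin d)) = 1 := by
  have hm := measurable_potential (N := N) (T := T) hG
  have h : ∫ ξ, Real.exp (-potential T G (rescale T β ξ)) ∂(stdNormal (Fin N × Fin d)) =
      partitionFunction N T β G := by
    rw [partitionFunction, ← map_rescale hT hβ, integral_map (by fun_prop) (by fun_prop)]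
  unfold weight
  rw [integral_div, h, div_self (partitionFunction_pos hT hG).ne']

lemma target_prod (hT : 0 < T) (hβ : 0 < β) (hG : GrowthCondition G) :
    (target N T β G).prod (stdNormal (Fin N × Fin d)) =
      ((pairLaw (Fin N × Fin d)).map (Prod.map (rescale T β) id)).withDensity
        fun p => ENNReal.ofReal (Real.exp (-potential T G p.1) / partitionFunction N T β G) := by
  have hm := measurable_potential (N := N) (T := T) hG
  rw [← Measure.map_prod_map _ _ (by fun_prop) measurable_id, map_rescale hT hβ, Measure.map_id,
    target, Measure.tilted, prod_withDensity_left (by fun_prop)]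
  rfl

lemma integral_target_prod (hT : 0 < T) (hβ : 0 < β) (hG : GrowthCondition G)
    {F : State d N × State d N → ℝ} (hF : Measurable F) :
    ∫ p, F p ∂((target N T β G).prod (stdNormal (Fin N × Fin d))) =
      ∫ p, weight T β G p.1 * F (rescale T β p.1, p.2) ∂(pairLaw (Fin N × Fin d)) := by
  have hm := measurable_potential (N := N) (T := T) hG
  have hZ := partitionFunction_pos (N := N) (β := β) hT hG
  rw [target_prod hT hβ hG, integral_withDensity_eq_integral_toReal_smul (by fun_prop)
    (ae_of_all _ fun _ => ENNReal.ofReal_lt_top), integral_map (by fun_prop) (by fun_prop)]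
  refine integral_congr_ae (ae_of_all _ fun p => ?_)
  simp only [smul_eq_mul]
  rw [ENNReal.toReal_ofReal (by positivity)]
  rfl

lemma integrable_target_prod (hT : 0 < T) (hβ : 0 < β) (hG : GrowthCondition G)
    {F : State d N × State d N → ℝ} (hF : Measurable F)
    (h : Integrable (fun p => weight T β G p.1 * F (rescale T β p.1, p.2))
      (pairLaw (Fin N × Fin d))) :
    Integrable F ((target N T β G).prod (stdNormal (Fin N × Fin d))) := by
  have hm := measurable_potential (N := N) (T := T) hG
  have hZ := partitionFunction_pos (N := N) (β := β) hT hG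
  rw [target_prod hT hβ hG, integrable_withDensity_iff_integrable_smul' (by fun_prop)
    (ae_of_all _ fun _ => ENNReal.ofReal_lt_top), integrable_map_measure (by fun_prop)
    (by fun_prop)]
  refine h.congr (ae_of_all _ fun p => ?_)
  simp only [smul_eq_mul, Function.comp_apply]
  rw [ENNReal.toReal_ofReal (by positivity)]
  rfl

/-- The increment of the proposal, in units of `σ` and in standardized coordinates. -/
def increment (T β : ℝ) (alg : Algorithm) (σ : ℝ) (ξ z : State d N) : State d N :=
  fun k => z k + alg.drift (σ / stdDev T β N k.1) * ξ k

lemma proposal_rescale (hT : 0 < T) (hβ : 0 < β) (ξ z : State d N) :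
    proposal T β alg σ (rescale T β ξ) z = fun k =>
      rescale T β ξ k + σ * increment T β alg σ ξ z k := by
  ext k
  rw [proposal_apply hT hβ, standardize_rescale hT hβ]
  rfl

/-- The difference of the potentials of the current state and of the proposal. -/
def potentialDrop (T β : ℝ) (G : EuclideanSpace ℝ (Fin d) → ℝ) (alg : Algorithm) (σ : ℝ)
    (ξ z : State d N) : ℝ :=
  potential T G (rescale T β ξ) -
    potential T G (fun k => rescale T β ξ k + σ * increment T β alg σ ξ z k)

lemma measurable_acceptance (hT : 0 < T) (hβ : 0 < β) (hG : GrowthCondition G) (hσ : 0 < σ) :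
    Measurable fun p : State d N × State d N =>
      acceptance T β G alg σ p.1 (proposal T β alg σ p.1 p.2) := by
  simp_rw [acceptance_eq hT hβ hσ (partitionFunction_pos hT hG)]
  have hm := measurable_potential (N := N) (T := T) hG
  have hp := measurable_proposal (d := d) (N := N) (alg := alg) (σ := σ) hT hβ
  have hq := measurable_quadForm (fun k : Fin N × Fin d => alg.coefA (σ / stdDev T β N k.1))
    (fun k => alg.coefB (σ / stdDev T β N k.1)) (fun k => alg.coefC (σ / stdDev T β N k.1))
  have hr : Measurable fun p : State d N × State d N =>
      logRatio T β alg σ (standardize T β p.1) p.2 :=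
    hq.comp (f := fun p : State d N × State d N => (standardize T β p.1, p.2)) (by fun_prop)
  exact measurable_acc.comp
    (hr.add ((hm.comp measurable_fst).sub (hm.comp hp)))

lemma measurable_potentialDrop (hG : GrowthCondition G) :
    Measurable fun p : State d N × State d N => potentialDrop T β G alg σ p.1 p.2 := by
  have hm := measurable_potential (N := N) (T := T) hG
  unfold potentialDrop
  refine (hm.comp (measurable_rescale.comp measurable_fst)).sub (hm.comp ?_)
  unfold rescale increment
  fun_prop

lemma acceptance_rescale (hT : 0 < T) (hβ : 0 < β) (hG : GrowthCondition G) (hσ : 0 < σ)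
    (ξ z : State d N) :
    acceptance T β G alg σ (rescale T β ξ) (proposal T β alg σ (rescale T β ξ) z) =
      acc (logRatio T β alg σ ξ z + potentialDrop T β G alg σ ξ z) := by
  rw [acceptance_eq hT hβ hσ (partitionFunction_pos hT hG), standardize_rescale hT hβ,
    proposal_rescale hT hβ]
  rfl

lemma meanAcceptance_eq (hT : 0 < T) (hβ : 0 < β) (hG : GrowthCondition G) {l ρ : ℝ}
    (hσ : 0 < stepSize d N l ρ) :
    meanAcceptance T β G alg l ρ N =
      ∫ p, weight T β G p.1 * acc (logRatio T β alg (stepSize d N l ρ) p.1 p.2 +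
        potentialDrop T β G alg (stepSize d N l ρ) p.1 p.2) ∂(pairLaw (Fin N × Fin d)) := by
  have := isProbabilityMeasure_target (N := N) (β := β) hT hG
  rw [meanAcceptance, stationaryLaw, integral_fun_fst (fun p : State d N × State d N =>
    acceptance T β G alg (stepSize d N l ρ) p.1 (proposal T β alg (stepSize d N l ρ) p.1 p.2)),
    integral_target_prod hT hβ hG (measurable_acceptance hT hβ hG hσ)]
  simp [acceptance_rescale hT hβ hG hσ]

/-! ### Integrating out the acceptance variable -/

lemma squaredJump_eq (l ρ : ℝ) (k : Fin N × Fin d) (ω : (State d N × State d N) × ℝ) :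
    squaredJump T β G alg l ρ k ω =
      (Set.Iic (acceptance T β G alg (stepSize d N l ρ) ω.1.1
        (proposal T β alg (stepSize d N l ρ) ω.1.1 ω.1.2))).indicator (fun _ =>
        (proposal T β alg (stepSize d N l ρ) ω.1.1 ω.1.2 k - ω.1.1 k) ^ 2) ω.2 := by
  unfold squaredJump nextState
  by_cases h : ω.2 ≤ acceptance T β G alg (stepSize d N l ρ) ω.1.1
        (proposal T β alg (stepSize d N l ρ) ω.1.1 ω.1.2)
  · rw [if_pos h, Set.indicator_of_mem (by exact h)]
  · rw [if_neg h, Set.indicator_of_notMem (by exact h)]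
    simp

lemma integral_uniform_Iic {a : ℝ} (h0 : 0 ≤ a) (h1 : a ≤ 1) (c : ℝ) :
    ∫ u, (Set.Iic a).indicator (fun _ => c) u ∂(volume.restrict (Set.Icc (0 : ℝ) 1)) = a * c := by
  have h : Set.Iic a ∩ Set.Icc 0 1 = Set.Icc 0 a := by
    ext u
    simp only [Set.mem_inter_iff, Set.mem_Iic, Set.mem_Icc]
    exact ⟨fun h => ⟨h.2.1, h.1⟩, fun h => ⟨h.2, h.1, h.2.trans h1⟩⟩
  rw [integral_indicator measurableSet_Iic, setIntegral_const, smul_eq_mul,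
    measureReal_restrict_apply measurableSet_Iic, h]
  simp [h0]

lemma integrable_sq_increment (hT : 0 < T) (hG : GrowthCondition G)
    {a : State d N × State d N → ℝ} (ha : Measurable a) (ha1 : ∀ p, |a p| ≤ 1)
    (k : Fin N × Fin d) :
    Integrable (fun p => weight T β G p.1 * (a p * increment T β alg σ p.1 p.2 k ^ 2))
      (pairLaw (Fin N × Fin d)) := by
  obtain ⟨m, hm⟩ := hG.1
  have hw := measurable_weight (N := N) (T := T) (β := β) hG
  set g := alg.drift (σ / stdDev T β N k.1)
  have hi : Integrable (fun p : State d N × State d N => 2 * p.2 k ^ 2 + 2 * g ^ 2 * p.1 k ^ 2)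
      (pairLaw (Fin N × Fin d)) :=
    ((integrable_pow_coord_snd k 2).const_mul 2).add
      ((integrable_pow_coord_fst k 2).const_mul (2 * g ^ 2))
  have hZ := partitionFunction_pos (N := N) (β := β) hT hG
  refine (hi.const_mul (Real.exp (|m| * T) / partitionFunction N T β G)).mono' ?_
    (ae_of_all _ fun p => ?_)
  · unfold increment
    fun_prop
  · rw [Real.norm_eq_abs, abs_mul, abs_of_nonneg (weight_pos hT hG _).le, abs_mul,
      abs_of_nonneg (sq_nonneg (increment T β alg σ p.1 p.2 k))]
    refine mul_le_mul ?_ ?_ (by positivity) (by positivity)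
    · unfold weight
      gcongr
      linarith [neg_le_potential hT hm (rescale T β p.1)]
    · refine (mul_le_of_le_one_left (sq_nonneg _) (ha1 p)).trans ?_
      have : increment T β alg σ p.1 p.2 k = p.2 k + g * p.1 k := rfl
      rw [this]
      nlinarith [sq_nonneg (p.2 k - g * p.1 k)]

lemma integrable_squaredJump (hT : 0 < T) (hβ : 0 < β) (hG : GrowthCondition G) {l ρ : ℝ}
    (hσ : 0 < stepSize d N l ρ) (k : Fin N × Fin d) :
    Integrable (squaredJump T β G alg l ρ k) (stationaryLaw N T β G) := by
  have := isProbabilityMeasure_target (N := N) (β := β) hT hG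
  have ha := measurable_acceptance (d := d) (N := N) (alg := alg) hT hβ hG hσ
  have hp := measurable_proposal (d := d) (N := N) (alg := alg) (σ := stepSize d N l ρ) hT hβ
  have hpk : Measurable fun p : State d N × State d N =>
      (proposal T β alg (stepSize d N l ρ) p.1 p.2 k - p.1 k) ^ 2 :=
    (((measurable_pi_apply k).comp hp).sub ((measurable_pi_apply k).comp measurable_fst)).pow_const 2
  have hD : Integrable (fun p : State d N × State d N =>
      (proposal T β alg (stepSize d N l ρ) p.1 p.2 k - p.1 k) ^ 2)
      ((target N T β G).prod (stdNormal (Fin N × Fin d))) := by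
    refine integrable_target_prod hT hβ hG hpk ?_
    have := (integrable_sq_increment (β := β) (alg := alg) (σ := stepSize d N l ρ) hT hG
      (a := fun _ => 1) (by fun_prop) (by simp) k).const_mul (stepSize d N l ρ ^ 2)
    refine this.congr (ae_of_all _ fun p => ?_)
    simp only [proposal_rescale hT hβ]
    ring
  have hmeas : Measurable (squaredJump (d := d) (N := N) T β G alg l ρ k) := by
    have hset : MeasurableSet {ω : (State d N × State d N) × ℝ |
        ω.2 ≤ acceptance T β G alg (stepSize d N l ρ) ω.1.1
          (proposal T β alg (stepSize d N l ρ) ω.1.1 ω.1.2)} :=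
      measurableSet_le measurable_snd (ha.comp measurable_fst)
    have h := (hpk.comp measurable_fst).indicator hset
    convert! h using 1
    ext ω
    rw [squaredJump_eq]
    rfl
  refine (hD.comp_fst (volume.restrict (Set.Icc (0 : ℝ) 1))).mono' hmeas.aestronglyMeasurable
    (ae_of_all _ fun ω => ?_)
  rw [squaredJump_eq, Real.norm_eq_abs]
  rw [Set.indicator_apply]
  split_ifs
  · rw [abs_of_nonneg (sq_nonneg _)]
  · simpa using sq_nonneg _

lemma meanSquaredJump_eq (hT : 0 < T) (hβ : 0 < β) (hG : GrowthCondition G) {l ρ : ℝ}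
    (hσ : 0 < stepSize d N l ρ) {i : ℕ} (hi : i < N) (j : Fin d) :
    meanSquaredJump T β G alg l ρ i j N = stepSize d N l ρ ^ 2 *
      ∫ p, weight T β G p.1 * (acc (logRatio T β alg (stepSize d N l ρ) p.1 p.2 +
        potentialDrop T β G alg (stepSize d N l ρ) p.1 p.2) *
          increment T β alg (stepSize d N l ρ) p.1 p.2 (⟨i, hi⟩, j) ^ 2)
          ∂(pairLaw (Fin N × Fin d)) := by
  have := isProbabilityMeasure_target (N := N) (β := β) hT hG
  have ha := measurable_acceptance (d := d) (N := N) (alg := alg) hT hβ hG hσ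
  have hp := measurable_proposal (d := d) (N := N) (alg := alg) (σ := stepSize d N l ρ) hT hβ
  set k : Fin N × Fin d := (⟨i, hi⟩, j)
  have hpk : Measurable fun p : State d N × State d N =>
      (proposal T β alg (stepSize d N l ρ) p.1 p.2 k - p.1 k) ^ 2 :=
    (((measurable_pi_apply k).comp hp).sub ((measurable_pi_apply k).comp measurable_fst)).pow_const 2
  rw [meanSquaredJump, dif_pos hi, stationaryLaw, integral_prod _
    (integrable_squaredJump hT hβ hG hσ k)]
  have h1 : ∀ p : State d N × State d N, ∫ u, squaredJump T β G alg l ρ k (p, u)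
      ∂(volume.restrict (Set.Icc (0 : ℝ) 1)) =
      acceptance T β G alg (stepSize d N l ρ) p.1 (proposal T β alg (stepSize d N l ρ) p.1 p.2) *
        (proposal T β alg (stepSize d N l ρ) p.1 p.2 k - p.1 k) ^ 2 := by
    intro p
    simp_rw [squaredJump_eq]
    refine integral_uniform_Iic ?_ ?_ _
    · rw [acceptance_eq hT hβ hσ (partitionFunction_pos hT hG)]
      exact acc_nonneg _
    · rw [acceptance_eq hT hβ hσ (partitionFunction_pos hT hG)]
      exact acc_le_one _
  simp_rw [h1]
  have hF : Measurable fun p : State d N × State d N =>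
      acceptance T β G alg (stepSize d N l ρ) p.1 (proposal T β alg (stepSize d N l ρ) p.1 p.2) *
        (proposal T β alg (stepSize d N l ρ) p.1 p.2 k - p.1 k) ^ 2 := ha.mul hpk
  rw [integral_target_prod hT hβ hG hF, ← integral_const_mul]
  refine integral_congr_ae (ae_of_all _ fun p => ?_)
  simp only [acceptance_rescale hT hβ hG hσ]
  simp only [proposal_rescale hT hβ]
  ring

end Model

/-! ### Consequences of the growth condition -/

section Growth

variable {d : ℕ}

lemma exists_rpow_le_exp (q : ℝ) (hq : 0 ≤ q) :
    ∃ K : ℝ, 0 ≤ K ∧ ∀ r : ℝ, 0 ≤ r → r ^ q ≤ K * Real.exp r := by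
  refine ⟨(Nat.factorial ⌈q⌉₊ : ℝ), by positivity, fun r hr => ?_⟩
  have hf : (1 : ℝ) ≤ (Nat.factorial ⌈q⌉₊ : ℝ) := by exact_mod_cast Nat.factorial_pos _
  rcases le_total r 1 with h | h
  · have h1 : r ^ q ≤ 1 := Real.rpow_le_one hr h hq
    have h2 := Real.one_le_exp hr
    nlinarith
  · have h1 : r ^ q ≤ r ^ ⌈q⌉₊ := by
      rw [← Real.rpow_natCast]
      exact Real.rpow_le_rpow_of_exponent_le h (Nat.le_ceil q)
    have h2 := Real.pow_div_factorial_le_exp r hr ⌈q⌉₊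
    rw [div_le_iff₀ (by positivity)] at h2
    linarith

/-- The sum of the exponentials of the coordinates and of their opposites. -/
def expSum (v : EuclideanSpace ℝ (Fin d)) : ℝ := ∑ j, (Real.exp (v j) + Real.exp (-v j))

lemma expSum_nonneg (v : EuclideanSpace ℝ (Fin d)) : 0 ≤ expSum v :=
  Finset.sum_nonneg fun _ _ => by positivity

/-- Powers of the norm are traded for exponentials of coordinates, because along a Gaussian path
those have explicit moments depending only on the variance. -/
lemma exists_norm_rpow_le (q : ℝ) (hq : 0 ≤ q) :
    ∃ K : ℝ, 0 ≤ K ∧ ∀ v : EuclideanSpace ℝ (Fin d), ‖v‖ ^ q ≤ K * (1 + expSum v) := by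
  obtain ⟨K, hK, h⟩ := exists_rpow_le_exp q hq
  have hd : (0 : ℝ) ≤ Real.sqrt d ^ q := Real.rpow_nonneg (Real.sqrt_nonneg _) _
  -- The summand 1 covers d = 0, where there is no largest coordinate to compare with.
  refine ⟨1 + Real.sqrt d ^ q * K, by positivity, fun v => ?_⟩
  have hE := expSum_nonneg v
  have hdK := mul_nonneg hd hK
  rcases isEmpty_or_nonempty (Fin d) with he | hne
  · have hv : v = 0 := by
      ext j
      exact he.elim j
    have : ‖v‖ ^ q ≤ 1 := Real.rpow_le_one (norm_nonneg _) (by simp [hv]) hq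
    nlinarith
  · obtain ⟨j, -, hj⟩ := Finset.exists_max_image Finset.univ (fun j => |v j|) Finset.univ_nonempty
    have h1 : ‖v‖ ≤ Real.sqrt d * |v j| := by
      rw [EuclideanSpace.norm_eq]
      refine Real.sqrt_le_iff.2 ⟨by positivity, ?_⟩
      rw [mul_pow, Real.sq_sqrt (Nat.cast_nonneg d)]
      refine (Finset.sum_le_card_nsmul _ _ (|v j| ^ 2) fun i hi => ?_).trans (by simp)
      rw [Real.norm_eq_abs]
      exact pow_le_pow_left₀ (abs_nonneg _) (hj i hi) 2
    have h2 : Real.exp |v j| ≤ expSum v := by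
      have h3 : Real.exp |v j| ≤ Real.exp (v j) + Real.exp (-v j) := by
        rcases abs_cases (v j) with ⟨h4, -⟩ | ⟨h4, -⟩ <;> rw [h4] <;>
          linarith [Real.exp_pos (v j), Real.exp_pos (-v j)]
      exact h3.trans (Finset.single_le_sum
        (f := fun j => Real.exp (v j) + Real.exp (-v j)) (fun _ _ => by positivity)
        (Finset.mem_univ j))
    calc ‖v‖ ^ q ≤ (Real.sqrt d * |v j|) ^ q := Real.rpow_le_rpow (norm_nonneg _) h1 hq
      _ = Real.sqrt d ^ q * |v j| ^ q := Real.mul_rpow (Real.sqrt_nonneg _) (abs_nonneg _)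
      _ ≤ Real.sqrt d ^ q * (K * Real.exp |v j|) :=
          mul_le_mul_of_nonneg_left (h _ (abs_nonneg _)) hd
      _ ≤ Real.sqrt d ^ q * (K * expSum v) := by gcongr
      _ ≤ (1 + Real.sqrt d ^ q * K) * (1 + expSum v) := by nlinarith

variable {G : EuclideanSpace ℝ (Fin d) → ℝ}

lemma GrowthCondition.exists_abs_le (hG : GrowthCondition G) :
    ∃ K : ℝ, 0 ≤ K ∧ ∀ v, |G v| ≤ K * (1 + expSum v) := by
  obtain ⟨-, C, p, hC, hp, h⟩ := hG
  obtain ⟨K₁, hK₁, h₁⟩ := exists_norm_rpow_le (d := d) 1 zero_le_one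
  obtain ⟨K₂, hK₂, h₂⟩ := exists_norm_rpow_le (d := d) (p + 1) (by linarith)
  refine ⟨|G 0| + C * (K₁ + K₂), by positivity, fun v => ?_⟩
  have hv := h 0 v
  rw [norm_zero, Real.zero_rpow hp.ne', sub_zero, add_zero] at hv
  have e1 := h₁ v
  have e2 := h₂ v
  rw [Real.rpow_one] at e1
  rw [Real.rpow_add_one' (norm_nonneg _) (by linarith)] at e2
  have e3 : |G v| ≤ |G 0| + |G v - G 0| := by
    have := abs_add_le (G 0) (G v - G 0)
    rwa [add_sub_cancel] at this
  have e4 : C * (1 + ‖v‖ ^ p) * ‖v‖ ≤ C * ((K₁ + K₂) * (1 + expSum v)) := by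
    rw [mul_assoc]
    refine mul_le_mul_of_nonneg_left ?_ hC.le
    linarith
  have e5 : |G 0| ≤ |G 0| * (1 + expSum v) :=
    le_mul_of_one_le_right (abs_nonneg _) (by linarith [expSum_nonneg v])
  linarith

/-- The growth condition is linear in the displacement, so a factor ε comes out; the condition ε ≤ 1
lets its other occurrence, (ε‖u‖)^p, be bounded by ‖u‖^p. The mixed term ‖v‖^p ‖u‖ is split by the
inequality between means, whence the exponents 2p and 2. -/
lemma GrowthCondition.exists_abs_sub_le (hG : GrowthCondition G) :
    ∃ K : ℝ, 0 ≤ K ∧ ∀ (ε : ℝ) (v u : EuclideanSpace ℝ (Fin d)), 0 ≤ ε → ε ≤ 1 →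
      |G v - G (v + ε • u)| ≤ ε * (K * (1 + expSum v + expSum u)) := by
  obtain ⟨-, C, p, hC, hp, h⟩ := hG
  obtain ⟨K₁, hK₁, h₁⟩ := exists_norm_rpow_le (d := d) 1 zero_le_one
  obtain ⟨K₂, hK₂, h₂⟩ := exists_norm_rpow_le (d := d) (p + 1) (by linarith)
  obtain ⟨K₃, hK₃, h₃⟩ := exists_norm_rpow_le (d := d) (p * 2) (by linarith)
  obtain ⟨K₄, hK₄, h₄⟩ := exists_norm_rpow_le (d := d) 2 (by norm_num)
  refine ⟨C * (K₁ + K₂ + K₃ + K₄), by positivity, fun ε v u h0 h1 => ?_⟩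
  have hv := h v (v + ε • u)
  rw [abs_sub_comm]
  refine hv.trans ?_
  rw [add_sub_cancel_left, norm_smul, Real.norm_eq_abs, abs_of_nonneg h0]
  have e1 := h₁ u
  have e2 := h₂ u
  have e3 := h₃ v
  have e4 := h₄ u
  rw [Real.rpow_one] at e1
  rw [Real.rpow_add_one' (norm_nonneg _) (by linarith)] at e2
  rw [Real.rpow_mul (norm_nonneg _)] at e3
  rw [Real.rpow_two] at e3 e4
  have e5 : (ε * ‖u‖) ^ p ≤ ‖u‖ ^ p :=
    Real.rpow_le_rpow (by positivity) (mul_le_of_le_one_left (norm_nonneg _) h1) hp.le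
  have e6 : ‖v‖ ^ p * ‖u‖ ≤ (‖v‖ ^ p) ^ 2 + ‖u‖ ^ 2 := by
    nlinarith [sq_nonneg (‖v‖ ^ p - ‖u‖), sq_nonneg (‖v‖ ^ p), sq_nonneg ‖u‖]
  have hEv := expSum_nonneg v
  have hEu := expSum_nonneg u
  have e7 : (1 + ‖v‖ ^ p + ‖u‖ ^ p) * ‖u‖ ≤
      (K₁ + K₂ + K₃ + K₄) * (1 + expSum v + expSum u) := by
    have f1 := mul_nonneg hK₁ hEv
    have f2 := mul_nonneg hK₂ hEv
    have f3 := mul_nonneg hK₃ hEu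
    have f4 := mul_nonneg hK₄ hEv
    nlinarith
  calc C * (1 + ‖v‖ ^ p + (ε * ‖u‖) ^ p) * (ε * ‖u‖)
      ≤ C * (1 + ‖v‖ ^ p + ‖u‖ ^ p) * (ε * ‖u‖) := by gcongr
    _ = ε * (C * ((1 + ‖v‖ ^ p + ‖u‖ ^ p) * ‖u‖)) := by ring
    _ ≤ ε * (C * ((K₁ + K₂ + K₃ + K₄) * (1 + expSum v + expSum u))) := by gcongr
    _ = _ := by ring

end Growth

/-! ### Exponential moments of the paths -/

section Moments

lemma exp_linear_pairLaw {ι : Type*} [Fintype ι] (u v : ι → ℝ) :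
    Integrable (fun p : (ι → ℝ) × (ι → ℝ) => Real.exp (∑ k, u k * p.1 k + ∑ k, v k * p.2 k))
      (pairLaw ι) ∧
    ∫ p, Real.exp (∑ k, u k * p.1 k + ∑ k, v k * p.2 k) ∂(pairLaw ι) =
      Real.exp ((∑ k, u k ^ 2 + ∑ k, v k ^ 2) / 2) := by
  simp_rw [Real.exp_add]
  constructor
  · exact (integrable_exp_sum_mul_stdNormal u).mul_prod (integrable_exp_sum_mul_stdNormal v)
  · rw [integral_prod_mul (fun ξ : ι → ℝ => Real.exp (∑ k, u k * ξ k))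
      (fun z : ι → ℝ => Real.exp (∑ k, v k * z k)), integral_exp_sum_mul_stdNormal,
      integral_exp_sum_mul_stdNormal, ← Real.exp_add, add_div]

variable {d N : ℕ} {T β : ℝ}

lemma sum_coord (f : Fin N → ℝ) (ξ : State d N) (j : Fin d) :
    ∑ k : Fin N × Fin d, (if k.2 = j then f k.1 else 0) * ξ k = ∑ i, f i * ξ (i, j) := by
  rw [Fintype.sum_prod_type]
  refine Finset.sum_congr rfl fun i _ => ?_
  simp

lemma sum_coord_sq (f : Fin N → ℝ) (j : Fin d) :
    ∑ k : Fin N × Fin d, (if k.2 = j then f k.1 else 0) ^ 2 = ∑ i, f i ^ 2 := by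
  rw [Fintype.sum_prod_type]
  refine Finset.sum_congr rfl fun i _ => ?_
  simp

/-- A path whose coordinates are linear in a pair of standard normal vectors. -/
def linearPath (f g : Fin N → ℝ) (p : State d N × State d N) : EuclideanSpace ℝ (Fin d) :=
  WithLp.toLp 2 fun j => ∑ i, f i * p.1 (i, j) + ∑ i, g i * p.2 (i, j)

/-- Each component of the path is a centred normal variable of variance at most B, so each of the 2d
exponentials has mean at most e^{B/2}. The bound is independent of N. -/
lemma expSum_linearPath (f g : Fin N → ℝ) {B : ℝ} (hB : ∑ i, f i ^ 2 + ∑ i, g i ^ 2 ≤ B) :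
    Integrable (fun p : State d N × State d N => expSum (linearPath f g p))
      (pairLaw (Fin N × Fin d)) ∧
    ∫ p : State d N × State d N, expSum (linearPath f g p) ∂(pairLaw (Fin N × Fin d)) ≤
      2 * d * Real.exp (B / 2) := by
  have h1 : ∀ (f g : Fin N → ℝ) (j : Fin d), ∑ i, f i ^ 2 + ∑ i, g i ^ 2 ≤ B →
      Integrable (fun p : State d N × State d N =>
        Real.exp (∑ i, f i * p.1 (i, j) + ∑ i, g i * p.2 (i, j))) (pairLaw (Fin N × Fin d)) ∧
      ∫ p : State d N × State d N,
        Real.exp (∑ i, f i * p.1 (i, j) + ∑ i, g i * p.2 (i, j)) ∂(pairLaw (Fin N × Fin d)) ≤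
        Real.exp (B / 2) := by
    intro f g j h
    have := exp_linear_pairLaw (fun k : Fin N × Fin d => if k.2 = j then f k.1 else 0)
      (fun k : Fin N × Fin d => if k.2 = j then g k.1 else 0)
    simp only [sum_coord, sum_coord_sq] at this
    refine ⟨this.1, this.2.le.trans (Real.exp_le_exp.2 (by linarith))⟩
  have h2 : ∀ j : Fin d, Integrable (fun p : State d N × State d N =>
      Real.exp (-(∑ i, f i * p.1 (i, j) + ∑ i, g i * p.2 (i, j)))) (pairLaw (Fin N × Fin d)) ∧
      ∫ p : State d N × State d N,
        Real.exp (-(∑ i, f i * p.1 (i, j) + ∑ i, g i * p.2 (i, j))) ∂(pairLaw (Fin N × Fin d)) ≤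
        Real.exp (B / 2) := by
    intro j
    have := h1 (fun i => -f i) (fun i => -g i) j (by simpa using hB)
    simpa [neg_mul, Finset.sum_neg_distrib, neg_add, add_comm] using this
  have h3 : ∀ j ∈ (Finset.univ : Finset (Fin d)), Integrable (fun p : State d N × State d N =>
      Real.exp (∑ i, f i * p.1 (i, j) + ∑ i, g i * p.2 (i, j)) +
      Real.exp (-(∑ i, f i * p.1 (i, j) + ∑ i, g i * p.2 (i, j)))) (pairLaw (Fin N × Fin d)) :=
    fun j _ => (h1 f g j hB).1.add (h2 j).1
  unfold expSum linearPath
  refine ⟨integrable_finsetSum _ h3, ?_⟩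
  simp only
  rw [integral_finsetSum _ h3]
  refine (Finset.sum_le_card_nsmul _ _ (2 * Real.exp (B / 2)) fun j _ => ?_).trans
    (le_of_eq (by simp; ring))
  rw [integral_add (h1 f g j hB).1 (h2 j).1]
  linarith [(h1 f g j hB).2, (h2 j).2]

lemma eigenvector_sq_le (hT : 0 < T) (i t : Fin N) : eigenvector T N i t ^ 2 ≤ 2 / T := by
  rw [eigenvector, mul_pow, Real.sq_sqrt (by positivity)]
  exact mul_le_of_le_one_right (by positivity) (Real.sin_sq_le_one _)

/-- Jordan's inequality sin x ≥ 2x/π on [0, π/2] compares the discrete eigenvalue with the summable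
sequence 1/i², uniformly in N. -/
lemma eigenvalue_le (hT : 0 < T) (hβ : 0 < β) (i : Fin N) :
    eigenvalue T β N i ≤ T ^ 2 / (2 * β) * (1 / (((i : ℕ) : ℝ) + 1) ^ 2) := by
  have hi : ((i : ℕ) : ℝ) + 1 ≤ N := by exact_mod_cast i.2
  have hN : (0 : ℝ) < (N : ℝ) + 1 := by positivity
  have hi0 : (0 : ℝ) < ((i : ℕ) : ℝ) + 1 := by positivity
  have h := Real.mul_le_sin (x := ((i : ℕ) + 1 : ℝ) * Real.pi / (2 * (N + 1)))
    (by have := Real.pi_pos; positivity)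
    (by rw [div_le_div_iff₀ (by positivity) (by positivity)]; nlinarith [Real.pi_pos])
  have h2 : 2 / Real.pi * (((i : ℕ) + 1 : ℝ) * Real.pi / (2 * (N + 1))) * (N + 1) =
      ((i : ℕ) : ℝ) + 1 := by
    have := Real.pi_pos.ne'
    field_simp
  have h3 := mul_le_mul_of_nonneg_right h hN.le
  rw [h2] at h3
  rw [eigenvalue, one_div]
  gcongr

/-- A bound for the variance of the bridge. -/
def varianceBound (T β : ℝ) : ℝ := T / β * ∑' n : ℕ, 1 / ((n : ℝ) + 1) ^ 2

/-- The left side is the variance at time t of one component of the reference path. -/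
lemma sum_path_sq_le (hT : 0 < T) (hβ : 0 < β) (t : Fin N) :
    ∑ i, (stdDev T β N i * eigenvector T N i t) ^ 2 ≤ varianceBound T β := by
  have hs : Summable fun n : ℕ => 1 / ((n : ℝ) + 1) ^ 2 := by
    have := (summable_nat_add_iff 1).2 (Real.summable_one_div_nat_pow.2 one_lt_two)
    simpa using this
  have h1 : ∑ i : Fin N, 1 / (((i : ℕ) : ℝ) + 1) ^ 2 ≤ ∑' n : ℕ, 1 / ((n : ℝ) + 1) ^ 2 := by
    rw [Fin.sum_univ_eq_sum_range (fun n : ℕ => 1 / ((n : ℝ) + 1) ^ 2)]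
    exact hs.sum_le_tsum _ fun _ _ => by positivity
  refine le_trans ?_ (mul_le_mul_of_nonneg_left h1 (by positivity : 0 ≤ T / β))
  rw [Finset.mul_sum]
  refine Finset.sum_le_sum fun i _ => ?_
  rw [mul_pow, stdDev_sq hT hβ]
  refine (mul_le_mul (eigenvalue_le hT hβ i) (eigenvector_sq_le hT i t) (sq_nonneg _)
    (by positivity)).trans (le_of_eq ?_)
  field_simp

lemma path_rescale (t : Fin N) (p : State d N × State d N) :
    path T (rescale T β p.1) t =
      linearPath (fun i => stdDev T β N i * eigenvector T N i t) (fun _ => 0) p := by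
  unfold path linearPath rescale
  congr 1
  ext j
  simp only [zero_mul, Finset.sum_const_zero, add_zero]
  exact Finset.sum_congr rfl fun i _ => by ring

variable {G : EuclideanSpace ℝ (Fin d) → ℝ}

/-- The partition function is bounded below uniformly in the dimension. -/
lemma exists_le_partitionFunction (hT : 0 < T) (hβ : 0 < β) (hG : GrowthCondition G) :
    ∃ c : ℝ, 0 < c ∧ ∀ N : ℕ, c ≤ partitionFunction N T β G := by
  obtain ⟨K, hK, h⟩ := hG.exists_abs_le
  set A : ℝ := K * (1 + 2 * d * Real.exp (varianceBound T β / 2)) with hA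
  have hA0 : 0 ≤ A := by positivity
  refine ⟨Real.exp (-(T * A)), Real.exp_pos _, fun N => ?_⟩
  set X : Fin N → State d N × State d N → EuclideanSpace ℝ (Fin d) := fun t =>
    linearPath (fun i => stdDev T β N i * eigenvector T N i t) (fun _ => 0) with hX
  have hX1 : ∀ t, _ := fun t => expSum_linearPath (d := d)
    (fun i => stdDev T β N i * eigenvector T N i t) (fun _ => 0) (B := varianceBound T β)
    (by simpa using sum_path_sq_le hT hβ t)
  have hGi : ∀ t, Integrable (fun p => G (X t p)) (pairLaw (Fin N × Fin d)) := by
    intro t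
    have hY : Integrable (fun p => K * (1 + expSum (X t p))) (pairLaw (Fin N × Fin d)) :=
      ((integrable_const 1).add (hX1 t).1).const_mul K
    refine hY.mono' ?_ (ae_of_all _ fun p => h _)
    refine (hG.continuous.measurable.comp ?_).aestronglyMeasurable
    have hc : Continuous fun p : State d N × State d N => path T (rescale T β p.1) t := by
      unfold path rescale
      fun_prop
    simp only [path_rescale] at hc
    exact hc.measurable
  have hGb : ∀ t, ∫ p, G (X t p) ∂(pairLaw (Fin N × Fin d)) ≤ A := by
    intro t
    have hY : Integrable (fun p => K * (1 + expSum (X t p))) (pairLaw (Fin N × Fin d)) :=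
      ((integrable_const 1).add (hX1 t).1).const_mul K
    refine (integral_mono (hGi t) hY fun p => (le_abs_self _).trans (h _)).trans ?_
    rw [integral_const_mul, integral_add (integrable_const 1) (hX1 t).1]
    refine mul_le_mul_of_nonneg_left ?_ hK
    simpa using (hX1 t).2
  set Ψ : State d N × State d N → ℝ := fun p => potential T G (rescale T β p.1) with hΨ
  have hΨe : Ψ = fun p => ∑ t, G (X t p) * mesh T N := by
    ext p
    simp only [hΨ, potential]
    exact Finset.sum_congr rfl fun t _ => by rw [path_rescale]
  have hΨi : Integrable Ψ (pairLaw (Fin N × Fin d)) := by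
    rw [hΨe]
    exact integrable_finsetSum _ fun t _ => (hGi t).mul_const _
  have hΨb : ∫ p, Ψ p ∂(pairLaw (Fin N × Fin d)) ≤ T * A := by
    rw [hΨe, integral_finsetSum _ fun t _ => (hGi t).mul_const _]
    have h1 : ∀ t ∈ (Finset.univ : Finset (Fin N)),
        ∫ p, G (X t p) * mesh T N ∂(pairLaw (Fin N × Fin d)) ≤ mesh T N * A := by
      intro t _
      rw [integral_mul_const, mul_comm]
      exact mul_le_mul_of_nonneg_left (hGb t) (mesh_nonneg hT)
    refine (Finset.sum_le_sum h1).trans ?_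
    rw [← Finset.sum_mul]
    exact mul_le_mul_of_nonneg_right (sum_mesh_le hT) hA0
  have hm := measurable_potential (N := N) (T := T) hG
  have hZ : partitionFunction N T β G = ∫ p, Real.exp (-Ψ p) ∂(pairLaw (Fin N × Fin d)) := by
    rw [partitionFunction, ← map_rescale hT hβ, integral_map (by fun_prop) (by fun_prop)]
    exact (integral_pairLaw_fst fun ξ => Real.exp (-potential T G (rescale T β ξ))).symm
  have hei : Integrable (fun p => Real.exp (-Ψ p)) (pairLaw (Fin N × Fin d)) := by
    have h1 : Integrable (fun ξ => Real.exp (-potential T G (rescale T β ξ)))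
        (stdNormal (Fin N × Fin d)) := by
      have := integrable_exp_neg_potential (T := T) hT hG (reference d N T β)
      rw [← map_rescale hT hβ, integrable_map_measure (by fun_prop) (by fun_prop)] at this
      exact this
    exact h1.comp_fst _
  set m : ℝ := ∫ p, Ψ p ∂(pairLaw (Fin N × Fin d)) with hm'
  -- Jensen's inequality: the integrand is the tangent line of e^{-x} at the mean m of the
  -- potential, and it integrates to e^{-m}.
  have hle : ∫ p, Real.exp (-m) * (1 + m - Ψ p) ∂(pairLaw (Fin N × Fin d)) ≤
      ∫ p, Real.exp (-Ψ p) ∂(pairLaw (Fin N × Fin d)) := by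
    refine integral_mono (((integrable_const (1 + m)).sub hΨi).const_mul _) hei fun p => ?_
    have h1 := Real.add_one_le_exp (m - Ψ p)
    have h2 : Real.exp (-Ψ p) = Real.exp (-m) * Real.exp (m - Ψ p) := by
      rw [← Real.exp_add]; ring_nf
    simp only
    rw [h2]
    exact mul_le_mul_of_nonneg_left (by linarith) (Real.exp_pos _).le
  rw [integral_const_mul, integral_sub (integrable_const _) hΨi, ← hm', ← hZ] at hle
  simp only [integral_const, probReal_univ, smul_eq_mul, one_mul, add_sub_cancel_right,
    mul_one] at hle
  exact (Real.exp_le_exp.2 (by linarith)).trans hle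

/-- The density of the target is bounded uniformly in the dimension, also after multiplication by
the Metropolis factor. -/
lemma exists_weight_le (hT : 0 < T) (hβ : 0 < β) (hG : GrowthCondition G) :
    ∃ M : ℝ, 0 < M ∧ ∀ N : ℕ, (∀ ξ : State d N, weight T β G ξ ≤ M) ∧
      ∀ (alg : Algorithm) (σ : ℝ) (ξ z : State d N),
        weight T β G ξ * acc (logRatio T β alg σ ξ z + potentialDrop T β G alg σ ξ z) ≤
          M * acc (logRatio T β alg σ ξ z) := by
  obtain ⟨c, hc, h⟩ := exists_le_partitionFunction hT hβ hG
  obtain ⟨m, hm⟩ := hG.1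
  refine ⟨Real.exp (|m| * T) / c, by positivity, fun N => ?_⟩
  have hb : ∀ x : State d N, Real.exp (-potential T G x) ≤ Real.exp (|m| * T) := fun x =>
    Real.exp_le_exp.2 (by linarith [neg_le_potential hT hm x])
  have hZ := (partitionFunction_pos (N := N) (β := β) hT hG)
  refine ⟨fun ξ => div_le_div₀ (Real.exp_pos _).le (hb _) hc (h N), fun alg σ ξ z => ?_⟩
  set R := logRatio T β alg σ ξ z
  have h1 : weight T β G ξ * acc (R + potentialDrop T β G alg σ ξ z) =
      Real.exp (-potential T G (rescale T β ξ)) * acc (R + potentialDrop T β G alg σ ξ z) /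
        partitionFunction N T β G := by
    rw [weight]; ring
  rw [h1, div_mul_eq_mul_div]
  refine div_le_div₀ (mul_nonneg (Real.exp_pos _).le (acc_nonneg _)) ?_ hc (h N)
  have hE := Real.exp_pos (|m| * T)
  -- Moving the weight inside the minimum cancels the potential at x in the second argument; only
  -- the potential at y is left, and it is bounded below. No smallness of the potential drop is
  -- used.
  rw [acc, acc, mul_min_of_nonneg _ _ (Real.exp_pos _).le, mul_min_of_nonneg _ _ hE.le]
  refine min_le_min (by simpa using hb _) ?_
  rw [← Real.exp_add, potentialDrop, ← Real.exp_add]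
  refine Real.exp_le_exp.2 ?_
  linarith [neg_le_potential hT hm
    (fun k => rescale T β ξ k + σ * increment T β alg σ ξ z k)]

/-- The potential changes little in one step. -/
lemma exists_potentialDrop_le (hT : 0 < T) (hβ : 0 < β) (hG : GrowthCondition G) :
    ∃ K : ℝ, 0 ≤ K ∧ ∀ (N : ℕ) (alg : Algorithm) (σ : ℝ), 0 ≤ σ → σ * Real.sqrt N ≤ 1 →
      (∀ i : Fin N, |alg.drift (σ / stdDev T β N i)| ≤ 1) →
      ∃ Y : State d N × State d N → ℝ, Integrable Y (pairLaw (Fin N × Fin d)) ∧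
        (∀ p, |potentialDrop T β G alg σ p.1 p.2| ≤ Y p) ∧
        ∫ p, Y p ∂(pairLaw (Fin N × Fin d)) ≤ K * (σ * Real.sqrt N) := by
  obtain ⟨K, hK, h⟩ := hG.exists_abs_sub_le
  set A : ℝ := 1 + 2 * d * Real.exp (varianceBound T β / 2) + 2 * d * Real.exp (4 / T / 2) with hA
  have hA0 : 0 ≤ A := by positivity
  refine ⟨T * (K * A), by positivity, fun N alg σ hσ hσ1 hdrift => ?_⟩
  set ε : ℝ := σ * Real.sqrt N with hε
  have hε0 : 0 ≤ ε := by positivity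
  set X : Fin N → State d N × State d N → EuclideanSpace ℝ (Fin d) := fun t =>
    linearPath (fun i => stdDev T β N i * eigenvector T N i t) (fun _ => 0) with hX
  -- The increment of the path divided by ε = σ√N. The factor 1/√N normalizes it: its variance is a
  -- sum of N terms of size at most (2/T + 2/T)/N, from noise and drift, whence B = 4/T.
  set D : Fin N → State d N × State d N → EuclideanSpace ℝ (Fin d) := fun t =>
    linearPath (fun i => alg.drift (σ / stdDev T β N i) * (eigenvector T N i t / Real.sqrt N))
      (fun i => eigenvector T N i t / Real.sqrt N) with hD
  have hX1 : ∀ t, _ := fun t => expSum_linearPath (d := d)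
    (fun i => stdDev T β N i * eigenvector T N i t) (fun _ => 0) (B := varianceBound T β)
    (by simpa using sum_path_sq_le hT hβ t)
  have hD1 : ∀ t, _ := fun t => expSum_linearPath (d := d)
    (fun i => alg.drift (σ / stdDev T β N i) * (eigenvector T N i t / Real.sqrt N))
    (fun i => eigenvector T N i t / Real.sqrt N) (B := 4 / T) (by
      have hN : (0 : ℝ) < N := by exact_mod_cast t.pos
      rw [← Finset.sum_add_distrib]
      refine (Finset.sum_le_card_nsmul _ _ (4 / T / N) fun i _ => ?_).trans
        (le_of_eq ?_)
      · have e1 := (sq_le_one_iff_abs_le_one _).2 (hdrift i)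
        have e2 : (eigenvector T N i t / Real.sqrt N) ^ 2 ≤ 2 / T / N := by
          rw [div_pow, Real.sq_sqrt hN.le]
          exact div_le_div_of_nonneg_right (eigenvector_sq_le hT i t) hN.le
        have e3 : 4 / T / N = 2 / T / N + 2 / T / N := by ring
        rw [mul_pow, e3]
        exact add_le_add ((mul_le_of_le_one_left (sq_nonneg _) e1).trans e2) e2
      · rw [Finset.card_univ, Fintype.card_fin, nsmul_eq_mul]
        field_simp)
  have hstep : ∀ t p, path T (fun k => rescale T β p.1 k + σ * increment T β alg σ p.1 p.2 k) t =
      X t p + ε • D t p := by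
    intro t p
    have hN : (0 : ℝ) < N := by exact_mod_cast t.pos
    have hN' := (Real.sqrt_pos.2 hN).ne'
    ext j
    simp only [path, hX, hD, linearPath, rescale, increment, PiLp.add_apply, PiLp.smul_apply,
      smul_eq_mul, zero_mul, Finset.sum_const_zero, add_zero]
    rw [← Finset.sum_add_distrib, Finset.mul_sum, ← Finset.sum_add_distrib]
    refine Finset.sum_congr rfl fun i _ => ?_
    rw [hε]
    field_simp
    ring
  have hXD : ∀ t, Integrable (fun p => 1 + expSum (X t p)) (pairLaw (Fin N × Fin d)) := fun t =>
    (integrable_const 1).add (hX1 t).1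
  have hYi : ∀ t, Integrable (fun p => mesh T N * (ε * (K * (1 + expSum (X t p) +
      expSum (D t p))))) (pairLaw (Fin N × Fin d)) := fun t =>
    ((((hXD t).add (hD1 t).1).const_mul K).const_mul ε).const_mul _
  refine ⟨fun p => ∑ t, mesh T N * (ε * (K * (1 + expSum (X t p) + expSum (D t p)))), ?_, ?_, ?_⟩
  · exact integrable_finsetSum _ fun t _ => hYi t
  · intro p
    rw [potentialDrop, potential, potential, ← Finset.sum_sub_distrib]
    refine (Finset.abs_sum_le_sum_abs _ _).trans (Finset.sum_le_sum fun t _ => ?_)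
    rw [← sub_mul, abs_mul, abs_of_nonneg (mesh_nonneg hT), mul_comm]
    refine mul_le_mul_of_nonneg_left ?_ (mesh_nonneg hT)
    rw [hstep, path_rescale]
    exact h ε _ _ hε0 hσ1
  · beta_reduce
    rw [integral_finsetSum _ fun t _ => hYi t]
    have h1 : ∀ t ∈ (Finset.univ : Finset (Fin N)),
        ∫ p, mesh T N * (ε * (K * (1 + expSum (X t p) + expSum (D t p))))
          ∂(pairLaw (Fin N × Fin d)) ≤ mesh T N * (K * A * ε) := by
      intro t _
      rw [integral_const_mul, integral_const_mul, integral_const_mul,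
        integral_add (hXD t) (hD1 t).1, integral_add (integrable_const 1) (hX1 t).1]
      refine mul_le_mul_of_nonneg_left ?_ (mesh_nonneg hT)
      rw [mul_comm (K * A) ε]
      refine mul_le_mul_of_nonneg_left (mul_le_mul_of_nonneg_left ?_ hK) hε0
      simp only [integral_const, probReal_univ, smul_eq_mul, one_mul]
      exact add_le_add (add_le_add le_rfl (hX1 t).2) (hD1 t).2
    refine (Finset.sum_le_sum h1).trans ?_
    rw [← Finset.sum_mul, mul_assoc T]
    exact mul_le_mul_of_nonneg_right (sum_mesh_le hT) (by positivity)

end Moments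

/-! ### Trigonometric sums -/

section Trig

/-- Reversing the order of the frequencies reflects the angle about π/4, which exchanges sine and
cosine. A power sum of sines is therefore half the corresponding sum of sines and cosines. -/
lemma sum_sin_sq_half_eq_cos (N : ℕ) (f : ℝ → ℝ) :
    ∑ i : Fin N, f (Real.sin (((i : ℕ) + 1 : ℝ) * Real.pi / (2 * (N + 1)))) =
      ∑ i : Fin N, f (Real.cos (((i : ℕ) + 1 : ℝ) * Real.pi / (2 * (N + 1)))) := by
  rw [← Equiv.sum_comp Fin.revPerm]
  refine Finset.sum_congr rfl fun i _ => ?_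
  rw [← Real.sin_pi_div_two_sub]
  congr 2
  have h : (((Fin.rev i : Fin N) : ℕ) : ℝ) = N - ((i : ℕ) + 1) := by
    rw [Fin.val_rev, Nat.cast_sub i.2]
    push_cast
    ring
  rw [Fin.revPerm_apply, h]
  field_simp
  ring

lemma sum_sin_sq_half (N : ℕ) :
    ∑ i : Fin N, Real.sin (((i : ℕ) + 1 : ℝ) * Real.pi / (2 * (N + 1))) ^ 2 = N / 2 := by
  have h := sum_sin_sq_half_eq_cos N fun x => x ^ 2
  have h2 : ∑ i : Fin N, Real.sin (((i : ℕ) + 1 : ℝ) * Real.pi / (2 * (N + 1))) ^ 2 +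
      ∑ i : Fin N, Real.cos (((i : ℕ) + 1 : ℝ) * Real.pi / (2 * (N + 1))) ^ 2 = N := by
    rw [← Finset.sum_add_distrib]
    simp
  linarith

/-- Each product 2 sin a cos(2(i+1)a) is a difference of sines at consecutive odd multiples of a. -/
lemma sum_cos_telescope (a : ℝ) (N : ℕ) :
    2 * Real.sin a * ∑ i ∈ Finset.range N, Real.cos (2 * ((i : ℝ) + 1) * a) =
      Real.sin ((2 * N + 1) * a) - Real.sin a := by
  induction N with
  | zero => simp
  | succ n ih =>
    rw [Finset.sum_range_succ, mul_add, ih]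
    have h1 : Real.sin ((2 * ((n + 1 : ℕ) : ℝ) + 1) * a) =
        Real.sin (2 * ((n : ℝ) + 1) * a + a) := by
      congr 1; push_cast; ring
    have h2 : Real.sin ((2 * (n : ℝ) + 1) * a) = Real.sin (2 * ((n : ℝ) + 1) * a - a) := by
      congr 1; ring
    rw [h1, h2, Real.sin_add, Real.sin_sub]
    ring

lemma sum_sin_sq_double (N : ℕ) (hN : 1 ≤ N) :
    ∑ i : Fin N, Real.sin (2 * (((i : ℕ) + 1 : ℝ) * Real.pi / (2 * (N + 1)))) ^ 2 =
      (N + 1) / 2 := by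
  set a : ℝ := Real.pi / (N + 1) with ha
  have hN' : (1 : ℝ) ≤ N := by exact_mod_cast hN
  have hsin : 0 < Real.sin a := by
    apply Real.sin_pos_of_pos_of_lt_pi
    · have := Real.pi_pos
      positivity
    · rw [ha, div_lt_iff₀ (by positivity)]
      nlinarith [Real.pi_pos]
  have hcos : ∑ i ∈ Finset.range N, Real.cos (2 * ((i : ℝ) + 1) * a) = -1 := by
    have h := sum_cos_telescope a N
    have h1 : (2 * (N : ℝ) + 1) * a = 2 * Real.pi - a := by
      rw [ha]; field_simp; ring
    rw [h1, Real.sin_two_pi_sub] at h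
    have h2 : 2 * Real.sin a ≠ 0 := by positivity
    apply mul_left_cancel₀ h2
    rw [h]
    ring
  have h3 : ∀ i : Fin N, Real.sin (2 * (((i : ℕ) + 1 : ℝ) * Real.pi / (2 * (N + 1)))) ^ 2 =
      1 / 2 - Real.cos (2 * (((i : ℕ) : ℝ) + 1) * a) / 2 := by
    intro i
    have e1 : 2 * (((i : ℕ) + 1 : ℝ) * Real.pi / (2 * (N + 1))) = (((i : ℕ) : ℝ) + 1) * a := by
      rw [ha]; field_simp
    rw [e1, mul_assoc 2, Real.cos_two_mul, Real.sin_sq]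
    ring
  simp_rw [h3]
  rw [Finset.sum_sub_distrib,
    ← Finset.sum_div Finset.univ (fun i : Fin N => Real.cos (2 * (((i : ℕ) : ℝ) + 1) * a)),
    Fin.sum_univ_eq_sum_range (fun n : ℕ => Real.cos (2 * ((n : ℝ) + 1) * a)), hcos]
  simp
  ring

/-- From sin⁶x + cos⁶x = 1 - (3/4) sin²(2x), the reflection symmetry and the sum of sin² at the
doubled angles. The 5 in `tau` for SLA comes from here. -/
lemma sum_sin_pow_six_half (N : ℕ) (hN : 1 ≤ N) :
    ∑ i : Fin N, Real.sin (((i : ℕ) + 1 : ℝ) * Real.pi / (2 * (N + 1))) ^ 6 =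
      (5 * N - 3) / 16 := by
  have h := sum_sin_sq_half_eq_cos N fun x => x ^ 6
  have h2 : ∑ i : Fin N, Real.sin (((i : ℕ) + 1 : ℝ) * Real.pi / (2 * (N + 1))) ^ 6 +
      ∑ i : Fin N, Real.cos (((i : ℕ) + 1 : ℝ) * Real.pi / (2 * (N + 1))) ^ 6 =
      N - 3 / 4 * ((N + 1) / 2) := by
    rw [← sum_sin_sq_double N hN, ← Finset.sum_add_distrib, Finset.mul_sum]
    have hcard : (N : ℝ) = ∑ _i : Fin N, (1 : ℝ) := by simp
    nth_rewrite 3 [hcard]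
    rw [← Finset.sum_sub_distrib]
    refine Finset.sum_congr rfl fun i _ => ?_
    rw [Real.sin_two_mul]
    have := Real.sin_sq_add_cos_sq (((i : ℕ) + 1 : ℝ) * Real.pi / (2 * (N + 1)))
    set x := Real.sin (((i : ℕ) + 1 : ℝ) * Real.pi / (2 * (N + 1)))
    set y := Real.cos (((i : ℕ) + 1 : ℝ) * Real.pi / (2 * (N + 1)))
    have e1 : y ^ 2 = 1 - x ^ 2 := by linarith
    have e2 : y ^ 6 = (1 - x ^ 2) ^ 3 := by rw [← e1]; ring
    have e3 : (2 * x * y) ^ 2 = 4 * x ^ 2 * (1 - x ^ 2) := by rw [← e1]; ring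
    rw [e2, e3]
    ring
  linarith

end Trig

/-! ### The coefficients of the log-ratio -/

/-- The mean of the log-ratio is exactly minus half the nominal variance, so the centring in the
limit theorem has no error term beyond |V - v|/2. -/
lemma Algorithm.coefB_add_coefC (alg : Algorithm) (s : ℝ) :
    alg.coefB s + alg.coefC s = -(alg.rate s / 2) := by
  cases alg <;> simp only [Algorithm.coefB, Algorithm.coefC, Algorithm.rate] <;> ring

/-- This is the determinant that governs the mean of e^{R/2} in `integral_acc_quadForm_le`; its
excess over 1 gives the decay in the subcritical regime. -/
lemma Algorithm.coef_det (alg : Algorithm) (s : ℝ) :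
    (1 - alg.coefB s) * (1 - alg.coefC s) - alg.coefA s ^ 2 / 4 = 1 + alg.rate s / 4 := by
  cases alg <;>
    simp only [Algorithm.coefA, Algorithm.coefB, Algorithm.coefC, Algorithm.rate] <;> ring

lemma Algorithm.rate_nonneg (alg : Algorithm) (s : ℝ) : 0 ≤ alg.rate s := by
  cases alg <;> simp only [Algorithm.rate] <;> positivity

section Coef

variable {s u : ℝ}

lemma Algorithm.rate_le (alg : Algorithm) (hs : s ^ 2 ≤ u) (hu : u ≤ 1) : alg.rate s ≤ u := by
  cases alg with
  | RWM => exact hs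
  | SLA =>
    have h0 := sq_nonneg s
    have h : (s ^ 2) ^ 3 ≤ s ^ 2 := pow_le_of_le_one h0 (hs.trans hu) (by norm_num)
    simp only [Algorithm.rate]
    nlinarith

/-- Like the next bounds for `coefC` and `coefA`, this extracts a small factor u while keeping one
factor `rate`: after summation every error is at most u times the total rate, whatever the
algorithm. -/
lemma Algorithm.coefB_sq_le (alg : Algorithm) (hs : s ^ 2 ≤ u) (hu : u ≤ 1) :
    alg.coefB s ^ 2 ≤ u * alg.rate s := by
  have h0 := sq_nonneg s
  cases alg with
  | RWM =>
    simp only [Algorithm.coefB, Algorithm.rate]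
    nlinarith
  | SLA =>
    have e : Algorithm.SLA.coefB s ^ 2 = s ^ 2 * ((1 - s ^ 2 / 4) ^ 2 / 4) * (s ^ 6 / 16) := by
      simp only [Algorithm.coefB]; ring
    rw [e, Algorithm.rate]
    refine mul_le_mul_of_nonneg_right ?_ (by positivity)
    refine (mul_le_of_le_one_right h0 ?_).trans hs
    nlinarith

lemma Algorithm.coefC_sq_le (alg : Algorithm) (hs : s ^ 2 ≤ u) :
    alg.coefC s ^ 2 ≤ u * alg.rate s := by
  have h0 := sq_nonneg s
  cases alg with
  | RWM =>
    simp only [Algorithm.coefC, Algorithm.rate]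
    nlinarith
  | SLA =>
    have e : Algorithm.SLA.coefC s ^ 2 = s ^ 2 * (1 / 4) * (s ^ 6 / 16) := by
      simp only [Algorithm.coefC]; ring
    rw [e, Algorithm.rate]
    refine mul_le_mul_of_nonneg_right ?_ (by positivity)
    linarith

lemma Algorithm.abs_coefA_sq_sub_le (alg : Algorithm) (hs : s ^ 2 ≤ u) (hu : u ≤ 1) :
    |alg.coefA s ^ 2 - alg.rate s| ≤ u * alg.rate s := by
  have h0 := sq_nonneg s
  cases alg with
  | RWM =>
    simp only [Algorithm.coefA, Algorithm.rate]
    rw [neg_sq, sub_self, abs_zero]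
    exact mul_nonneg (h0.trans hs) h0
  | SLA =>
    have e : Algorithm.SLA.coefA s ^ 2 - Algorithm.SLA.rate s =
        -(s ^ 2 * (1 - s ^ 2 / 4)) * (s ^ 6 / 16) := by
      simp only [Algorithm.coefA, Algorithm.rate]; ring
    have h6 : 0 ≤ s ^ 6 / 16 := by positivity
    rw [e, abs_mul, abs_neg, abs_of_nonneg h6, Algorithm.rate]
    refine mul_le_mul_of_nonneg_right ?_ h6
    rw [abs_of_nonneg (mul_nonneg h0 (by linarith))]
    nlinarith

lemma Algorithm.coefA_sq_le (alg : Algorithm) (hs : s ^ 2 ≤ u) (hu : u ≤ 1) :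
    alg.coefA s ^ 2 ≤ alg.rate s := by
  have h0 := sq_nonneg s
  cases alg with
  | RWM => simp [Algorithm.coefA, Algorithm.rate]
  | SLA =>
    have e : Algorithm.SLA.coefA s ^ 2 = (1 - s ^ 2 / 2) ^ 2 * (s ^ 6 / 16) := by
      simp only [Algorithm.coefA]; ring
    rw [e, Algorithm.rate]
    refine mul_le_of_le_one_left (by positivity) ?_
    nlinarith

lemma Algorithm.coefA_pow_four_le (alg : Algorithm) (hs : s ^ 2 ≤ u) (hu : u ≤ 1) :
    (alg.coefA s ^ 2) ^ 2 ≤ u * alg.rate s := by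
  rw [sq (alg.coefA s ^ 2)]
  exact mul_le_mul ((alg.coefA_sq_le hs hu).trans (alg.rate_le hs hu)) (alg.coefA_sq_le hs hu)
    (sq_nonneg _) ((sq_nonneg s).trans hs)

lemma Algorithm.abs_coef_sum_le (alg : Algorithm) (hs : s ^ 2 ≤ u) (hu : u ≤ 1) :
    |alg.coefA s| + |alg.coefB s| + |alg.coefC s| ≤ 3 * Real.sqrt u := by
  have hu0 : 0 ≤ u := (sq_nonneg s).trans hs
  have hr := alg.rate_le hs hu
  have hur : u * alg.rate s ≤ u := mul_le_of_le_one_right hu0 (hr.trans hu)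
  have h1 := Real.abs_le_sqrt ((alg.coefA_sq_le hs hu).trans hr)
  have h2 := Real.abs_le_sqrt ((alg.coefB_sq_le hs hu).trans hur)
  have h3 := Real.abs_le_sqrt ((alg.coefC_sq_le hs).trans hur)
  linarith

lemma Algorithm.abs_drift_le (alg : Algorithm) (hs : s ^ 2 ≤ u) :
    |alg.drift s| ≤ Real.sqrt u := by
  have h0 := sq_nonneg s
  apply Real.abs_le_sqrt
  cases alg <;> simp only [Algorithm.drift] <;> nlinarith

lemma Algorithm.coefB_lt_one (alg : Algorithm) (hs : s ^ 2 ≤ u) (hu : u ≤ 1) :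
    alg.coefB s < 1 := by
  have h0 := sq_nonneg s
  cases alg with
  | RWM => simp [Algorithm.coefB]
  | SLA =>
    have e : Algorithm.SLA.coefB s = (s ^ 2) ^ 2 / 8 - (s ^ 2) ^ 3 / 32 := by
      simp only [Algorithm.coefB]; ring
    have h1 : (s ^ 2) ^ 2 ≤ 1 := pow_le_one₀ h0 (hs.trans hu)
    have h2 : 0 ≤ (s ^ 2) ^ 3 := by positivity
    rw [e]
    linarith

end Coef

/-! ### Asymptotics of the variance of the log-ratio -/

section Asymptotics

variable {d N : ℕ} {T β l ρ : ℝ}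

/-- The largest squared relative step-size, up to a trigonometric factor. -/
def relStep (d : ℕ) (T β l ρ : ℝ) (N : ℕ) : ℝ :=
  stepSize d N l ρ ^ 2 * (2 * β / T ^ 2) * ((N : ℝ) + 1) ^ 2

/-- The asymptotic variance of the log-ratio. -/
def totalRate (d : ℕ) (T β : ℝ) (alg : Algorithm) (l ρ : ℝ) (N : ℕ) : ℝ :=
  ∑ k : Fin N × Fin d, alg.rate (stepSize d N l ρ / stdDev T β N k.1)

/-- The limit of the variance of the log-ratio at the critical scaling. -/
def limitRate (d : ℕ) (T β : ℝ) : Algorithm → ℝ → ℝ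
  | .RWM, l => l ^ 2 * (β / (T ^ 2 * (d : ℝ) ^ 2))
  | .SLA, l => l ^ 6 * (1 / 16 * (5 * β ^ 3 / (2 * T ^ 6 * (d : ℝ) ^ 6)))

lemma limitRate_pos (hd : 1 ≤ d) (hT : 0 < T) (hβ : 0 < β) (hl : 0 < l) (alg : Algorithm) :
    0 < limitRate d T β alg l := by
  have : (0 : ℝ) < d := by exact_mod_cast hd
  cases alg <;> simp only [limitRate] <;> positivity

lemma stepSize_sq : stepSize d N l ρ ^ 2 = l ^ 2 * ((d * N : ℕ) : ℝ) ^ (-ρ) :=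
  Real.sq_sqrt (by positivity)

lemma stepSize_pos (hd : 1 ≤ d) (hN : 1 ≤ N) (hl : 0 < l) : 0 < stepSize d N l ρ := by
  have : (0 : ℝ) < ((d * N : ℕ) : ℝ) := by exact_mod_cast Nat.mul_pos hd hN
  exact Real.sqrt_pos.2 (by positivity)

lemma sq_step_eq (hT : 0 < T) (hβ : 0 < β) (i : Fin N) :
    (stepSize d N l ρ / stdDev T β N i) ^ 2 = relStep d T β l ρ N *
      Real.sin (((i : ℕ) + 1 : ℝ) * Real.pi / (2 * (N + 1))) ^ 2 := by
  rw [div_pow, stdDev_sq hT hβ, eigenvalue, relStep]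
  field_simp

lemma sq_step_le (hT : 0 < T) (hβ : 0 < β) (i : Fin N) :
    (stepSize d N l ρ / stdDev T β N i) ^ 2 ≤ relStep d T β l ρ N := by
  rw [sq_step_eq hT hβ]
  refine mul_le_of_le_one_right ?_ (Real.sin_sq_le_one _)
  unfold relStep
  positivity

lemma totalRate_RWM (hT : 0 < T) (hβ : 0 < β) (N : ℕ) :
    totalRate d T β .RWM l ρ N = d * relStep d T β l ρ N * (N / 2) := by
  simp only [totalRate, Algorithm.rate, sq_step_eq hT hβ]
  rw [Fintype.sum_prod_type]
  simp only [Finset.sum_const, Finset.card_univ, Fintype.card_fin, nsmul_eq_mul]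
  rw [← Finset.mul_sum, ← Finset.mul_sum, sum_sin_sq_half, mul_assoc]

lemma totalRate_SLA (hT : 0 < T) (hβ : 0 < β) (hN : 1 ≤ N) :
    totalRate d T β .SLA l ρ N = d * relStep d T β l ρ N ^ 3 * ((5 * N - 3) / 256) := by
  have h : ∀ i : Fin N, Algorithm.SLA.rate (stepSize d N l ρ / stdDev T β N i) =
      relStep d T β l ρ N ^ 3 / 16 *
        Real.sin (((i : ℕ) + 1 : ℝ) * Real.pi / (2 * (N + 1))) ^ 6 := by
    intro i
    have e : Algorithm.SLA.rate (stepSize d N l ρ / stdDev T β N i) =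
        ((stepSize d N l ρ / stdDev T β N i) ^ 2) ^ 3 / 16 := by
      simp only [Algorithm.rate]; ring
    rw [e, sq_step_eq hT hβ]
    ring
  simp only [totalRate, h]
  rw [Fintype.sum_prod_type]
  simp only [Finset.sum_const, Finset.card_univ, Fintype.card_fin, nsmul_eq_mul]
  rw [← Finset.mul_sum, ← Finset.mul_sum, sum_sin_pow_six_half N hN]
  ring

/-- The factor N + 1 is written N (1 + 1/N) with N = n/d, which isolates the pure power of n. -/
lemma relStep_eq (hd : 1 ≤ d) (hN : 1 ≤ N) :
    relStep d T β l ρ N = l ^ 2 * (2 * β / T ^ 2) / (d : ℝ) ^ 2 * (1 + 1 / (N : ℝ)) ^ 2 *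
      ((d * N : ℕ) : ℝ) ^ (2 - ρ) := by
  have hN' : (0 : ℝ) < N := by exact_mod_cast hN
  have hd' : (0 : ℝ) < d := by exact_mod_cast hd
  have hn : (0 : ℝ) < ((d * N : ℕ) : ℝ) := by exact_mod_cast Nat.mul_pos hd hN
  have h : ((d * N : ℕ) : ℝ) ^ (2 - ρ) = (d * N) ^ 2 * ((d * N : ℕ) : ℝ) ^ (-ρ) := by
    rw [sub_eq_add_neg, Real.rpow_add hn, Real.rpow_two]
    push_cast
    rfl
  rw [relStep, stepSize_sq, h]
  field_simp

lemma tendsto_dim (hd : 1 ≤ d) : Tendsto (fun N : ℕ => ((d * N : ℕ) : ℝ)) atTop atTop :=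
  tendsto_natCast_atTop_atTop.comp (tendsto_id.const_mul_atTop' hd)

lemma tendsto_one_add_inv : Tendsto (fun N : ℕ => 1 + 1 / (N : ℝ)) atTop (𝓝 1) := by
  simpa using tendsto_one_div_atTop_nhds_zero_nat.const_add (1 : ℝ)

lemma tendsto_relStep (hd : 1 ≤ d) (hρ : 2 < ρ) :
    Tendsto (relStep d T β l ρ) atTop (𝓝 0) := by
  have h1 : Tendsto (fun N : ℕ => ((d * N : ℕ) : ℝ) ^ (2 - ρ)) atTop (𝓝 0) := by
    have := (tendsto_rpow_neg_atTop (y := ρ - 2) (by linarith)).comp (tendsto_dim hd)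
    simpa [Function.comp_def] using this
  have h2 := ((tendsto_one_add_inv.pow 2).const_mul
    (l ^ 2 * (2 * β / T ^ 2) / (d : ℝ) ^ 2)).mul h1
  rw [mul_zero] at h2
  refine h2.congr' ?_
  filter_upwards [eventually_ge_atTop 1] with N hN
  rw [relStep_eq hd hN]

/-- The power with which the distance to the critical scaling enters the variance. -/
def Algorithm.multiplicity : Algorithm → ℝ
  | .RWM => 1
  | .SLA => 3

lemma Algorithm.multiplicity_pos (alg : Algorithm) : 0 < alg.multiplicity := by
  cases alg <;> simp [Algorithm.multiplicity]

/-- The rate is of degree m = `multiplicity` in s², and there are n coordinates, so the power of n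
is m(2 - ρ) + 1 = m(2 + I - ρ) because m I = 1. The sign of 2 + I - ρ then decides between the three
regimes. -/
lemma exists_totalRate_eq (hd : 1 ≤ d) (hT : 0 < T) (hβ : 0 < β) (alg : Algorithm) :
    ∃ q : ℕ → ℝ, Tendsto q atTop (𝓝 (limitRate d T β alg l)) ∧ ∀ N : ℕ, 1 ≤ N →
      totalRate d T β alg l ρ N =
        q N * ((d * N : ℕ) : ℝ) ^ (alg.multiplicity * (2 * 1 + alg.index - ρ)) := by
  have hd' : (0 : ℝ) < d := by exact_mod_cast hd
  cases alg with
  | RWM =>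
    refine ⟨fun N => l ^ 2 * (β / (T ^ 2 * (d : ℝ) ^ 2)) * (1 + 1 / (N : ℝ)) ^ 2, ?_, ?_⟩
    · simpa [limitRate] using (tendsto_one_add_inv.pow 2).const_mul
        (l ^ 2 * (β / (T ^ 2 * (d : ℝ) ^ 2)))
    · intro N hN
      have hn : (0 : ℝ) < ((d * N : ℕ) : ℝ) := by exact_mod_cast Nat.mul_pos hd hN
      have h : ((d * N : ℕ) : ℝ) ^ (Algorithm.RWM.multiplicity *
          (2 * 1 + Algorithm.RWM.index - ρ)) = ((d * N : ℕ) : ℝ) ^ (2 - ρ) * (d * N) := by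
        rw [show Algorithm.RWM.multiplicity * (2 * 1 + Algorithm.RWM.index - ρ) = (2 - ρ) + 1 by
          simp only [Algorithm.multiplicity, Algorithm.index]; ring, Real.rpow_add_one hn.ne']
        push_cast
        rfl
      rw [totalRate_RWM hT hβ, relStep_eq hd hN, h]
      field_simp
  | SLA =>
    refine ⟨fun N => l ^ 6 * (β ^ 3 / (T ^ 6 * (d : ℝ) ^ 6)) / 32 * (1 + 1 / (N : ℝ)) ^ 6 *
      (5 - 3 * (1 / (N : ℝ))), ?_, ?_⟩
    · have h1 := (tendsto_one_add_inv.pow 6).const_mul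
        (l ^ 6 * (β ^ 3 / (T ^ 6 * (d : ℝ) ^ 6)) / 32)
      have h2 : Tendsto (fun N : ℕ => 5 - 3 * (1 / (N : ℝ))) atTop (𝓝 (5 - 3 * 0)) :=
        (tendsto_one_div_atTop_nhds_zero_nat.const_mul 3).const_sub 5
      convert! h1.mul h2 using 2
      simp only [limitRate]
      field_simp
      ring
    · intro N hN
      have hN' : (0 : ℝ) < N := by exact_mod_cast hN
      have hn : (0 : ℝ) < ((d * N : ℕ) : ℝ) := by exact_mod_cast Nat.mul_pos hd hN
      have h : ((d * N : ℕ) : ℝ) ^ (Algorithm.SLA.multiplicity *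
          (2 * 1 + Algorithm.SLA.index - ρ)) =
          (((d * N : ℕ) : ℝ) ^ (2 - ρ)) ^ 3 * (d * N) := by
        rw [show Algorithm.SLA.multiplicity * (2 * 1 + Algorithm.SLA.index - ρ) =
          (2 - ρ) * (3 : ℕ) + 1 by
          simp only [Algorithm.multiplicity, Algorithm.index]; push_cast; ring,
          Real.rpow_add_one hn.ne', Real.rpow_mul_natCast hn.le]
        push_cast
        rfl
      rw [totalRate_SLA hT hβ hN, relStep_eq hd hN, h]
      field_simp
      ring

lemma tendsto_totalRate_of_eq (hd : 1 ≤ d) (hT : 0 < T) (hβ : 0 < β) (alg : Algorithm)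
    (hρ : ρ = 2 * 1 + alg.index) :
    Tendsto (totalRate d T β alg l ρ) atTop (𝓝 (limitRate d T β alg l)) := by
  obtain ⟨q, hq, h⟩ := exists_totalRate_eq (l := l) (ρ := ρ) hd hT hβ alg
  refine hq.congr' ?_
  filter_upwards [eventually_ge_atTop 1] with N hN
  rw [h N hN, hρ, sub_self, mul_zero, Real.rpow_zero, mul_one]

lemma tendsto_totalRate_of_lt (hd : 1 ≤ d) (hT : 0 < T) (hβ : 0 < β) (alg : Algorithm)
    (hρ : 2 * 1 + alg.index < ρ) :
    Tendsto (totalRate d T β alg l ρ) atTop (𝓝 0) := by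
  obtain ⟨q, hq, h⟩ := exists_totalRate_eq (l := l) (ρ := ρ) hd hT hβ alg
  have h1 := hq.mul ((tendsto_rpow_neg_atTop (y := alg.multiplicity * (ρ - (2 * 1 + alg.index)))
    (mul_pos alg.multiplicity_pos (by linarith))).comp (tendsto_dim hd))
  rw [mul_zero] at h1
  refine h1.congr' ?_
  filter_upwards [eventually_ge_atTop 1] with N hN
  rw [h N hN, Function.comp_apply]
  congr 2
  ring

/-- Below the critical scaling the variance grows polynomially, so that the corresponding
Gaussian bound decays faster than any power. -/
lemma tendsto_rpow_mul_exp_totalRate (hd : 1 ≤ d) (hT : 0 < T) (hβ : 0 < β) (hl : 0 < l)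
    (alg : Algorithm) (hρ : ρ < 2 * 1 + alg.index) (p : ℝ) :
    Tendsto (fun N : ℕ => ((d * N : ℕ) : ℝ) ^ p * Real.exp (-(totalRate d T β alg l ρ N / 16)))
      atTop (𝓝 0) := by
  obtain ⟨q, hq, h⟩ := exists_totalRate_eq (l := l) (ρ := ρ) hd hT hβ alg
  have hV := limitRate_pos hd hT hβ hl alg
  set V := limitRate d T β alg l
  set e := alg.multiplicity * (2 * 1 + alg.index - ρ) with he
  have he0 : 0 < e := mul_pos alg.multiplicity_pos (by linarith)
  -- To be used at x = n^e, so that x^{p/e} = n^p. The rate V/32 is the factor 1/16 times V/2, an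
  -- eventual lower bound for q.
  have hlim : Tendsto (fun x : ℝ => x ^ (p / e) * Real.exp (-(V / 32) * x)) atTop (𝓝 0) :=
    tendsto_rpow_mul_exp_neg_mul_atTop_nhds_zero _ _ (by positivity)
  have h1 := hlim.comp ((tendsto_rpow_atTop he0).comp (tendsto_dim hd))
  refine squeeze_zero' (Eventually.of_forall fun N => by positivity) ?_ h1
  filter_upwards [eventually_ge_atTop 1, hq.eventually (eventually_gt_nhds (half_lt_self hV))]
    with N hN hqN
  have hn : (0 : ℝ) < ((d * N : ℕ) : ℝ) := by exact_mod_cast Nat.mul_pos hd hN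
  have hne : 0 < ((d * N : ℕ) : ℝ) ^ e := Real.rpow_pos_of_pos hn _
  simp only [Function.comp_apply]
  rw [← Real.rpow_mul hn.le, mul_div_cancel₀ _ he0.ne', h N hN]
  refine mul_le_mul_of_nonneg_left (Real.exp_le_exp.2 ?_) (Real.rpow_pos_of_pos hn _).le
  nlinarith

/-- The size of the path increments tends to `0`. -/
lemma tendsto_stepSize_mul_sqrt (hd : 1 ≤ d) (hρ : 2 < ρ) :
    Tendsto (fun N : ℕ => stepSize d N l ρ * Real.sqrt N) atTop (𝓝 0) := by
  have hd' : (0 : ℝ) < d := by exact_mod_cast hd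
  have h1 : Tendsto (fun N : ℕ => l ^ 2 / d * ((d * N : ℕ) : ℝ) ^ (1 - ρ)) atTop (𝓝 0) := by
    have := ((tendsto_rpow_neg_atTop (y := ρ - 1) (by linarith)).comp
      (tendsto_dim hd)).const_mul (l ^ 2 / d)
    simpa [Function.comp_def] using this
  have h2 := (Real.continuous_sqrt.tendsto 0).comp h1
  rw [Real.sqrt_zero] at h2
  refine h2.congr' ?_
  filter_upwards [eventually_ge_atTop 1] with N hN
  have hn : (0 : ℝ) < ((d * N : ℕ) : ℝ) := by exact_mod_cast Nat.mul_pos hd hN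
  simp only [Function.comp_apply]
  rw [stepSize, ← Real.sqrt_mul (by positivity), sub_eq_add_neg, Real.rpow_add hn, Real.rpow_one]
  congr 1
  push_cast
  field_simp

end Asymptotics

/-! ### The constants of the limit -/

lemma negLogGaussian_eq (u : ℝ) :
    negLogGaussian u = u ^ 2 / 2 - Real.log (Real.sqrt (2 * Real.pi))⁻¹ := by
  have h : (Real.sqrt (2 * Real.pi))⁻¹ ≠ 0 :=
    inv_ne_zero (Real.sqrt_pos.2 (by have := Real.pi_pos; positivity)).ne'
  rw [negLogGaussian, gaussianPDFReal, NNReal.coe_one, mul_one, Real.log_mul h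
    (Real.exp_pos _).ne', Real.log_exp]
  ring

lemma deriv_negLogGaussian : deriv negLogGaussian = fun u => u := by
  ext u
  have h : negLogGaussian = fun u => u ^ 2 / 2 - Real.log (Real.sqrt (2 * Real.pi))⁻¹ :=
    funext negLogGaussian_eq
  rw [h]
  have := ((hasDerivAt_pow 2 u).div_const 2).sub_const (Real.log (Real.sqrt (2 * Real.pi))⁻¹)
  rw [this.deriv]
  simp

lemma K_RWM : Algorithm.RWM.K = 1 := by
  simp only [Algorithm.K, deriv_negLogGaussian, integral_sq_gaussian]

lemma K_SLA : Algorithm.SLA.K = 1 / 16 := by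
  have h2 : iteratedDeriv 2 negLogGaussian = fun _ => 1 := by
    rw [iteratedDeriv_succ, iteratedDeriv_one, deriv_negLogGaussian]
    ext u
    simp
  have h3 : iteratedDeriv 3 negLogGaussian = fun _ => 0 := by
    rw [iteratedDeriv_succ, h2]
    ext u
    simp
  simp only [Algorithm.K, h2, h3]
  simp
  norm_num

lemma limitAcceptance_eq {d : ℕ} {T β l : ℝ} (hl : 0 < l) (alg : Algorithm) :
    limitAcceptance d T β alg l =
      2 * cdf (gaussianReal 0 1) (-(Real.sqrt (limitRate d T β alg l) / 2)) := by
  cases alg with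
  | RWM =>
    simp only [limitAcceptance, limitRate, K_RWM, Algorithm.tau, one_mul]
    rw [Real.sqrt_mul (sq_nonneg l), Real.sqrt_sq hl.le]
    congr 2
    ring
  | SLA =>
    simp only [limitAcceptance, limitRate, K_SLA, Algorithm.tau]
    have h : l ^ 6 = (l ^ 3) ^ 2 := by ring
    rw [h, Real.sqrt_mul (sq_nonneg _), Real.sqrt_sq (by positivity)]
    congr 2
    ring

lemma two_mul_cdf_zero : 2 * cdf (gaussianReal 0 1) (-(Real.sqrt 0 / 2)) = 1 := by
  have h := integral_acc_gaussian (s := 0)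
  simpa [acc] using h.symm

/-! ### The expected acceptance probability -/

section Limits

variable {d : ℕ} {T β : ℝ} {G : EuclideanSpace ℝ (Fin d) → ℝ} {alg : Algorithm} {l ρ : ℝ}

lemma measurable_logRatio {N : ℕ} {σ : ℝ} :
    Measurable fun p : State d N × State d N => logRatio T β alg σ p.1 p.2 := by
  unfold logRatio
  fun_prop

lemma measurable_logRatio_add_potentialDrop {N : ℕ} {σ : ℝ} (hG : GrowthCondition G) :
    Measurable fun p : State d N × State d N =>
      logRatio T β alg σ p.1 p.2 + potentialDrop T β G alg σ p.1 p.2 :=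
  measurable_logRatio.add (measurable_potentialDrop hG)

/-- The error is displayed as a function of u and of the total rate v alone; it is continuous and
vanishes at (0, V), so its limit needs no further estimate. -/
lemma abs_weighted_acc_sub_le {N : ℕ} (hT : 0 < T) (hβ : 0 < β) (hG : GrowthCondition G)
    {M u V σ : ℝ} (hM : ∀ ξ : State d N, weight T β G ξ ≤ M) (hV : 0 ≤ V)
    (hs : ∀ i : Fin N, (σ / stdDev T β N i) ^ 2 ≤ u) (hu : u ≤ 1) :
    |∫ p, weight T β G p.1 * acc (logRatio T β alg σ p.1 p.2) ∂(pairLaw (Fin N × Fin d)) -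
        2 * cdf (gaussianReal 0 1) (-(Real.sqrt V / 2))| ≤
      (fun u v => M * (Real.sqrt (sqVar * (u * v)) + Real.sqrt (sqVar * (u * v)) + |V - v| / 2 +
        Real.sqrt (Real.sqrt (sqVar * (u * v)) + (u * v + |v - V|)))) u
          (∑ k : Fin N × Fin d, alg.rate (σ / stdDev T β N k.1)) := by
  set v := ∑ k : Fin N × Fin d, alg.rate (σ / stdDev T β N k.1) with hv
  have hM0 : 0 ≤ M := (weight_pos hT hG 0).le.trans (hM 0)
  have hκ := sqVar_nonneg
  refine (abs_integral_acc_quadForm_sub_le _ _ _ (measurable_weight hG)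
    (fun ξ => (weight_pos hT hG ξ).le) hM (integral_weight hT hβ hG) hV).trans ?_
  refine mul_le_mul_of_nonneg_left ?_ hM0
  have hsum : ∀ f : Fin N × Fin d → ℝ, (∀ k, f k ≤ u * alg.rate (σ / stdDev T β N k.1)) →
      ∑ k, f k ≤ u * v := fun f hf => by
    rw [hv, Finset.mul_sum]
    exact Finset.sum_le_sum fun k _ => hf k
  have hB := hsum _ fun k => alg.coefB_sq_le (hs k.1) hu
  have hC := hsum _ fun k => alg.coefC_sq_le (hs k.1)
  have hA := hsum _ fun k => alg.coefA_pow_four_le (hs k.1) hu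
  have hA' := hsum _ fun k => alg.abs_coefA_sq_sub_le (hs k.1) hu
  have hBC : ∑ k : Fin N × Fin d, (alg.coefB (σ / stdDev T β N k.1) +
      alg.coefC (σ / stdDev T β N k.1)) = -(v / 2) := by
    simp_rw [Algorithm.coefB_add_coefC]
    rw [Finset.sum_neg_distrib, ← Finset.sum_div]
  have hA2 : |∑ k : Fin N × Fin d, alg.coefA (σ / stdDev T β N k.1) ^ 2 - V| ≤
      u * v + |v - V| := by
    refine (abs_sub_le _ v _).trans (add_le_add_left ?_ _)
    rw [hv, ← Finset.sum_sub_distrib]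
    exact (Finset.abs_sum_le_sum_abs _ _).trans hA'
  have hBC' : |-(v / 2) + V / 2| = |V - v| / 2 := by
    rw [show -(v / 2) + V / 2 = (V - v) / 2 by ring, abs_div, abs_two]
  rw [hBC, hBC']
  gcongr

lemma integrable_weighted_acc {N : ℕ} (hT : 0 < T) (hG : GrowthCondition G)
    {M : ℝ} (hM : ∀ ξ : State d N, weight T β G ξ ≤ M) {f : State d N × State d N → ℝ}
    (hf : Measurable f) :
    Integrable (fun p => weight T β G p.1 * acc (f p)) (pairLaw (Fin N × Fin d)) := by
  have hw := measurable_weight (N := N) (T := T) (β := β) hG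
  refine Integrable.of_bound (by fun_prop) M (ae_of_all _ fun p => ?_)
  rw [Real.norm_eq_abs, abs_mul, abs_of_nonneg (weight_pos hT hG _).le]
  exact (mul_le_of_le_one_right (weight_pos hT hG _).le (abs_acc_le _)).trans (hM _)

/-- The limit of the average acceptance probability, at or above the critical scaling. -/
theorem tendsto_meanAcceptance (hd : 1 ≤ d) (hT : 0 < T) (hβ : 0 < β) (hG : GrowthCondition G)
    (hl : 0 < l) (hρ : 2 < ρ) {V : ℝ} (hV : 0 ≤ V)
    (hrate : Tendsto (totalRate d T β alg l ρ) atTop (𝓝 V)) :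
    Tendsto (meanAcceptance T β G alg l ρ) atTop
      (𝓝 (2 * cdf (gaussianReal 0 1) (-(Real.sqrt V / 2)))) := by
  obtain ⟨M, hM0, hM⟩ := exists_weight_le hT hβ hG
  obtain ⟨K, hK, hdrop⟩ := exists_potentialDrop_le hT hβ hG
  have hu := tendsto_relStep (T := T) (β := β) (l := l) hd hρ
  have hε := tendsto_stepSize_mul_sqrt (l := l) hd hρ
  set F : ℝ → ℝ → ℝ := fun u v => M * (Real.sqrt (sqVar * (u * v)) +
    Real.sqrt (sqVar * (u * v)) + |V - v| / 2 +
    Real.sqrt (Real.sqrt (sqVar * (u * v)) + (u * v + |v - V|))) with hF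
  have hFc : Continuous fun q : ℝ × ℝ => F q.1 q.2 := by
    simp only [hF]; fun_prop
  have hFlim : Tendsto (fun N => F (relStep d T β l ρ N) (totalRate d T β alg l ρ N)) atTop
      (𝓝 0) := by
    have := (hFc.tendsto (0, V)).comp (hu.prodMk_nhds hrate)
    simpa [hF, Function.comp_def] using this
  have hbound : Tendsto (fun N : ℕ => M * (K * (stepSize d N l ρ * Real.sqrt N)) +
      F (relStep d T β l ρ N) (totalRate d T β alg l ρ N)) atTop (𝓝 0) := by
    simpa using ((hε.const_mul K).const_mul M).add hFlim
  rw [tendsto_iff_norm_sub_tendsto_zero]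
  refine squeeze_zero' (Eventually.of_forall fun _ => norm_nonneg _) ?_ hbound
  filter_upwards [eventually_ge_atTop 1, hu.eventually (eventually_le_nhds one_pos),
    hε.eventually (eventually_le_nhds one_pos)] with N hN huN hεN
  have hσ := stepSize_pos (ρ := ρ) hd hN hl
  have hs : ∀ i : Fin N, (stepSize d N l ρ / stdDev T β N i) ^ 2 ≤ relStep d T β l ρ N :=
    fun i => sq_step_le hT hβ i
  have hdr : ∀ i : Fin N, |alg.drift (stepSize d N l ρ / stdDev T β N i)| ≤ 1 := fun i =>
    (alg.abs_drift_le (hs i)).trans (Real.sqrt_le_one.2 huN)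
  obtain ⟨Y, hYi, hY, hYb⟩ := hdrop N alg (stepSize d N l ρ) hσ.le hεN hdr
  rw [Real.norm_eq_abs, meanAcceptance_eq hT hβ hG hσ]
  refine (abs_sub_le _ (∫ p, weight T β G p.1 * acc (logRatio T β alg (stepSize d N l ρ) p.1 p.2)
    ∂(pairLaw (Fin N × Fin d))) _).trans (add_le_add ?_ ?_)
  · rw [← integral_sub
      (integrable_weighted_acc hT hG (hM N).1
        (measurable_logRatio_add_potentialDrop hG))
      (integrable_weighted_acc hT hG (hM N).1 measurable_logRatio)]
    simp_rw [← mul_sub]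
    refine (abs_integral_weighted_le (w := fun p : State d N × State d N => weight T β G p.1)
      (fun p => (weight_pos hT hG _).le) (fun p => (hM N).1 _) (fun p => ?_) hYi).trans
      (mul_le_mul_of_nonneg_left hYb hM0.le)
    refine (abs_acc_sub_le _ _).trans ?_
    rw [add_sub_cancel_left]
    exact hY p
  · exact abs_weighted_acc_sub_le hT hβ hG (hM N).1 hV hs huN

lemma integral_acc_logRatio_le {N : ℕ} (hT : 0 < T) (hβ : 0 < β)
    (hu : relStep d T β l ρ N ≤ 1) :
    ∫ p, acc (logRatio T β alg (stepSize d N l ρ) p.1 p.2) ∂(pairLaw (Fin N × Fin d)) ≤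
      Real.exp (-(totalRate d T β alg l ρ N / 16)) := by
  have hs : ∀ i : Fin N, (stepSize d N l ρ / stdDev T β N i) ^ 2 ≤ relStep d T β l ρ N :=
    fun i => sq_step_le hT hβ i
  refine (integral_acc_quadForm_le
    (fun k : Fin N × Fin d => alg.coefA (stepSize d N l ρ / stdDev T β N k.1))
    (fun k => alg.coefB (stepSize d N l ρ / stdDev T β N k.1))
    (fun k => alg.coefC (stepSize d N l ρ / stdDev T β N k.1))
    (fun k => alg.coefB_lt_one (hs k.1) hu) fun k => ?_).trans ?_
  · rw [alg.coef_det]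
    linarith [alg.rate_nonneg (stepSize d N l ρ / stdDev T β N k.1)]
  · rw [totalRate, Finset.sum_div, ← Finset.sum_neg_distrib, Real.exp_sum]
    refine Finset.prod_le_prod (fun k _ => inv_nonneg.2 (Real.sqrt_nonneg _)) fun k _ => ?_
    rw [alg.coef_det]
    set r := alg.rate (stepSize d N l ρ / stdDev T β N k.1)
    have hr0 : 0 ≤ r := alg.rate_nonneg _
    have hr1 : r ≤ 1 := (alg.rate_le (hs k.1) hu).trans hu
    rw [Real.exp_neg]
    refine inv_anti₀ (Real.exp_pos _) (Real.le_sqrt_of_sq_le ?_)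
    rw [← Real.exp_nat_mul]
    -- Since 0 ≤ r ≤ 1, the second-order bound gives e^{r/8} ≤ 1 + r/8 + (r/8)² ≤ 1 + r/4, that is
    -- (1 + r/4)^{-1/2} ≤ e^{-r/16}.
    have h := Real.abs_exp_sub_one_sub_id_le (x := r / 8) (by rw [abs_of_nonneg] <;> linarith)
    have h' := (abs_le.1 h).2
    have e : ((2 : ℕ) : ℝ) * (r / 16) = r / 8 := by push_cast; ring
    rw [e]
    nlinarith

/-- Below the critical scaling the average acceptance probability decays faster than any power. -/
theorem tendsto_rpow_mul_meanAcceptance (hd : 1 ≤ d) (hT : 0 < T) (hβ : 0 < β)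
    (hG : GrowthCondition G) (hl : 0 < l) (hρ : 2 < ρ) (hρ' : ρ < 2 * 1 + alg.index) (p : ℝ) :
    Tendsto (fun N : ℕ => ((d * N : ℕ) : ℝ) ^ p * meanAcceptance T β G alg l ρ N) atTop
      (𝓝 0) := by
  obtain ⟨M, hM0, hM⟩ := exists_weight_le hT hβ hG
  have hu := tendsto_relStep (T := T) (β := β) (l := l) hd hρ
  have hlim := (tendsto_rpow_mul_exp_totalRate hd hT hβ hl alg hρ' p).const_mul M
  rw [mul_zero] at hlim
  refine squeeze_zero' ?_ ?_ hlim
  · filter_upwards [eventually_ge_atTop 1] with N hN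
    rw [meanAcceptance_eq hT hβ hG (stepSize_pos hd hN hl)]
    exact mul_nonneg (by positivity) (integral_nonneg fun q =>
      mul_nonneg (weight_pos hT hG _).le (acc_nonneg _))
  · filter_upwards [eventually_ge_atTop 1, hu.eventually (eventually_le_nhds one_pos)]
      with N hN huN
    have hσ := stepSize_pos (ρ := ρ) hd hN hl
    rw [meanAcceptance_eq hT hβ hG hσ, mul_left_comm]
    refine mul_le_mul_of_nonneg_left ?_ (by positivity)
    refine le_trans ?_ (mul_le_mul_of_nonneg_left
      (integral_acc_logRatio_le (alg := alg) hT hβ huN) hM0.le)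
    rw [← integral_const_mul]
    refine integral_mono (integrable_weighted_acc hT hG (hM N).1
      (measurable_logRatio_add_potentialDrop hG)) ?_ fun q => (hM N).2 _ _ _ _
    refine Integrable.const_mul (Integrable.of_bound ?_ 1 (ae_of_all _ fun q => abs_acc_le _)) _
    exact (measurable_acc.comp measurable_logRatio).aestronglyMeasurable

/-! ### The mean squared jump distance -/

/-- The difference between the scaled squared jump and the average acceptance probability. -/
lemma abs_jump_sub_acceptance_le {N : ℕ} (hT : 0 < T) (hG : GrowthCondition G)
    {M u σ η K : ℝ} (hM : ∀ ξ : State d N, weight T β G ξ ≤ M)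
    (hs : ∀ i : Fin N, (σ / stdDev T β N i) ^ 2 ≤ u) (hu : u ≤ 1)
    (hη : 0 < η) {Y : State d N × State d N → ℝ} (hYi : Integrable Y (pairLaw (Fin N × Fin d)))
    (hY : ∀ p, |potentialDrop T β G alg σ p.1 p.2| ≤ Y p)
    (hYb : ∫ p, Y p ∂(pairLaw (Fin N × Fin d)) ≤ K * η ^ 2) (k : Fin N × Fin d) :
    |∫ p, weight T β G p.1 * (acc (logRatio T β alg σ p.1 p.2 + potentialDrop T β G alg σ p.1 p.2) *
        increment T β alg σ p.1 p.2 k ^ 2) ∂(pairLaw (Fin N × Fin d)) -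
      ∫ p, weight T β G p.1 * acc (logRatio T β alg σ p.1 p.2 + potentialDrop T β G alg σ p.1 p.2)
        ∂(pairLaw (Fin N × Fin d))| ≤
      M * (3 * Real.sqrt u * (2 * fourthMoment + 2)) +
        M * ((K + (fourthMoment + 1)) * η + 3 * Real.sqrt u) := by
  have hM0 : 0 ≤ M := (weight_pos hT hG 0).le.trans (hM 0)
  have hw := measurable_weight (N := N) (T := T) (β := β) hG
  have hR : Measurable fun p : State d N × State d N => logRatio T β alg σ p.1 p.2 :=
    measurable_logRatio
  set g := alg.drift (σ / stdDev T β N k.1) with hg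
  have hg1 : |g| ≤ Real.sqrt u := alg.abs_drift_le (hs k.1)
  have hg2 : |g| ≤ 1 := hg1.trans (Real.sqrt_le_one.2 hu)
  set a : State d N × State d N → ℝ := fun p =>
    acc (logRatio T β alg σ p.1 p.2 + potentialDrop T β G alg σ p.1 p.2) with ha
  set b : State d N × State d N → ℝ := fun p => acc (logRatio T β alg σ p.1 p.2) with hb
  have ham : Measurable a := measurable_acc.comp (measurable_logRatio_add_potentialDrop hG)
  have hbm : Measurable b := measurable_acc.comp hR
  have hwi : ∀ {f : State d N × State d N → ℝ}, Measurable f →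
      Integrable f (pairLaw (Fin N × Fin d)) →
      Integrable (fun p => weight T β G p.1 * f p) (pairLaw (Fin N × Fin d)) := by
    intro f hf hfi
    refine (hfi.abs.const_mul M).mono' (by fun_prop) (ae_of_all _ fun p => ?_)
    rw [Real.norm_eq_abs, abs_mul, abs_of_nonneg (weight_pos hT hG _).le]
    exact mul_le_mul_of_nonneg_right (hM _) (abs_nonneg _)
  have hi1 := integrable_sq_increment (β := β) (alg := alg) (σ := σ) hT hG ham
    (fun p => abs_acc_le _) k
  have hi2 : Integrable (fun p => weight T β G p.1 * a p) (pairLaw (Fin N × Fin d)) :=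
    integrable_weighted_acc hT hG hM (measurable_logRatio_add_potentialDrop hG)
  have hz : Integrable (fun p : State d N × State d N => p.2 k ^ 2 - 1)
      (pairLaw (Fin N × Fin d)) := (integrable_pow_coord_snd k 2).sub (integrable_const _)
  have hi3 : Integrable (fun p => weight T β G p.1 * (b p * (p.2 k ^ 2 - 1)))
      (pairLaw (Fin N × Fin d)) := by
    refine hwi (by fun_prop) (hz.abs.mono' (by fun_prop) (ae_of_all _ fun p => ?_))
    rw [Real.norm_eq_abs, abs_mul]
    exact mul_le_of_le_one_left (abs_nonneg _) (abs_acc_le _)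
  -- The main term carries the Gaussian log-ratio alone, so that the decoupling of one coordinate
  -- applies to it; the potential drop and the drift go into the remainder.
  have hsplit : ∫ p, weight T β G p.1 * (a p * increment T β alg σ p.1 p.2 k ^ 2)
        ∂(pairLaw (Fin N × Fin d)) - ∫ p, weight T β G p.1 * a p ∂(pairLaw (Fin N × Fin d)) =
      ∫ p, weight T β G p.1 * (b p * (p.2 k ^ 2 - 1)) ∂(pairLaw (Fin N × Fin d)) +
      ∫ p, weight T β G p.1 * ((a p - b p) * (p.2 k ^ 2 - 1) +
        a p * (2 * g * p.2 k * p.1 k + g ^ 2 * p.1 k ^ 2)) ∂(pairLaw (Fin N × Fin d)) := by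
    have hi12 : Integrable (fun p => weight T β G p.1 * (a p * increment T β alg σ p.1 p.2 k ^ 2) -
        weight T β G p.1 * a p) (pairLaw (Fin N × Fin d)) := hi1.sub hi2
    rw [← sub_eq_iff_eq_add', ← integral_sub hi1 hi2, ← integral_sub hi12 hi3]
    refine integral_congr_ae (ae_of_all _ fun p => ?_)
    have : increment T β alg σ p.1 p.2 k = p.2 k + g * p.1 k := rfl
    simp only [this]
    ring
  rw [hsplit]
  refine (abs_add_le _ _).trans (add_le_add ?_ ?_)
  · refine (abs_integral_acc_mul_sq_sub_one_le _ _ _ hw (fun ξ => (weight_pos hT hG ξ).le) hM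
      k).trans ?_
    refine mul_le_mul_of_nonneg_left (mul_le_mul_of_nonneg_right
      (alg.abs_coef_sum_le (hs k.1) hu) ?_) hM0
    have : 0 ≤ fourthMoment := integral_nonneg fun u => by positivity
    positivity
  · have h4 := integrable_pow_coord_snd k 4
    have h2 := integrable_pow_coord_snd k 2
    have h2' := integrable_pow_coord_fst k 2
    have hY1 : Integrable (fun p : State d N × State d N => Y p / η)
        (pairLaw (Fin N × Fin d)) := hYi.div_const η
    have hY2 : Integrable (fun p : State d N × State d N => η * (p.2 k ^ 4 + 1))
        (pairLaw (Fin N × Fin d)) := (h4.add (integrable_const 1)).const_mul η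
    have hY12 : Integrable (fun p : State d N × State d N => Y p / η + η * (p.2 k ^ 4 + 1))
        (pairLaw (Fin N × Fin d)) := hY1.add hY2
    have hY3a : Integrable (fun p : State d N × State d N => p.2 k ^ 2 + 2 * p.1 k ^ 2)
        (pairLaw (Fin N × Fin d)) := h2.add (h2'.const_mul 2)
    have hY3 : Integrable (fun p : State d N × State d N =>
        Real.sqrt u * (p.2 k ^ 2 + 2 * p.1 k ^ 2)) (pairLaw (Fin N × Fin d)) :=
      hY3a.const_mul _
    refine (abs_integral_weighted_le (w := fun p : State d N × State d N => weight T β G p.1)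
      (Y := fun p => Y p / η + η * (p.2 k ^ 4 + 1) + Real.sqrt u * (p.2 k ^ 2 + 2 * p.1 k ^ 2))
      (fun p => (weight_pos hT hG _).le) (fun p => hM _) (fun p => ?_) (hY12.add hY3)).trans ?_
    · refine (abs_add_le _ _).trans (add_le_add ?_ ?_)
      · have e1 : |a p - b p| ≤ Y p := by
          refine (abs_acc_sub_le _ _).trans ?_
          rw [add_sub_cancel_left]
          exact hY p
        have e2 : |a p - b p| ≤ 1 := abs_acc_sub_le_one _ _
        have e0 := abs_nonneg (a p - b p)
        have e3 : |a p - b p| ^ 2 ≤ Y p := by nlinarith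
        have e4 : |p.2 k ^ 2 - 1| ^ 2 ≤ p.2 k ^ 4 + 1 := by
          rw [sq_abs]; nlinarith [sq_nonneg (p.2 k)]
        rw [abs_mul]
        -- A weighted inequality between means, which separates the L¹-small drop from the unbounded
        -- noise. The square of |a - b| is controlled by Y because |a - b| is at most 1 and at most
        -- Y.
        have e5 : |a p - b p| * |p.2 k ^ 2 - 1| ≤
            |a p - b p| ^ 2 / η + η * |p.2 k ^ 2 - 1| ^ 2 := by
          have e6 : |a p - b p| ^ 2 / η + η * |p.2 k ^ 2 - 1| ^ 2 -
              |a p - b p| * |p.2 k ^ 2 - 1| =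
              ((|a p - b p| - η * |p.2 k ^ 2 - 1|) ^ 2 +
                |a p - b p| * (η * |p.2 k ^ 2 - 1|)) / η := by
            field_simp
            ring
          have e7 : 0 ≤ ((|a p - b p| - η * |p.2 k ^ 2 - 1|) ^ 2 +
                |a p - b p| * (η * |p.2 k ^ 2 - 1|)) / η := by positivity
          linarith
        refine e5.trans (add_le_add ?_ ?_)
        · gcongr
        · gcongr
      · rw [abs_mul]
        refine (mul_le_of_le_one_left (abs_nonneg _) (abs_acc_le _)).trans ?_
        have e1 : 2 * g * p.2 k * p.1 k + g ^ 2 * p.1 k ^ 2 =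
            g * (2 * p.2 k * p.1 k + g * p.1 k ^ 2) := by ring
        rw [e1, abs_mul]
        refine mul_le_mul hg1 ?_ (abs_nonneg _) (Real.sqrt_nonneg _)
        have e2 := abs_le.1 hg2
        rw [abs_le]
        constructor <;>
          nlinarith [sq_nonneg (p.2 k - p.1 k), sq_nonneg (p.2 k + p.1 k), sq_nonneg (p.1 k)]
    · refine mul_le_mul_of_nonneg_left ?_ hM0
      rw [integral_add hY12 hY3, integral_add hY1 hY2, integral_div, integral_const_mul,
        integral_const_mul, integral_add h4 (integrable_const 1), integral_add h2 (h2'.const_mul 2),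
        integral_const_mul, integral_pow_coord_snd, integral_pow_coord_snd, integral_pow_coord_fst,
        integral_sq_gaussian]
      simp only [integral_const, probReal_univ, smul_eq_mul, one_mul, fourthMoment]
      have e1 : (∫ p, Y p ∂(pairLaw (Fin N × Fin d))) / η ≤ K * η := by
        rw [div_le_iff₀ hη]
        linarith
      linarith

/-- At and above the critical scaling the squared jump distance is asymptotically the product of
the squared step-size and of the average acceptance probability. -/
theorem isLittleO_meanSquaredJump (hd : 1 ≤ d) (hT : 0 < T) (hβ : 0 < β) (hG : GrowthCondition G)
    (hl : 0 < l) (hρ : 2 < ρ) {A : ℝ}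
    (hA : Tendsto (meanAcceptance T β G alg l ρ) atTop (𝓝 A)) (i : ℕ) (j : Fin d) :
    (fun N : ℕ => meanSquaredJump T β G alg l ρ i j N - l ^ 2 * A * ((d * N : ℕ) : ℝ) ^ (-ρ))
      =o[atTop] fun N : ℕ => ((d * N : ℕ) : ℝ) ^ (-ρ) := by
  obtain ⟨M, hM0, hM⟩ := exists_weight_le hT hβ hG
  obtain ⟨K, hK, hdrop⟩ := exists_potentialDrop_le hT hβ hG
  have hu := tendsto_relStep (T := T) (β := β) (l := l) hd hρ
  have hε := tendsto_stepSize_mul_sqrt (l := l) hd hρ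
  have hsu := (Real.continuous_sqrt.tendsto 0).comp hu
  have hsε := (Real.continuous_sqrt.tendsto 0).comp hε
  rw [Real.sqrt_zero] at hsu hsε
  set E : ℕ → ℝ := fun N => M * (3 * Real.sqrt (relStep d T β l ρ N) * (2 * fourthMoment + 2)) +
    M * ((K + (fourthMoment + 1)) * Real.sqrt (stepSize d N l ρ * Real.sqrt N) +
      3 * Real.sqrt (relStep d T β l ρ N)) with hE
  have hElim : Tendsto E atTop (𝓝 0) := by
    have h1 := ((hsu.const_mul 3).mul_const (2 * fourthMoment + 2)).const_mul M
    have h2 := ((hsε.const_mul (K + (fourthMoment + 1))).add (hsu.const_mul 3)).const_mul M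
    simpa [hE, Function.comp_def] using h1.add h2
  have hsum : Tendsto (fun N => l ^ 2 * (E N + ‖meanAcceptance T β G alg l ρ N - A‖)) atTop
      (𝓝 0) := by
    have h1 := tendsto_iff_norm_sub_tendsto_zero.1 hA
    simpa using (hElim.add h1).const_mul (l ^ 2)
  refine IsLittleO.of_bound fun c hc => ?_
  filter_upwards [eventually_gt_atTop i, eventually_ge_atTop 1,
    hu.eventually (eventually_le_nhds one_pos), hε.eventually (eventually_le_nhds one_pos),
    hsum.eventually (eventually_le_nhds hc)] with N hi hN huN hεN hcN
  have hσ := stepSize_pos (ρ := ρ) hd hN hl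
  have hN' : (0 : ℝ) < N := by exact_mod_cast hN
  have hs : ∀ i : Fin N, (stepSize d N l ρ / stdDev T β N i) ^ 2 ≤ relStep d T β l ρ N :=
    fun i => sq_step_le hT hβ i
  have hdr : ∀ i : Fin N, |alg.drift (stepSize d N l ρ / stdDev T β N i)| ≤ 1 := fun i =>
    (alg.abs_drift_le (hs i)).trans (Real.sqrt_le_one.2 huN)
  obtain ⟨Y, hYi, hY, hYb⟩ := hdrop N alg (stepSize d N l ρ) hσ.le hεN hdr
  -- The weight η is the square root of the L¹ size σ√N of the potential drop: it balances the terms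
  -- of order σ√N/η and η, which both tend to 0.
  have hη : 0 < Real.sqrt (stepSize d N l ρ * Real.sqrt N) :=
    Real.sqrt_pos.2 (mul_pos hσ (Real.sqrt_pos.2 hN'))
  have hjump := abs_jump_sub_acceptance_le (K := K) hT hG (hM N).1 hs huN hη hYi hY
    (by rwa [Real.sq_sqrt (by positivity)]) (⟨i, hi⟩, j)
  rw [← meanAcceptance_eq hT hβ hG hσ] at hjump
  have hJ := meanSquaredJump_eq (alg := alg) hT hβ hG hσ hi j
  set J := ∫ p, weight T β G p.1 * (acc (logRatio T β alg (stepSize d N l ρ) p.1 p.2 +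
        potentialDrop T β G alg (stepSize d N l ρ) p.1 p.2) *
          increment T β alg (stepSize d N l ρ) p.1 p.2 (⟨i, hi⟩, j) ^ 2)
          ∂(pairLaw (Fin N × Fin d))
  have hn : (0 : ℝ) ≤ ((d * N : ℕ) : ℝ) ^ (-ρ) := by positivity
  have e1 : meanSquaredJump T β G alg l ρ i j N - l ^ 2 * A * ((d * N : ℕ) : ℝ) ^ (-ρ) =
      l ^ 2 * ((J - meanAcceptance T β G alg l ρ N) + (meanAcceptance T β G alg l ρ N - A)) *
        ((d * N : ℕ) : ℝ) ^ (-ρ) := by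
    rw [hJ, stepSize_sq]
    ring
  rw [e1, norm_mul, norm_mul, Real.norm_of_nonneg (sq_nonneg l)]
  refine mul_le_mul_of_nonneg_right (le_trans ?_ hcN) (norm_nonneg _)
  refine mul_le_mul_of_nonneg_left ((norm_add_le _ _).trans (add_le_add_left ?_ _)) (sq_nonneg l)
  exact hjump

/-- Below the critical scaling the squared jump distance decays faster than any power. -/
theorem isBigO_meanSquaredJump (hd : 1 ≤ d) (hT : 0 < T) (hβ : 0 < β) (hG : GrowthCondition G)
    (hl : 0 < l) (hρ : 2 < ρ) (hρ' : ρ < 2 * 1 + alg.index) (p : ℝ) (i : ℕ) (j : Fin d) :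
    (fun N : ℕ => meanSquaredJump T β G alg l ρ i j N)
      =O[atTop] fun N : ℕ => ((d * N : ℕ) : ℝ) ^ (-p) := by
  obtain ⟨M, hM0, hM⟩ := exists_weight_le hT hβ hG
  have hu := tendsto_relStep (T := T) (β := β) (l := l) hd hρ
  -- The power is doubled because the unbounded increment is split off with weights n^p and n^{-p}.
  have hlim := tendsto_rpow_mul_exp_totalRate hd hT hβ hl alg hρ' (p + p)
  refine IsBigO.of_bound (l ^ 2 * (M * (1 + 16 * fourthMoment))) ?_
  filter_upwards [eventually_gt_atTop i, eventually_ge_atTop 1,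
    hu.eventually (eventually_le_nhds one_pos), hlim.eventually (eventually_le_nhds one_pos)]
    with N hi hN huN hexp
  have hσ := stepSize_pos (ρ := ρ) hd hN hl
  have hn : (0 : ℝ) < ((d * N : ℕ) : ℝ) := by exact_mod_cast Nat.mul_pos hd hN
  have hn1 : (1 : ℝ) ≤ ((d * N : ℕ) : ℝ) := by exact_mod_cast Nat.mul_pos hd hN
  have hs : ∀ i : Fin N, (stepSize d N l ρ / stdDev T β N i) ^ 2 ≤ relStep d T β l ρ N :=
    fun i => sq_step_le hT hβ i
  rw [meanSquaredJump_eq hT hβ hG hσ hi j]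
  set σ := stepSize d N l ρ
  set k : Fin N × Fin d := (⟨i, hi⟩, j)
  set n : ℝ := ((d * N : ℕ) : ℝ)
  have hnp : 0 < n ^ p := Real.rpow_pos_of_pos hn p
  have hnp' : 0 < n ^ (-p) := Real.rpow_pos_of_pos hn _
  set g := alg.drift (σ / stdDev T β N k.1) with hg
  have hg1 : |g| ≤ 1 := (alg.abs_drift_le (hs k.1)).trans (Real.sqrt_le_one.2 huN)
  have hi1 := integrable_sq_increment (β := β) (alg := alg) (σ := σ) hT hG
    (a := fun p => acc (logRatio T β alg σ p.1 p.2 + potentialDrop T β G alg σ p.1 p.2))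
    (measurable_acc.comp (measurable_logRatio_add_potentialDrop hG)) (fun p => abs_acc_le _) k
  have hacc : Integrable (fun q : State d N × State d N => n ^ p * acc (logRatio T β alg σ q.1 q.2))
      (pairLaw (Fin N × Fin d)) := by
    refine Integrable.const_mul (Integrable.of_bound ?_ 1 (ae_of_all _ fun q => abs_acc_le _)) _
    exact (measurable_acc.comp measurable_logRatio).aestronglyMeasurable
  have h4 : Integrable (fun q : State d N × State d N => q.2 k ^ 4 + q.1 k ^ 4)
      (pairLaw (Fin N × Fin d)) := (integrable_pow_coord_snd k 4).add (integrable_pow_coord_fst k 4)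
  have h4' : Integrable (fun q : State d N × State d N =>
      n ^ (-p) * (8 * (q.2 k ^ 4 + q.1 k ^ 4))) (pairLaw (Fin N × Fin d)) :=
    (h4.const_mul 8).const_mul _
  have hle : ∫ q, weight T β G q.1 * (acc (logRatio T β alg σ q.1 q.2 +
        potentialDrop T β G alg σ q.1 q.2) * increment T β alg σ q.1 q.2 k ^ 2)
          ∂(pairLaw (Fin N × Fin d)) ≤ M * ((1 + 16 * fourthMoment) * n ^ (-p)) := by
    refine (integral_mono hi1 ((hacc.add h4').const_mul M) fun q => ?_).trans ?_
    · have e1 := mul_le_mul_of_nonneg_right ((hM N).2 alg σ q.1 q.2)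
        (sq_nonneg (increment T β alg σ q.1 q.2 k))
      simp only [Pi.add_apply]
      rw [← mul_assoc]
      refine e1.trans ?_
      rw [mul_assoc]
      refine mul_le_mul_of_nonneg_left ?_ hM0.le
      set a := acc (logRatio T β alg σ q.1 q.2)
      have ha0 : 0 ≤ a := acc_nonneg _
      have ha1 : a ≤ 1 := acc_le_one _
      have einc : increment T β alg σ q.1 q.2 k = q.2 k + g * q.1 k := rfl
      rw [einc]
      set y := q.2 k + g * q.1 k with hy
      have e4 : y ^ 4 ≤ 8 * (q.2 k ^ 4 + q.1 k ^ 4) := by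
        have f1 : y ^ 2 ≤ 2 * (q.2 k ^ 2 + q.1 k ^ 2) := by
          have f2 : g ^ 2 ≤ 1 := (sq_le_one_iff_abs_le_one g).2 hg1
          have f3 : g ^ 2 * q.1 k ^ 2 ≤ q.1 k ^ 2 := mul_le_of_le_one_left (sq_nonneg _) f2
          rw [hy]
          nlinarith [sq_nonneg (q.2 k - g * q.1 k)]
        have f4 := pow_le_pow_left₀ (sq_nonneg y) f1 2
        nlinarith [sq_nonneg (q.2 k ^ 2 - q.1 k ^ 2)]
      have e5 : n ^ p * n ^ (-p) = 1 := by rw [← Real.rpow_add hn]; simp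
      -- The mean of a is at most n^{-2p} and y has bounded fourth moment, so both terms have mean
      -- O(n^{-p}).
      have e6 : a * y ^ 2 ≤ n ^ p * a + n ^ (-p) * y ^ 4 := by
        have f1 : a ^ 2 ≤ a := by nlinarith
        have f2 : n ^ p * a ^ 2 ≤ n ^ p * a := mul_le_mul_of_nonneg_left f1 hnp.le
        have f3 : n ^ p * a ^ 2 + n ^ (-p) * y ^ 4 - 2 * (a * y ^ 2) =
            n ^ (-p) * (n ^ p * a - y ^ 2) ^ 2 := by
          linear_combination (-(n ^ p * a ^ 2) + 2 * a * y ^ 2) * e5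
        have f4 : 0 ≤ n ^ (-p) * (n ^ p * a - y ^ 2) ^ 2 := by positivity
        have f5 : 0 ≤ a * y ^ 2 := by positivity
        linarith
      refine e6.trans (add_le_add_right ?_ _)
      exact mul_le_mul_of_nonneg_left e4 hnp'.le
    · rw [integral_const_mul, integral_add' hacc h4', integral_const_mul, integral_const_mul,
        integral_const_mul, integral_add (integrable_pow_coord_snd k 4)
        (integrable_pow_coord_fst k 4), integral_pow_coord_snd, integral_pow_coord_fst]
      refine mul_le_mul_of_nonneg_left ?_ hM0.le
      have e1 := integral_acc_logRatio_le (alg := alg) hT hβ huN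
      have e2 := mul_le_mul_of_nonneg_left e1 hnp.le
      have e3 : n ^ p * Real.exp (-(totalRate d T β alg l ρ N / 16)) ≤ n ^ (-p) := by
        have f1 : n ^ (p + p) * Real.exp (-(totalRate d T β alg l ρ N / 16)) ≤ 1 := hexp
        rw [Real.rpow_add hn, mul_assoc] at f1
        rw [Real.rpow_neg hn.le, ← one_div, le_div_iff₀ hnp]
        linarith
      have e4 : (∫ u : ℝ, u ^ 4 ∂(gaussianReal 0 1)) = fourthMoment := rfl
      rw [e4]
      have e5 := e2.trans e3
      nlinarith
  have hσl : σ ^ 2 ≤ l ^ 2 := by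
    rw [stepSize_sq]
    exact mul_le_of_le_one_right (sq_nonneg l)
      (Real.rpow_le_one_of_one_le_of_nonpos hn1 (by linarith))
  have hnn : 0 ≤ ∫ q, weight T β G q.1 * (acc (logRatio T β alg σ q.1 q.2 +
        potentialDrop T β G alg σ q.1 q.2) * increment T β alg σ q.1 q.2 k ^ 2)
          ∂(pairLaw (Fin N × Fin d)) := integral_nonneg fun q =>
    mul_nonneg (weight_pos hT hG _).le (mul_nonneg (acc_nonneg _) (sq_nonneg _))
  rw [Real.norm_of_nonneg (mul_nonneg (sq_nonneg _) hnn), Real.norm_of_nonneg hnp'.le]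
  refine (mul_le_mul hσl hle hnn (sq_nonneg l)).trans (le_of_eq ?_)
  ring

end Limits

end DiffusionBridge

end

/-! ### The three scaling regimes -/

theorem proposition2 (d : ℕ) (hd : 1 ≤ d) (T β : ℝ) (hT : 0 < T) (hβ : 0 < β)
    (G : EuclideanSpace ℝ (Fin d) → ℝ) (hG : DiffusionBridge.GrowthCondition G)
    (alg : DiffusionBridge.Algorithm) (l ρ : ℝ) (hl : 0 < l) (hρ : 0 < ρ) :
    -- the target is a probability measure and the expectations `S_n` are finite
    (∀ N : ℕ, IsProbabilityMeasure (DiffusionBridge.target N T β G) ∧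
      ∀ k : Fin N × Fin d, Integrable (DiffusionBridge.squaredJump T β G alg l ρ k)
        (DiffusionBridge.stationaryLaw N T β G)) ∧
    -- average acceptance probability, with `κ = 1`, `n = d * N` and `N → ∞`
    (ρ = 2 * 1 + alg.index →
      Tendsto (DiffusionBridge.meanAcceptance T β G alg l ρ) atTop
        (𝓝 (DiffusionBridge.limitAcceptance d T β alg l))) ∧
    (2 * 1 + alg.index < ρ →
      Tendsto (DiffusionBridge.meanAcceptance T β G alg l ρ) atTop (𝓝 1)) ∧
    (2 * 1 < ρ → ρ < 2 * 1 + alg.index → ∀ p : ℝ, 0 ≤ p →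
      Tendsto (fun N : ℕ => ((d * N : ℕ) : ℝ) ^ p *
        DiffusionBridge.meanAcceptance T β G alg l ρ N) atTop (𝓝 0)) ∧
    -- mean squared-jump-distance of an arbitrary fixed coordinate
    ∀ (i : ℕ) (j : Fin d),
      (ρ = 2 * 1 + alg.index →
        (fun N : ℕ => DiffusionBridge.meanSquaredJump T β G alg l ρ i j N -
            l ^ 2 * DiffusionBridge.limitAcceptance d T β alg l *
              ((d * N : ℕ) : ℝ) ^ (-(2 * 1 + alg.index)))
          =o[atTop] fun N : ℕ => ((d * N : ℕ) : ℝ) ^ (-(2 * 1 + alg.index))) ∧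
      (2 * 1 + alg.index < ρ →
        (fun N : ℕ => DiffusionBridge.meanSquaredJump T β G alg l ρ i j N -
            l ^ 2 * ((d * N : ℕ) : ℝ) ^ (-ρ))
          =o[atTop] fun N : ℕ => ((d * N : ℕ) : ℝ) ^ (-ρ)) ∧
      (2 * 1 < ρ → ρ < 2 * 1 + alg.index → ∀ p : ℝ, 0 ≤ p →
        (fun N : ℕ => DiffusionBridge.meanSquaredJump T β G alg l ρ i j N)
          =O[atTop] fun N : ℕ => ((d * N : ℕ) : ℝ) ^ (-p)) := by
  have hidx : 0 < alg.index := by cases alg <;> norm_num [DiffusionBridge.Algorithm.index]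
  have hcrit : ρ = 2 * 1 + alg.index →
      Tendsto (DiffusionBridge.meanAcceptance T β G alg l ρ) atTop
        (𝓝 (DiffusionBridge.limitAcceptance d T β alg l)) := by
    intro h
    rw [DiffusionBridge.limitAcceptance_eq hl]
    exact DiffusionBridge.tendsto_meanAcceptance hd hT hβ hG hl (by linarith)
      (DiffusionBridge.limitRate_pos hd hT hβ hl alg).le
      (DiffusionBridge.tendsto_totalRate_of_eq hd hT hβ alg h)
  have hsuper : 2 * 1 + alg.index < ρ →
      Tendsto (DiffusionBridge.meanAcceptance T β G alg l ρ) atTop (𝓝 1) := by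
    intro h
    -- Here V = 0: the log-ratio degenerates to 0 and the general limit becomes 2Φ(0) = 1.
    have := DiffusionBridge.tendsto_meanAcceptance hd hT hβ hG hl (by linarith) le_rfl
      (DiffusionBridge.tendsto_totalRate_of_lt (l := l) hd hT hβ alg h)
    rwa [DiffusionBridge.two_mul_cdf_zero] at this
  refine ⟨fun N => ⟨DiffusionBridge.isProbabilityMeasure_target hT hG, fun k => ?_⟩, hcrit, hsuper,
    fun h1 h2 p _ => DiffusionBridge.tendsto_rpow_mul_meanAcceptance hd hT hβ hG hl
      (by linarith) h2 p, fun i j => ⟨fun h => ?_, fun h => ?_, fun h1 h2 p _ =>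
      DiffusionBridge.isBigO_meanSquaredJump hd hT hβ hG hl (by linarith) h2 p i j⟩⟩
  · exact DiffusionBridge.integrable_squaredJump hT hβ hG
      (DiffusionBridge.stepSize_pos hd (Nat.one_le_iff_ne_zero.2 k.1.pos.ne') hl) k
  · rw [← h]
    exact DiffusionBridge.isLittleO_meanSquaredJump hd hT hβ hG hl (by linarith) (hcrit h) i j
  · have := DiffusionBridge.isLittleO_meanSquaredJump hd hT hβ hG hl (by linarith) (hsuper h) i j
    simpa only [mul_one] using this
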